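/- **Setting.** Let $V=\mathbb R^2$ with area form $\omega_V$, and let $W=V\otimes V$ with the symmetric bilinear form $\langle\cdot,\cdot\rangle=-\omega_V\otimes\omega_V$ of signature $(2,2)$ and the volume form $\det$ for which the basis $(e_1\otimes e_1,\,e_1\otimes e_2,\,e_2\otimes e_1,\,e_2\otimes e_2)$ has volume $1$. Let $\mathbf{Ein}^{1,1}\subset\mathbf P(W)$ be the set of isotropic lines, identified with $\mathbf{RP}^1\times\mathbf{RP}^1$ by $([v],[w])\mapsto[v\otimes w]$, and let $\tau$ be its tautological line bundle. The split annulus is $\mathbf A=(\mathbf{RP}^1\times\mathbf{RP}^1)\setminus\Delta$. On $\mathbf A$ and on $\mathbf{Ein}^{1,1}$, let $\mathcal L_i$ ($i=1,2$) be the foliation by the fibres of the projection to the $i$-th factor. Let $x,y$ be the angular coordinates on the two factors (where $t\mapsto[\cos t:\sin t]$); $\mathbf A$ is oriented by the split frame $(\partial_y,\partial_x)$, tangent to $(\mathcal L_1,\mathcal L_2)$. A *metric* on $\mathbf A$ is a Lorentz metric $g$ compatible with the split structure: $g(\partial_x,\partial_x)=g(\partial_y,\partial_y)=0$ and $g(\partial_x,\partial_y)>0$.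 An *admissible immersion* is a smooth immersion $\psi:\mathbf A\to\mathbf{Ein}^{1,1}$ such that $\psi^*\tau$ is trivial and the split structure induced by $\psi$ is that of $\mathbf A$: $\psi$ maps leaves of $\mathcal L_i$ into leaves of $\mathcal L_i$ for $i=1,2$, and $\langle \mathrm D_{\partial_y}s,\mathrm D_{\partial_x}s\rangle>0$ for local lifts $s$ of $\psi$ to $W\setminus\{0\}$. **Epstein surfaces.** Let $\mathsf U\mathbf H^{2,1}_+=\{(x,n)\in W\times W:\langle x,x\rangle=-1,\ \langle n,n\rangle=1,\ \langle x,n\rangle=0\}$ be the spacelike unit tangent bundle of $\mathbf H^{2,1}_+=\{x\in W:\langle x,x\rangle=-1\}$. A *holonomic surface* is an immersion $(x,n):\mathbf A\to\mathsf U\mathbf H^{2,1}_+$ with $\langle n,\mathrm D_ux\rangle=\langle x,\mathrm D_un\rangle=0$ for every tangent vector $u$. Given an admissible $\psi$ and a metric $g$, let $\sigma:\mathbf A\to W$ be the isotropic surface (unique up to sign) with $[\sigma]=\psi$ and $\langle\mathrm D_u\sigma,\mathrm D_v\sigma\rangle=g(u,v)$, and let $\eta$ be its dual: $\langle\eta,\sigma\rangle=1$,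 $\langle\eta,\eta\rangle=0$, $\langle\eta,\mathrm D_u\sigma\rangle=0$. The *Epstein surface* of $(\psi,g)$ is $\big(\tfrac{\sqrt2}{2}(\sigma-\eta),\tfrac{\sqrt2}{2}(\sigma+\eta)\big):\mathbf A\to\mathsf U\mathbf H^{2,1}_+$. **$\mathcal W$-volume.** A $C^k$ *lens cobordism* is a $C^k$ map $\phi:M=\mathbf A\times[0,1]\to\mathsf U\mathbf H^{2,1}_+$ such that $\phi(\cdot,0)$ and $\phi(\cdot,1)$ are holonomic surfaces and $\phi(p,t)$ is constant in $t$ for $p$ outside a compact subset of $\mathbf A$. Writing tangent vectors of $\mathsf U\mathbf H^{2,1}_+$ as $u=(u_1,u_2)$, put, at $(x,n)$, $\omega(u,v,w)=\det(x,u_1,v_1,w_1)$ and $\alpha(u,v)=\tfrac14\big(\det(x,n,u_2,v_1)+\det(x,n,u_1,v_2)\big)$. The $\mathcal W$-volume is $$\mathcal W(M,\phi)=\int_M\phi^*\omega-\int_{\partial M}\phi^*\alpha,$$ where $M$ is oriented so that $\partial M=(\mathbf A\times\{0\})\sqcup\overline{(\mathbf A\times\{1\})}$, and the boundary term means $\int_{\mathbf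 A}\big(\phi(\cdot,0)^*\alpha-\phi(\cdot,1)^*\alpha\big)$, whose integrand has compact support. **Statement.** Let $1\le k\le\infty$ and let $g_0,g_1$ be two metrics of class $C^{k+1}$ on $\mathbf A$ which are equal outside a compact subset of $\mathbf A$. Then there is a unique real number $\mathcal S(g_0,g_1)$ such that for every admissible immersion $\psi$ of $\mathbf A$ in $\mathbf{Ein}^{1,1}$: 1. there is a $C^k$ lens cobordism $\phi$ such that $\phi(\cdot,0)$ is an Epstein surface of $(\psi,g_0)$ and $\phi(\cdot,1)$ is an Epstein surface of $(\psi,g_1)$; 2. every such $\phi$ satisfies $\mathcal W(M,\phi)=\mathcal S(g_0,g_1)$. In other words, $\mathcal W_\psi(g_0,g_1):=\mathcal W(M,\phi)$ is well defined and does not depend on $\psi$, so that the Liouville action $\mathcal S(g_0,g_1)=\mathcal W_\psi(g_0,g_1)$ is well defined. -/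

import Mathlib

open scoped ContDiff

noncomputable section

namespace AdS

/-! ### The quadratic space `W = V ⊗ V` of signature `(2,2)` and the Einstein torus -/

/-- The plane `V = ℝ²`. -/
abbrev V : Type := Fin 2 → ℝ

/-- `W = V ⊗ V`, in the coordinates of the basis `e₁⊗e₁, e₁⊗e₂, e₂⊗e₁, e₂⊗e₂`. -/
abbrev W : Type := Fin 4 → ℝ

/-- The decomposable tensor `v ⊗ w`. -/
def tensor (v w : V) : W := ![v 0 * w 0, v 0 * w 1, v 1 * w 0, v 1 * w 1]

/-- The area form `ω` of `V`. -/
def areaV (v w : V) : ℝ := v 0 * w 1 - v 1 * w 0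

/-- The symmetric bilinear form `-ω ⊗ ω` of signature `(2,2)` on `W`. -/
def form (u v : W) : ℝ := u 1 * v 2 + u 2 * v 1 - u 0 * v 3 - u 3 * v 0

theorem form_tensor (v₁ v₂ w₁ w₂ : V) :
    form (tensor v₁ v₂) (tensor w₁ w₂) = -(areaV v₁ w₁ * areaV v₂ w₂) := by
  simp [form, tensor, areaV]; ring

/-- The volume form of `W`. -/
def vol (a b c d : W) : ℝ := (Matrix.of ![a, b, c, d]).det

/-- The real projective line. -/
abbrev RP1 : Type := Projectivization ℝ V

theorem tensor_ne_zero {v w : V} (hv : v ≠ 0) (hw : w ≠ 0) : tensor v w ≠ 0 := by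
  intro h
  obtain ⟨i, hi⟩ := Function.ne_iff.mp hv
  obtain ⟨j, hj⟩ := Function.ne_iff.mp hw
  have h0 := congrFun h 0
  have h1 := congrFun h 1
  have h2 := congrFun h 2
  have h3 := congrFun h 3
  simp only [tensor, Matrix.cons_val, Pi.zero_apply] at h0 h1 h2 h3 hi hj
  fin_cases i <;> fin_cases j <;> simp_all

/-- The Einstein torus: the isotropic lines of `W`. -/
def Ein : Set (Projectivization ℝ W) := {ℓ | ∀ w ∈ ℓ.submodule, form w w = 0}

/-- The Segre map `([v], [w]) ↦ [v ⊗ w]`, which identifies `RP1 × RP1` with `Ein`. -/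
def segre (a b : RP1) : Projectivization ℝ W :=
  Projectivization.mk ℝ (tensor a.rep b.rep) (tensor_ne_zero a.rep_nonzero b.rep_nonzero)

/-- The leaf over `a` of the first foliation `L₁` of `Ein`
(a fibre of the projection to the first factor). -/
def einLeaf₁ (a : RP1) : Set (Projectivization ℝ W) := {ℓ | ∃ b, ℓ = segre a b}

/-- The leaf over `b` of the second foliation `L₂` of `Ein`. -/
def einLeaf₂ (b : RP1) : Set (Projectivization ℝ W) := {ℓ | ∃ a, ℓ = segre a b}

/-! ### The split annulus

Maps on the annulus `A ⊆ RP1 × RP1` are written as functions on `RP1 × RP1` of which only the values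
on `A` are used.  The smooth structure of `RP1 × RP1` is the one for which the covering
`angles : ℝ × ℝ → RP1 × RP1` is a local diffeomorphism. -/

theorem cos_sin_ne_zero (t : ℝ) : (![Real.cos t, Real.sin t] : V) ≠ 0 := by
  intro h
  have h0 : Real.cos t = 0 := by simpa using congrFun h 0
  have h1 : Real.sin t = 0 := by simpa using congrFun h 1
  have := Real.cos_sq_add_sin_sq t
  simp [h0, h1] at this

/-- The covering `t ↦ [cos t : sin t]` of the projective line. -/
def angle (t : ℝ) : RP1 := Projectivization.mk ℝ ![Real.cos t, Real.sin t] (cos_sin_ne_zero t)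

/-- The covering of `RP1 × RP1` by the plane. -/
def angles (z : ℝ × ℝ) : RP1 × RP1 := (angle z.1, angle z.2)

/-- The split annulus `A = (RP1 × RP1) ∖ Δ`; its foliations `L₁`, `L₂` are the fibres of the
projections to the first and to the second factor. -/
def annulus : Set (RP1 × RP1) := {p | p.1 ≠ p.2}

/-- The part of the plane which covers the annulus. -/
def annulusCover : Set (ℝ × ℝ) := angles ⁻¹' annulus

/-- The split frame `(e₁, e₂)` of `A`, in angular coordinates, with `e₁` tangent to `L₁` and
`e₂` tangent to `L₂`.  It is positively oriented, and it is a global frame of `A`,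
since it is invariant under the deck transformations of `angles`. -/
def e₁ : ℝ × ℝ := (0, 1)

/-- See `e₁`. -/
def e₂ : ℝ × ℝ := (1, 0)

/-- A fundamental domain: `angles` maps it bijectively to `A`. -/
def fundDomain : Set (ℝ × ℝ) :=
  {z | 0 ≤ z.1 ∧ z.1 < Real.pi ∧ z.1 < z.2 ∧ z.2 < z.1 + Real.pi}

/-- `f` is of class `C^n` on the annulus. -/
def SmoothOnAnnulus {E : Type*} [NormedAddCommGroup E] [NormedSpace ℝ E] (n : ℕ∞)
    (f : RP1 × RP1 → E) : Prop :=
  ContDiffOn ℝ n (f ∘ angles) annulusCover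

/-- The derivative of `f` at the point `angles z`, in angular coordinates. -/
def dA {E : Type*} [NormedAddCommGroup E] [NormedSpace ℝ E]
    (f : RP1 × RP1 → E) (z : ℝ × ℝ) : ℝ × ℝ →L[ℝ] E :=
  fderiv ℝ (f ∘ angles) z

/-- `K` is a compact subset of the annulus. -/
def IsCompactInAnnulus (K : Set (RP1 × RP1)) : Prop :=
  ∃ C : Set (ℝ × ℝ), C ⊆ annulusCover ∧ IsCompact C ∧ K = angles '' C

/-- A field of bilinear forms on the tangent spaces of `A`, in the angular frame. -/
abbrev BilinField : Type := RP1 × RP1 → ℝ × ℝ →L[ℝ] ℝ × ℝ →L[ℝ] ℝ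

/-- `g` is a `C^n` Lorentz metric on `A` compatible with its split structure: the leaves of both
foliations are isotropic, and positively oriented split bases have positive product. -/
structure IsCompatibleMetric (n : ℕ∞) (g : BilinField) : Prop where
  smooth : SmoothOnAnnulus n g
  symm : ∀ p ∈ annulus, ∀ u v, g p u v = g p v u
  isotropic₁ : ∀ p ∈ annulus, g p e₁ e₁ = 0
  isotropic₂ : ∀ p ∈ annulus, g p e₂ e₂ = 0
  pos : ∀ p ∈ annulus, 0 < g p e₁ e₂

/-- Two metrics on `A` are equal outside a compact subset of `A`. -/
def EqualOutsideCompact (g₀ g₁ : BilinField) : Prop :=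
  ∃ K, IsCompactInAnnulus K ∧ ∀ p ∈ annulus, p ∉ K → g₀ p = g₁ p

/-! ### Immersions of the annulus in the Einstein torus -/

/-- `ψ` is a smooth immersion of `A` in `Ein` whose induced split structure is that of `A`.
Smoothness and immersivity are read off from local lifts `s` of `ψ` to `W ∖ {0}`; the condition
`0 < ⟨D s e₁, D s e₂⟩`, which does not depend on the lift, says that `ψ` preserves the orientation
of split bases, that is, that the conformal class it induces is that of the metrics of `A`. -/
structure IsSplitImmersion (ψ : RP1 × RP1 → Projectivization ℝ W) : Prop where
  mem_ein : ∀ p ∈ annulus, ψ p ∈ Ein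
  immersion : ∀ z ∈ annulusCover, ∃ s : ℝ × ℝ → W,
    (∀ᶠ z' in nhds z, ContDiffAt ℝ ∞ s z' ∧
      ∃ h : s z' ≠ 0, ψ (angles z') = Projectivization.mk ℝ (s z') h) ∧
    LinearIndependent ℝ ![s z, fderiv ℝ s z e₁, fderiv ℝ s z e₂] ∧
    0 < form (fderiv ℝ s z e₁) (fderiv ℝ s z e₂)
  leaf₁ : ∀ a, ∃ a', ∀ b, (a, b) ∈ annulus → ψ (a, b) ∈ einLeaf₁ a'
  leaf₂ : ∀ b, ∃ b', ∀ a, (a, b) ∈ annulus → ψ (a, b) ∈ einLeaf₂ b'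

/-- The pull-back by `ψ` of the tautological line bundle is trivial:
it has a continuous nowhere vanishing section over `A`. -/
def TautologicalTrivial (ψ : RP1 × RP1 → Projectivization ℝ W) : Prop :=
  ∃ s : RP1 × RP1 → W, ContinuousOn (s ∘ angles) annulusCover ∧
    ∀ p ∈ annulus, ∃ h : s p ≠ 0, ψ p = Projectivization.mk ℝ (s p) h

/-! ### Isotropic, holonomic and Epstein surfaces -/

/-- `σ` is a `C^n` isotropic surface over `ψ` whose first fundamental form at infinity is `g`. -/
structure IsIsotropicSurface (n : ℕ∞) (ψ : RP1 × RP1 → Projectivization ℝ W) (g : BilinField)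
    (σ : RP1 × RP1 → W) : Prop where
  smooth : SmoothOnAnnulus n σ
  lift : ∀ p ∈ annulus, ∃ h : σ p ≠ 0, ψ p = Projectivization.mk ℝ (σ p) h
  isotropic : ∀ p ∈ annulus, form (σ p) (σ p) = 0
  transverse : ∀ z ∈ annulusCover,
    LinearIndependent ℝ ![σ (angles z), dA σ z e₁, dA σ z e₂]
  metric : ∀ z ∈ annulusCover, ∀ u v, g (angles z) u v = form (dA σ z u) (dA σ z v)

/-- `η` is the dual isotropic surface of `σ`. -/
structure IsDualSurface (σ η : RP1 × RP1 → W) : Prop where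
  pairing : ∀ p ∈ annulus, form (η p) (σ p) = 1
  isotropic : ∀ p ∈ annulus, form (η p) (η p) = 0
  orthogonal : ∀ z ∈ annulusCover, ∀ u, form (η (angles z)) (dA σ z u) = 0

/-- The spacelike unit tangent bundle of `H^{2,1}_+ = {x | ⟨x,x⟩ = -1}`: pairs `(x,n)` with
`n` a unit tangent vector at `x`. -/
def unitTangent : Set (W × W) := {q | form q.1 q.1 = -1 ∧ form q.2 q.2 = 1 ∧ form q.1 q.2 = 0}

/-- `ε = (x,n)` is a holonomic surface: a `C^n` immersion of `A` in the unit tangent bundle which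
is tangent to the contact distribution. -/
structure IsHolonomicSurface (n : ℕ∞) (ε : RP1 × RP1 → W × W) : Prop where
  smooth : SmoothOnAnnulus n ε
  mem : ∀ p ∈ annulus, ε p ∈ unitTangent
  immersion : ∀ z ∈ annulusCover, Function.Injective (dA ε z)
  contact : ∀ z ∈ annulusCover, ∀ u, form (ε (angles z)).2 (dA ε z u).1 = 0 ∧
    form (ε (angles z)).1 (dA ε z u).2 = 0

/-- `ε` is the Epstein surface of the metric `g` (of class `C^n`) and the immersion `ψ`
(determined by `g` and `ψ` up to the sign `±`). -/
def IsEpsteinSurface (n : ℕ∞) (ψ : RP1 × RP1 → Projectivization ℝ W) (g : BilinField)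
    (ε : RP1 × RP1 → W × W) : Prop :=
  ∃ σ η : RP1 × RP1 → W, IsIsotropicSurface n ψ g σ ∧ IsDualSurface σ η ∧
    ∀ p ∈ annulus, ε p =
      ((Real.sqrt 2 / 2) • (σ p - η p), (Real.sqrt 2 / 2) • (σ p + η p))

/-! ### Lens cobordisms and the `W`-volume -/

/-- The map `φ : A × [0,1] → W × W` in angular coordinates. -/
def cobordismLift (φ : RP1 × RP1 → ℝ → W × W) (q : (ℝ × ℝ) × ℝ) : W × W := φ (angles q.1) q.2

/-- `φ` is a `C^k` lens cobordism `A × [0,1] → U H^{2,1}_+`. -/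
structure IsLensCobordism (k : ℕ∞) (φ : RP1 × RP1 → ℝ → W × W) : Prop where
  smooth : ContDiffOn ℝ k (cobordismLift φ) (annulusCover ×ˢ Set.Icc (0 : ℝ) 1)
  mem : ∀ p ∈ annulus, ∀ t ∈ Set.Icc (0 : ℝ) 1, φ p t ∈ unitTangent
  holonomic₀ : IsHolonomicSurface k (fun p => φ p 0)
  holonomic₁ : IsHolonomicSurface k (fun p => φ p 1)
  constant : ∃ K, IsCompactInAnnulus K ∧
    ∀ p ∈ annulus, p ∉ K → ∀ t ∈ Set.Icc (0 : ℝ) 1, φ p t = φ p 0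

/-- `φ` is a `C^k` lens cobordism from the Epstein surface of `g₀` to that of `g₁`, both with respect
to `ψ`. -/
structure IsEpsteinCobordism (k : ℕ∞) (ψ : RP1 × RP1 → Projectivization ℝ W) (g₀ g₁ : BilinField)
    (φ : RP1 × RP1 → ℝ → W × W) : Prop where
  lens : IsLensCobordism k φ
  epstein₀ : IsEpsteinSurface (k + 1) ψ g₀ (fun p => φ p 0)
  epstein₁ : IsEpsteinSurface (k + 1) ψ g₁ (fun p => φ p 1)

/-- The pull-back to `U H^{2,1}_+` of the volume form of `H^{2,1}_+`. -/
def omegaForm (q u v w : W × W) : ℝ := vol q.1 u.1 v.1 w.1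

/-- The `2`-form `α` on `U H^{2,1}_+`. -/
def alphaForm (q u v : W × W) : ℝ := (1 / 4) * (vol q.1 q.2 u.2 v.1 + vol q.1 q.2 u.1 v.2)

/-- The density of `φ^*ω` at `(angles z, t)`, evaluated on `(-∂ₜ, e₁, e₂)`.  This is an oriented frame
of `M = A × [0,1]` for the orientation with `∂M = A × {0} ⊔ (A × {1} reversed)`. -/
def omegaDensity (φ : RP1 × RP1 → ℝ → W × W) (q : (ℝ × ℝ) × ℝ) : ℝ :=
  let D := fderivWithin ℝ (cobordismLift φ) (annulusCover ×ˢ Set.Icc (0 : ℝ) 1) q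
  omegaForm (cobordismLift φ q) (D (0, -1)) (D (e₁, 0)) (D (e₂, 0))

/-- The density of `ε^*α` at `angles z`, evaluated on the oriented frame `(e₁, e₂)` of `A`. -/
def alphaDensity (ε : RP1 × RP1 → W × W) (z : ℝ × ℝ) : ℝ :=
  alphaForm (ε (angles z)) (dA ε z e₁) (dA ε z e₂)

/-- The `W`-volume `∫_M φ^*ω - ∫_{∂M} φ^*α` of a lens cobordism; as `φ^*α` agrees on both boundary
components outside a compact set, the boundary term is the integral over `A` of the difference. -/
def wVolume (φ : RP1 × RP1 → ℝ → W × W) : ℝ :=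
  (∫ q in fundDomain ×ˢ Set.Icc (0 : ℝ) 1, omegaDensity φ q) -
    ∫ z in fundDomain,
      (alphaDensity (fun p => φ p 0) z - alphaDensity (fun p => φ p 1) z)

end AdS

end

/-!
The proof rests on a moving frame. The lift of an admissible immersion `ψ` to the isotropic cone
can be rescaled to a *normal lift* `s`, whose induced metric is the flat metric `2 dx dy`
(`exists_normalLift`). The frame `(s, s_x, s_y, s_xy)` then has constant Gram matrix, and it
satisfies `s_xx = -q s`, `s_yy = -Q s` with potentials `q = q(x)` and `Q = Q(y)`
(`dxdx_eq`, `dydy_eq`, `dy_potX`, `dx_potY`). The immersion enters only through `q` and `Q`.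

*Existence.* For `g = 2 e^{2ρ} dx dy` the isotropic surface is `± e^ρ s`, its dual is explicit in
the frame, and hence so is the Epstein surface. Interpolating linearly between `ρ₀` and `ρ₁` gives
a cobordism `epsteinMap` (`isEpsteinCobordism_epsteinMap`). An Epstein surface is unique up to a
sign (`IsEpsteinSurface.exists_sign`), and the signs at the two ends of a cobordism are the same
because the cobordism is stationary near the ends of the annulus.

*Independence of the cobordism.* The volume form of the quadric `⟨x, x⟩ = -1` is a combination of
two forms `du ∧ dv ∧ dw` with `u, v, w` functions on `W` (`vol_eq_det33`). So the difference of the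
volumes of two cobordisms with the same ends is an integral of Jacobian determinants of functions
with compact support. Cobordisms may be of class `C¹` only, so that Stokes' formula, which involves
second derivatives, is not directly available. Instead, Milnor's argument applies: for a `C¹` map `F` supported in a
ball, `x ↦ x + r F(x)` is a diffeomorphism of the ball for small `r ≥ 0`, so `∫ det (1 + r DF)` is
constant for such `r`; it is a polynomial in `r`, whose leading coefficient `∫ det DF` is therefore
zero (`integral_det3_fderiv_eq_zero`). A partition of unity under the translation by `(π, π)`
carries this over from the plane to the annulus (`integral_jac_sub_eq_zero`), and `wVolume_eq`
follows.

*Independence of the immersion.* Write `ρ = ρ₀ + t f` with `f = ρ₁ - ρ₀`, and put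
`U = ρ_xx - ρ_x² - q`, `T = ρ_yy - ρ_y² - Q`. In the frame the densities of `ω` and `α` along
`epsteinMap` are (`omegaDensity_epsteinMap`, `alphaDensity_epsteinMap`)
`½ f (e^{2ρ} + 2 ρ_xy + e^{-2ρ} (ρ_xy² - U T))` and `-¼ (e^{2ρ} - e^{-2ρ} (ρ_xy² - U T))`.
For two immersions with potentials `(q, Q)` and `(q', Q')`, let
`G = ¼ e^{-2ρ} (U T - U' T')`. The densities of `ω` differ by `-2 f G` and those of `-α` by `G`,
while
`∂_t G = -2 f G - ¼ (∂_x (e^{-2ρ} (Q - Q') f_x) + ∂_y (e^{-2ρ} (q - q') f_y))`,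
because `Q - Q'` does not depend on `x` nor `q - q'` on `y` (`hasDerivAt_alphaGap`). The divergence
integrates to zero over the annulus (`integral_flux_eq_zero`), hence the `W`-volumes are equal
(`wVolume_epsteinMap_eq`).

*Uniqueness of the number.* The inclusion of the annulus in the Einstein torus is an admissible
immersion (`isSplitImmersion_segre`, `tautologicalTrivial_segre`), so the condition which
characterises the number is not void.
-/

open scoped ContDiff
noncomputable section
open MeasureTheory Set Filter Topology

namespace AdS

/-! ### The integral of `du ∧ dv ∧ dw` for functions of class `C¹` -/

/-- The space `ℝ² × ℝ` with coordinates `((x, y), t)`. -/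
abbrev Space : Type := (ℝ × ℝ) × ℝ

/-- The determinant of three linear forms on `Space` in the standard basis: the value of
`a ∧ b ∧ c` on that basis. -/
def det3 (a b c : Space →L[ℝ] ℝ) : ℝ :=
  a ((1, 0), 0) * (b ((0, 1), 0) * c ((0, 0), 1) - b ((0, 0), 1) * c ((0, 1), 0))
  - a ((0, 1), 0) * (b ((1, 0), 0) * c ((0, 0), 1) - b ((0, 0), 1) * c ((1, 0), 0))
  + a ((0, 0), 1) * (b ((1, 0), 0) * c ((0, 1), 0) - b ((0, 1), 0) * c ((1, 0), 0))

/-- The standard coordinates of `Space`. -/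
def spaceEquiv : Space ≃ₗ[ℝ] (Fin 3 → ℝ) where
  toFun q := ![q.1.1, q.1.2, q.2]
  invFun v := ((v 0, v 1), v 2)
  left_inv q := by simp
  right_inv v := by ext i; fin_cases i <;> simp
  map_add' p q := by ext i; fin_cases i <;> simp
  map_smul' r q := by ext i; fin_cases i <;> simp

theorem det_one_add_smul (a b c : Space →L[ℝ] ℝ) (s : ℝ) :
    (1 + s • ((a.prod b).prod c) : Space →L[ℝ] Space).det =
      1 + s * (a ((1, 0), 0) + b ((0, 1), 0) + c ((0, 0), 1)) +
        s ^ 2 * (a ((1, 0), 0) * b ((0, 1), 0) - a ((0, 1), 0) * b ((1, 0), 0) +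
          (a ((1, 0), 0) * c ((0, 0), 1) - a ((0, 0), 1) * c ((1, 0), 0)) +
          (b ((0, 1), 0) * c ((0, 0), 1) - b ((0, 0), 1) * c ((0, 1), 0))) +
        s ^ 3 * det3 a b c := by
  have h := LinearMap.det_conj ((1 + s • ((a.prod b).prod c) : Space →L[ℝ] Space) : Space →ₗ[ℝ] Space) spaceEquiv
  rw [ContinuousLinearMap.det, ← h, ← LinearMap.det_toMatrix', Matrix.det_fin_three]
  simp [LinearMap.toMatrix'_apply, spaceEquiv, det3]
  ring

/-- For a `C¹` map `F` supported in a ball and small `s ≥ 0`, the map `x ↦ x + s F(x)` is a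
diffeomorphism of the ball, so that the integral of its Jacobian determinant does not depend
on `s`. -/
theorem exists_integral_det_one_add_smul_eq {E : Type*} [NormedAddCommGroup E] [NormedSpace ℝ E]
    [FiniteDimensional ℝ E] [MeasurableSpace E] [BorelSpace E] (μ : Measure E)
    [μ.IsAddHaarMeasure] {F : E → E} (hF : ContDiff ℝ 1 F) {r : ℝ}
    (hr : ∀ x, x ∉ Metric.ball (0 : E) r → F x = 0) :
    ∃ s₀ > 0, ∀ s : ℝ, 0 ≤ s → s ≤ s₀ →
      ∫ x in Metric.ball (0 : E) r, (1 + s • fderiv ℝ F x : E →L[ℝ] E).det ∂μ =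
        μ.real (Metric.ball (0 : E) r) := by
  have hc : HasCompactSupport F :=
    HasCompactSupport.of_support_subset_isCompact (isCompact_closedBall (0 : E) r) fun x hx => by
      by_contra h
      exact hx (hr x fun h' => h (Metric.ball_subset_closedBall h'))
  obtain ⟨K, hK⟩ := hF.lipschitzWith_of_hasCompactSupport hc one_ne_zero
  have hdet : ∀ᶠ A in 𝓝 (1 : E →L[ℝ] E), 0 < A.det := by
    refine (ContinuousLinearMap.continuous_det.tendsto (1 : E →L[ℝ] E)).eventually
      (lt_mem_nhds ?_)
    have : (1 : E →L[ℝ] E).det = 1 := by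
      rw [ContinuousLinearMap.det]; exact LinearMap.det_id
    rw [this]; exact one_pos
  obtain ⟨ε, hε, hball⟩ := Metric.eventually_nhds_iff.1 hdet
  set s₀ : ℝ := min (ε / 2) (1 / 2) / (K + 1) with hs₀
  have hK0 : (0 : ℝ) < K + 1 := by positivity
  have hs₀pos : 0 < s₀ := by positivity
  refine ⟨s₀, hs₀pos, fun s hs hss => ?_⟩
  have hsK : s * K ≤ min (ε / 2) (1 / 2) := by
    calc s * K ≤ s₀ * (K + 1) := by gcongr; linarith
      _ = _ := by rw [hs₀]; field_simp
  set f : E → E := fun x => x + s • F x with hf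
  have hdf : ∀ x, HasFDerivAt f (1 + s • fderiv ℝ F x : E →L[ℝ] E) x := fun x =>
    (hasFDerivAt_id x).add (((hF.differentiable one_ne_zero) x).hasFDerivAt.const_smul s)
  have hnorm : ∀ x, ‖s • fderiv ℝ F x‖ ≤ s * K := fun x => by
    rw [norm_smul, Real.norm_of_nonneg hs]
    exact mul_le_mul_of_nonneg_left (norm_fderiv_le_of_lipschitz ℝ hK) hs
  have hpos : ∀ x, 0 < (1 + s • fderiv ℝ F x : E →L[ℝ] E).det := fun x => by
    apply hball
    rw [dist_eq_norm, add_sub_cancel_left]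
    have := hnorm x
    have h2 := min_le_left (ε / 2) (1 / 2 : ℝ)
    linarith
  have happ : ApproximatesLinearOn f (ContinuousLinearEquiv.refl ℝ E : E →L[ℝ] E) univ
      (1 / 2 : NNReal) := by
    intro x _ y _
    have e : f x - f y - (ContinuousLinearEquiv.refl ℝ E : E →L[ℝ] E) (x - y) =
        s • (F x - F y) := by
      simp [hf, smul_sub]; abel
    rw [e, norm_smul, Real.norm_of_nonneg hs]
    have h1 := hK.norm_sub_le x y
    have h2 := min_le_right (ε / 2) (1 / 2 : ℝ)
    calc s * ‖F x - F y‖ ≤ s * (K * ‖x - y‖) := by gcongr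
      _ = (s * K) * ‖x - y‖ := by ring
      _ ≤ (1 / 2) * ‖x - y‖ := by gcongr; linarith
      _ = _ := by norm_num
  have hcond : Subsingleton E ∨
      (1 / 2 : NNReal) < ‖((ContinuousLinearEquiv.refl ℝ E).symm : E →L[ℝ] E)‖₊⁻¹ := by
    rcases subsingleton_or_nontrivial E with h | h
    · exact Or.inl h
    · right
      have : ‖((ContinuousLinearEquiv.refl ℝ E).symm : E →L[ℝ] E)‖₊ = 1 := by
        ext; exact ContinuousLinearMap.norm_id
      rw [this, inv_one]
      exact NNReal.coe_lt_coe.1 (by norm_num)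
  -- a Lipschitz perturbation of the identity, with constant `1 / 2`, is a bijection
  have hinj : Function.Injective f := injOn_univ.1 (happ.injOn hcond)
  have hsurj : Function.Surjective f := happ.surjective hcond
  have hout : ∀ x, x ∉ Metric.ball (0 : E) r → f x = x := fun x hx => by simp [hf, hr x hx]
  have himg : f '' Metric.ball (0 : E) r = Metric.ball (0 : E) r := by
    ext y
    constructor
    · rintro ⟨x, hx, rfl⟩
      by_contra h
      exact h (by rw [hinj (hout _ h)]; exact hx)
    · intro hy
      obtain ⟨x, rfl⟩ := hsurj y
      refine ⟨x, ?_, rfl⟩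
      by_contra h
      exact h (hout x h ▸ hy)
  have key := integral_image_eq_integral_abs_det_fderiv_smul μ
    (measurableSet_ball (x := (0 : E)) (ε := r)) (fun x _ => (hdf x).hasFDerivWithinAt)
    hinj.injOn (fun _ => (1 : ℝ))
  rw [himg] at key
  simp only [smul_eq_mul, mul_one, integral_const, measureReal_restrict_apply_univ] at key
  rw [key]
  refine integral_congr_ae (Eventually.of_forall fun x => ?_)
  exact (abs_of_pos (hpos x)).symm

theorem continuous_fderiv_apply {E F : Type*} [NormedAddCommGroup E] [NormedSpace ℝ E]
    [NormedAddCommGroup F] [NormedSpace ℝ F]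
    {u : E → F} (hu : ContDiff ℝ 1 u) (h : E) :
    Continuous fun q => fderiv ℝ u q h :=
  (hu.continuous_fderiv one_ne_zero).clm_apply continuous_const

/-- The integral of `det (1 + s DF)` is a polynomial of degree three in `s` which is constant near
zero on the right; its leading coefficient is the integral of `du ∧ dv ∧ dw`. -/
theorem integral_det3_fderiv_eq_zero_of_ball {u v w : Space → ℝ} (hu : ContDiff ℝ 1 u)
    (hv : ContDiff ℝ 1 v) (hw : ContDiff ℝ 1 w) {r : ℝ}
    (hur : ∀ q, q ∉ Metric.ball (0 : Space) r → u q = 0)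
    (hvr : ∀ q, q ∉ Metric.ball (0 : Space) r → v q = 0)
    (hwr : ∀ q, q ∉ Metric.ball (0 : Space) r → w q = 0) :
    ∫ q in Metric.ball (0 : Space) r, det3 (fderiv ℝ u q) (fderiv ℝ v q) (fderiv ℝ w q) = 0 := by
  have hF : ContDiff ℝ 1 fun q => ((u q, v q), w q) := (hu.prodMk hv).prodMk hw
  have hd : ∀ q, fderiv ℝ (fun q => ((u q, v q), w q)) q =
      ((fderiv ℝ u q).prod (fderiv ℝ v q)).prod (fderiv ℝ w q) := fun q =>
    ((((hu.differentiable one_ne_zero) q).hasFDerivAt.prodMk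
      ((hv.differentiable one_ne_zero) q).hasFDerivAt).prodMk
      ((hw.differentiable one_ne_zero) q).hasFDerivAt).fderiv
  have : (volume : Measure Space).IsAddHaarMeasure :=
    inferInstanceAs (((volume : Measure (ℝ × ℝ)).prod (volume : Measure ℝ)).IsAddHaarMeasure)
  obtain ⟨s₀, hs₀, H⟩ := exists_integral_det_one_add_smul_eq (volume : Measure Space) hF (r := r)
    (fun q hq => by simp [hur q hq, hvr q hq, hwr q hq])
  have hi : ∀ G : Space → ℝ, Continuous G → IntegrableOn G (Metric.ball (0 : Space) r) :=
    fun G hG => (hG.continuousOn.integrableOn_compact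
      (isCompact_closedBall (0 : Space) r)).mono_set Metric.ball_subset_closedBall
  have cu := fun h => continuous_fderiv_apply hu h
  have cv := fun h => continuous_fderiv_apply hv h
  have cw := fun h => continuous_fderiv_apply hw h
  simp only [hd, det_one_add_smul] at H
  set c1 : Space → ℝ := fun q => fderiv ℝ u q ((1, 0), 0) + fderiv ℝ v q ((0, 1), 0) +
    fderiv ℝ w q ((0, 0), 1) with hc1
  set c2 : Space → ℝ := fun q =>
    fderiv ℝ u q ((1, 0), 0) * fderiv ℝ v q ((0, 1), 0) -
      fderiv ℝ u q ((0, 1), 0) * fderiv ℝ v q ((1, 0), 0) +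
    (fderiv ℝ u q ((1, 0), 0) * fderiv ℝ w q ((0, 0), 1) -
      fderiv ℝ u q ((0, 0), 1) * fderiv ℝ w q ((1, 0), 0)) +
    (fderiv ℝ v q ((0, 1), 0) * fderiv ℝ w q ((0, 0), 1) -
      fderiv ℝ v q ((0, 0), 1) * fderiv ℝ w q ((0, 1), 0)) with hc2
  set c3 : Space → ℝ := fun q => det3 (fderiv ℝ u q) (fderiv ℝ v q) (fderiv ℝ w q) with hc3
  have k1 : Continuous c1 := ((cu _).add (cv _)).add (cw _)
  have k2 : Continuous c2 := by
    simp only [hc2]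
    exact ((((cu _).mul (cv _)).sub ((cu _).mul (cv _))).add
      (((cu _).mul (cw _)).sub ((cu _).mul (cw _)))).add
      (((cv _).mul (cw _)).sub ((cv _).mul (cw _)))
  have k3 : Continuous c3 := by
    simp only [hc3, det3]
    exact (((cu _).mul (((cv _).mul (cw _)).sub ((cv _).mul (cw _)))).sub
      ((cu _).mul (((cv _).mul (cw _)).sub ((cv _).mul (cw _))))).add
      ((cu _).mul (((cv _).mul (cw _)).sub ((cv _).mul (cw _))))
  set B := Metric.ball (0 : Space) r
  have H' : ∀ s : ℝ, 0 ≤ s → s ≤ s₀ →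
      s * (∫ q in B, c1 q) + s ^ 2 * (∫ q in B, c2 q) + s ^ 3 * (∫ q in B, c3 q) = 0 := by
    intro s h0 h1
    have h : ∫ q in B, (1 + s * c1 q + s ^ 2 * c2 q + s ^ 3 * c3 q) = volume.real B := H s h0 h1
    have i1 : IntegrableOn (fun q => s * c1 q) B := hi _ (continuous_const.mul k1)
    have i2 : IntegrableOn (fun q => s ^ 2 * c2 q) B := hi _ (continuous_const.mul k2)
    have i3 : IntegrableOn (fun q => s ^ 3 * c3 q) B := hi _ (continuous_const.mul k3)
    have i0 : IntegrableOn (fun _ => (1 : ℝ)) B := hi _ continuous_const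
    have i01 : IntegrableOn (fun q => 1 + s * c1 q) B := i0.add i1
    have i012 : IntegrableOn (fun q => 1 + s * c1 q + s ^ 2 * c2 q) B := i01.add i2
    rw [integral_add i012 i3, integral_add i01 i2,
      integral_add i0 i1, integral_const_mul, integral_const_mul, integral_const_mul] at h
    simp only [integral_const, measureReal_restrict_apply_univ, smul_eq_mul, mul_one] at h
    linarith
  have e1 := H' s₀ hs₀.le le_rfl
  have e2 := H' (s₀ / 2) (by positivity) (by linarith)
  have e3 := H' (s₀ / 4) (by positivity) (by linarith)
  -- a polynomial of degree three without constant term which vanishes at three points is zero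
  have : s₀ ^ 3 * (∫ q in B, c3 q) = 0 := by
    linear_combination (8 / 3) * e1 - 16 * e2 + (64 / 3) * e3
  exact (mul_eq_zero.1 this).resolve_left (by positivity)

theorem exists_contDiff_cutoff {E : Type*} [NormedAddCommGroup E] [NormedSpace ℝ E]
    [FiniteDimensional ℝ E] {K O : Set E} (hK : IsCompact K) (hO : IsOpen O) (hKO : K ⊆ O) :
    ∃ κ : E → ℝ, ContDiff ℝ ∞ κ ∧ HasCompactSupport κ ∧ tsupport κ ⊆ O ∧
      ∀ x ∈ K, ∀ᶠ y in 𝓝 x, κ y = 1 := by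
  obtain ⟨t, ht, hKt, htO⟩ := exists_compact_between hK hO hKO
  obtain ⟨f, hf1, hf0, -⟩ := exists_contMDiffMap_one_nhds_of_subset_interior
    (modelWithCornersSelf ℝ E) (n := ⊤) hK.isClosed hKt
  have hs : tsupport f ⊆ t := closure_minimal (fun x hx => by
    by_contra h
    exact hx (hf0 x h)) ht.isClosed
  exact ⟨f, f.contMDiff.contDiff, HasCompactSupport.of_support_subset_isCompact ht
    (subset_closure.trans hs), hs.trans htO, fun x hx => (eventually_nhdsSet_iff_forall.1 hf1) x hx⟩

theorem contDiff_mul_of_tsupport_subset {E : Type*} [NormedAddCommGroup E] [NormedSpace ℝ E]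
    {n : WithTop ℕ∞} {κ v : E → ℝ} {O : Set E} (hκ : ContDiff ℝ n κ) (hO : IsOpen O)
    (hκO : tsupport κ ⊆ O) (hv : ContDiffOn ℝ n v O) : ContDiff ℝ n fun q => κ q * v q := by
  refine contDiff_iff_contDiffAt.2 fun q => ?_
  by_cases hq : q ∈ tsupport κ
  · exact hκ.contDiffAt.mul (hv.contDiffAt (hO.mem_nhds (hκO hq)))
  · refine (contDiffAt_const (c := (0 : ℝ))).congr_of_eventuallyEq ?_
    filter_upwards [notMem_tsupport_iff_eventuallyEq.1 hq] with p hp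
    simp [hp]

/-- The `3`-form `du ∧ dv ∧ dw` has integral zero if `u` has compact support. The other two
functions need only be defined near the support of `u`; a cut-off makes them compactly supported. -/
theorem integral_det3_fderiv_eq_zero {u v w : Space → ℝ} (hu : ContDiff ℝ 1 u)
    (hc : HasCompactSupport u) {O : Set Space} (hO : IsOpen O) (huO : tsupport u ⊆ O)
    (hv : ContDiffOn ℝ 1 v O) (hw : ContDiffOn ℝ 1 w O) :
    ∫ q, det3 (fderiv ℝ u q) (fderiv ℝ v q) (fderiv ℝ w q) = 0 := by
  obtain ⟨κ, hκ, hκc, hκO, hκ1⟩ := exists_contDiff_cutoff hc.isCompact hO huO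
  have key : ∀ v : Space → ℝ, ContDiffOn ℝ 1 v O →
      ContDiff ℝ 1 (fun q => κ q * v q) ∧
      (∀ q ∈ tsupport u, fderiv ℝ (fun q => κ q * v q) q = fderiv ℝ v q) := by
    intro v hv
    refine ⟨contDiff_mul_of_tsupport_subset (hκ.of_le (by exact_mod_cast le_top)) hO hκO hv,
      fun q hq => ?_⟩
    refine Filter.EventuallyEq.fderiv_eq ?_
    filter_upwards [hκ1 q hq] with p hp
    rw [hp, one_mul]
  obtain ⟨r, hr⟩ := (hc.isCompact.union hκc.isCompact).isBounded.subset_ball (0 : Space)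
  have hout : ∀ q, q ∉ Metric.ball (0 : Space) r → u q = 0 ∧ κ q = 0 := fun q hq =>
    ⟨image_eq_zero_of_notMem_tsupport fun h => hq (hr (Or.inl h)),
      image_eq_zero_of_notMem_tsupport fun h => hq (hr (Or.inr h))⟩
  have h := integral_det3_fderiv_eq_zero_of_ball hu (key v hv).1 (key w hw).1 (r := r)
    (fun q hq => (hout q hq).1) (fun q hq => by simp [(hout q hq).2])
    (fun q hq => by simp [(hout q hq).2])
  have h0 : ∀ q, q ∉ tsupport u → fderiv ℝ u q = 0 := fun q hq =>
    image_eq_zero_of_notMem_tsupport fun h => hq (tsupport_fderiv_subset ℝ h)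
  have hzero : ∀ b c : Space →L[ℝ] ℝ, det3 0 b c = 0 := fun b c => by simp [det3]
  rw [setIntegral_eq_integral_of_forall_compl_eq_zero] at h
  · rw [← h]
    congr 1
    ext q
    by_cases hq : q ∈ tsupport u
    · rw [(key v hv).2 q hq, (key w hw).2 q hq]
    · rw [h0 q hq, hzero, hzero]
  · intro q hq
    rw [h0 q fun hq' => hq (hr (Or.inl hq')), hzero]

/-! ### Integrals of periodic functions over a slab -/

/-- A smooth function supported in `[-π, π]` whose translates by multiples of `π` sum to `1`. -/
def unityCut (a : ℝ) : ℝ :=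
  Real.smoothTransition (a / Real.pi + 1) - Real.smoothTransition (a / Real.pi)

theorem contDiff_unityCut : ContDiff ℝ ∞ unityCut :=
  (Real.smoothTransition.contDiff.comp ((contDiff_id.div_const _).add contDiff_const)).sub
    (Real.smoothTransition.contDiff.comp (contDiff_id.div_const _))

theorem unityCut_eq_zero {a : ℝ} (h : a ∉ Ioo (-Real.pi) Real.pi) : unityCut a = 0 := by
  have hp := Real.pi_pos
  rcases le_or_gt a (-Real.pi) with h1 | h1
  · rw [unityCut, Real.smoothTransition.zero_of_nonpos, Real.smoothTransition.zero_of_nonpos,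
      sub_zero]
    · exact div_nonpos_of_nonpos_of_nonneg (by linarith) hp.le
    · rw [div_add_one hp.ne']; exact div_nonpos_of_nonpos_of_nonneg (by linarith) hp.le
  · have h2 : Real.pi ≤ a := by by_contra h2; exact h ⟨h1, not_le.1 h2⟩
    have h3 : 1 ≤ a / Real.pi := by rwa [le_div_iff₀ hp, one_mul]
    rw [unityCut, Real.smoothTransition.one_of_one_le (by linarith),
      Real.smoothTransition.one_of_one_le h3, sub_self]

theorem unityCut_add_shift {a : ℝ} (h : a ∈ Icc 0 Real.pi) :
    unityCut a + unityCut (a - Real.pi) = 1 := by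
  have hp := Real.pi_pos
  have e : (a - Real.pi) / Real.pi = a / Real.pi - 1 := by field_simp
  have h1 : 0 ≤ a / Real.pi := div_nonneg h.1 hp.le
  have h2 : a / Real.pi ≤ 1 := by rw [div_le_one hp]; exact h.2
  rw [unityCut, unityCut, e, sub_add_cancel, Real.smoothTransition.one_of_one_le (by linarith),
    Real.smoothTransition.zero_of_nonpos (x := a / Real.pi - 1) (by linarith)]
  ring

theorem deriv_unityCut_eq_zero {a : ℝ} (h : a ∉ Icc (-Real.pi) Real.pi) :
    deriv unityCut a = 0 := by
  have : unityCut =ᶠ[𝓝 a] fun _ => 0 := by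
    filter_upwards [isClosed_Icc.isOpen_compl.mem_nhds h] with b hb
    exact unityCut_eq_zero fun h' => hb (Ioo_subset_Icc_self h')
  rw [this.deriv_eq, deriv_const]

theorem deriv_unityCut_add_shift {a : ℝ} (h : a ∈ Icc 0 Real.pi) :
    deriv unityCut a + deriv unityCut (a - Real.pi) = 0 := by
  have hd : Differentiable ℝ unityCut := contDiff_unityCut.differentiable (by simp)
  have h1 : HasDerivAt (fun a => unityCut a + unityCut (a - Real.pi))
      (deriv unityCut a + deriv unityCut (a - Real.pi)) a :=
    (hd a).hasDerivAt.add ((hd (a - Real.pi)).hasDerivAt.comp_sub_const a Real.pi)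
  have h2 : HasDerivWithinAt (fun a => unityCut a + unityCut (a - Real.pi)) 0
      (Icc 0 Real.pi) a :=
    (hasDerivWithinAt_const a _ (1 : ℝ)).congr (fun b hb => unityCut_add_shift hb)
      (unityCut_add_shift h)
  exact (uniqueDiffOn_Icc Real.pi_pos a h).eq_deriv _ h1.hasDerivWithinAt h2

section Unfold
variable {E : Type*} [NormedAddCommGroup E] [NormedSpace ℝ E] [MeasurableSpace E] [BorelSpace E]
  (μ : Measure E) [μ.IsAddRightInvariant]

/-- The slab `{0 ≤ x < π}`. -/
def slab (x : E →L[ℝ] ℝ) : Set E := x ⁻¹' Ico 0 Real.pi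

theorem measurableSet_slab (x : E →L[ℝ] ℝ) : MeasurableSet (slab x) :=
  x.continuous.measurable measurableSet_Ico

/-- Unfolding of the integral of `χ(x) G` for a periodic `G`: the part over `-π ≤ x < 0` is moved
to the slab by the period `τ`. -/
theorem integral_cut_mul (x : E →L[ℝ] ℝ) {τ : E} (hτ : x τ = Real.pi) {χ : ℝ → ℝ}
    (hχ : ∀ a, a ∉ Icc (-Real.pi) Real.pi → χ a = 0) (hχ' : χ Real.pi = 0) {G : E → ℝ}
    (hG : ∀ q, G (q + τ) = G q) (hi : Integrable (fun q => χ (x q) * G q) μ) :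
    ∫ q, χ (x q) * G q ∂μ = ∫ q in slab x, (χ (x q) + χ (x q - Real.pi)) * G q ∂μ := by
  set F : E → ℝ := fun q => χ (x q) * G q with hF
  have hGm : ∀ q, G (q - τ) = G q := fun q => by rw [← hG (q - τ), sub_add_cancel]
  set A' : Set E := (fun q => q + τ) ⁻¹' slab x with hA'
  have hA'm : MeasurableSet A' := (measurable_add_const τ) (measurableSet_slab x)
  have hmem : ∀ q, q ∈ A' ↔ x q ∈ Ico (-Real.pi) 0 := fun q => by
    simp only [hA', slab, mem_preimage, map_add, hτ, mem_Ico]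
    constructor <;> rintro ⟨h1, h2⟩ <;> constructor <;> linarith
  have hdisj : Disjoint A' (slab x) := by
    rw [Set.disjoint_left]
    intro q h1 h2
    exact absurd h2.1 (not_le.2 ((hmem q).1 h1).2)
  have h1 : ∫ q, F q ∂μ = ∫ q in A' ∪ slab x, F q ∂μ := by
    refine (setIntegral_eq_integral_of_forall_compl_eq_zero fun q hq => ?_).symm
    have : χ (x q) = 0 := by
      by_cases hπ : x q = Real.pi
      · rw [hπ, hχ']
      refine hχ _ fun h => hq ?_
      rcases lt_or_ge (x q) 0 with h0 | h0
      · exact Or.inl ((hmem q).2 ⟨h.1, h0⟩)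
      · exact Or.inr ⟨h0, lt_of_le_of_ne h.2 hπ⟩
    simp [hF, this]
  have h2 : ∫ q in A', F q ∂μ = ∫ q in slab x, F (q - τ) ∂μ := by
    have := (measurePreserving_add_right μ τ).setIntegral_preimage_emb
      (measurableEmbedding_addRight τ) (fun q => F (q - τ)) (slab x)
    simpa using this
  have hi2 : IntegrableOn (fun q => F (q - τ)) (slab x) μ :=
    ((measurePreserving_sub_right μ τ).integrable_comp_of_integrable hi).integrableOn
  rw [h1, setIntegral_union hdisj (measurableSet_slab x) hi.integrableOn hi.integrableOn, h2,
    ← integral_add hi2 hi.integrableOn]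
  refine integral_congr_ae (Eventually.of_forall fun q => ?_)
  simp only [hF, hGm, map_sub, hτ]
  ring

variable {μ} in
/-- The integral over a period is a weighted integral over the whole space. -/
theorem integral_unityCut_mul (x : E →L[ℝ] ℝ) {τ : E} (hτ : x τ = Real.pi) {G : E → ℝ}
    (hG : ∀ q, G (q + τ) = G q) (hi : Integrable (fun q => unityCut (x q) * G q) μ) :
    ∫ q, unityCut (x q) * G q ∂μ = ∫ q in slab x, G q ∂μ := by
  rw [integral_cut_mul μ x hτ (fun a ha => unityCut_eq_zero fun h => ha (Ioo_subset_Icc_self h))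
    (unityCut_eq_zero (by simp)) hG hi]
  refine setIntegral_congr_fun (measurableSet_slab x) fun q hq => ?_
  simp only [unityCut_add_shift (Ico_subset_Icc_self hq), one_mul]

variable {μ} in
theorem integral_deriv_unityCut_mul (x : E →L[ℝ] ℝ) {τ : E} (hτ : x τ = Real.pi) {G : E → ℝ}
    (hG : ∀ q, G (q + τ) = G q) (hi : Integrable (fun q => deriv unityCut (x q) * G q) μ) :
    ∫ q, deriv unityCut (x q) * G q ∂μ = 0 := by
  have h0 : deriv unityCut Real.pi = 0 := by
    have h1 := deriv_unityCut_add_shift (a := Real.pi) ⟨Real.pi_pos.le, le_rfl⟩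
    have h2 := deriv_unityCut_add_shift (a := 0) ⟨le_rfl, Real.pi_pos.le⟩
    have h3 : HasDerivWithinAt unityCut 0 (Iic (-Real.pi)) (-Real.pi) :=
      (hasDerivWithinAt_const _ _ (0 : ℝ)).congr
        (fun b hb => unityCut_eq_zero fun h => absurd h.1 (not_lt.2 hb))
        (unityCut_eq_zero (by simp))
    have h4 := (uniqueDiffOn_Iic (-Real.pi) _ self_mem_Iic).eq_deriv _
      ((contDiff_unityCut.differentiable (by simp)) (-Real.pi)).hasDerivAt.hasDerivWithinAt h3
    rw [zero_sub, h4, add_zero] at h2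
    rwa [sub_self, h2, add_zero] at h1
  rw [integral_cut_mul μ x hτ (fun a ha => deriv_unityCut_eq_zero ha) h0 hG hi]
  rw [setIntegral_congr_fun (g := fun _ => (0 : ℝ)) (measurableSet_slab x) fun q hq => ?_]
  · simp
  · simp only [deriv_unityCut_add_shift (Ico_subset_Icc_self hq), zero_mul]

end Unfold

/-- `f` vanishes outside a set whose intersection with the slab `{|x| ≤ π}` is bounded. -/
def BoundedOnSlab {E : Type*} [NormedAddCommGroup E] [NormedSpace ℝ E] (x : E →L[ℝ] ℝ)
    (f : E → ℝ) : Prop :=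
  ∃ r : ℝ, ∀ q, f q ≠ 0 → |x q| ≤ Real.pi → ‖q‖ ≤ r

theorem BoundedOnSlab.hasCompactSupport {E : Type*} [NormedAddCommGroup E] [NormedSpace ℝ E]
    [FiniteDimensional ℝ E] {x : E →L[ℝ] ℝ} {f : E → ℝ} (hf : BoundedOnSlab x f) :
    HasCompactSupport fun q => unityCut (x q) * f q := by
  obtain ⟨r, hr⟩ := hf
  refine HasCompactSupport.of_support_subset_isCompact (isCompact_closedBall (0 : E) r)
    fun q hq => ?_
  rw [mem_closedBall_zero_iff]
  refine hr q (right_ne_zero_of_mul hq) (abs_le.2 ?_)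
  by_contra h
  exact left_ne_zero_of_mul hq (unityCut_eq_zero fun h' => h ⟨h'.1.le, h'.2.le⟩)

theorem fderiv_add_period {E F : Type*} [NormedAddCommGroup E] [NormedSpace ℝ E]
    [NormedAddCommGroup F] [NormedSpace ℝ F] {f : E → F} {τ : E} (h : ∀ q, f (q + τ) = f q)
    (q : E) : fderiv ℝ f (q + τ) = fderiv ℝ f q := by
  rw [← fderiv_comp_add_right τ]
  congr 1
  exact funext h

theorem fderiv_unityCut_mul {E : Type*} [NormedAddCommGroup E] [NormedSpace ℝ E]
    (x : E →L[ℝ] ℝ) {f : E → ℝ} (hf : ContDiff ℝ 1 f) (q : E) :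
    fderiv ℝ (fun q => unityCut (x q) * f q) q =
      unityCut (x q) • fderiv ℝ f q + (f q * deriv unityCut (x q)) • x := by
  have h1 : HasFDerivAt (fun q => unityCut (x q)) (deriv unityCut (x q) • x) q :=
    ((contDiff_unityCut.differentiable (by simp)) (x q)).hasDerivAt.comp_hasFDerivAt q
      x.hasFDerivAt
  have h2 := (h1.mul ((hf.differentiable one_ne_zero) q).hasFDerivAt).fderiv
  rw [smul_smul] at h2
  exact h2

/-- A directional derivative of a periodic function with bounded support in the slab has integral
zero over the slab. -/
theorem integral_slab_fderiv_eq_zero {E : Type*} [NormedAddCommGroup E] [NormedSpace ℝ E]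
    [FiniteDimensional ℝ E] [MeasurableSpace E] [BorelSpace E] (μ : Measure E)
    [μ.IsAddHaarMeasure] (x : E →L[ℝ] ℝ) {τ : E} (hτ : x τ = Real.pi) {f : E → ℝ}
    (hf : ContDiff ℝ 1 f) (hper : ∀ q, f (q + τ) = f q) (hb : BoundedOnSlab x f) (e : E) :
    ∫ q in slab x, fderiv ℝ f q e ∂μ = 0 := by
  set F : E → ℝ := fun q => unityCut (x q) * f q with hF
  have hFd : ContDiff ℝ 1 F :=
    ((contDiff_unityCut.comp x.contDiff).of_le (by exact_mod_cast le_top)).mul hf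
  have hc : HasCompactSupport F := hb.hasCompactSupport
  have hcd : HasCompactSupport fun q => fderiv ℝ F q e :=
    (hc.fderiv (𝕜 := ℝ)).comp_left (g := fun L : E →L[ℝ] ℝ => L e) rfl
  have hi : Integrable (fun q => fderiv ℝ F q e) μ :=
    (continuous_fderiv_apply hFd e).integrable_of_hasCompactSupport hcd
  have h0 : ∫ q, fderiv ℝ F q e ∂μ = 0 := by
    have h := integral_mul_fderiv_eq_neg_fderiv_mul_of_integrable (𝕜 := ℝ) (μ := μ) (v := e)
      (f := fun _ : E => (1 : ℝ)) (g := F) (by simp) (by simpa using hi)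
      (by simpa using hFd.continuous.integrable_of_hasCompactSupport hc)
      (fun _ _ => differentiableAt_const _)
      (fun q _ => hFd.differentiable one_ne_zero q)
    simpa using h
  have hcut : Integrable (fun q => deriv unityCut (x q) * (f q * x e)) μ := by
    refine Continuous.integrable_of_hasCompactSupport
      (((contDiff_unityCut.continuous_deriv (by simp)).comp x.continuous).mul
        (hf.continuous.mul continuous_const)) ?_
    obtain ⟨r, hr⟩ := hb
    refine HasCompactSupport.of_support_subset_isCompact (isCompact_closedBall (0 : E) r)
      fun q hq => mem_closedBall_zero_iff.2 (hr q (left_ne_zero_of_mul (right_ne_zero_of_mul hq))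
        (abs_le.2 ?_))
    by_contra h
    exact left_ne_zero_of_mul hq (deriv_unityCut_eq_zero h)
  have hsum : ∀ q, fderiv ℝ F q e =
      unityCut (x q) * fderiv ℝ f q e + deriv unityCut (x q) * (f q * x e) := fun q => by
    rw [hF, fderiv_unityCut_mul x hf]
    simp; ring
  have hmain : Integrable (fun q => unityCut (x q) * fderiv ℝ f q e) μ :=
    (hi.sub hcut).congr (Eventually.of_forall fun q => by simp [hsum])
  simp_rw [hsum] at h0
  rw [integral_add hmain hcut, integral_deriv_unityCut_mul x hτ (fun q => by rw [hper]) hcut,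
    add_zero, integral_unityCut_mul x hτ (fun q => by rw [fderiv_add_period hper]) hmain] at h0
  exact h0

/-- The periodic version of `integral_det3_fderiv_eq_zero`: multiplying `u` by `unityCut` produces
one more term, in which the weight is the derivative of `unityCut` and integrates to zero. -/
theorem integral_slab_det3_fderiv_eq_zero {u v w : Space → ℝ} (x : Space →L[ℝ] ℝ) {τ : Space}
    (hτ : x τ = Real.pi) (hu : ContDiff ℝ 1 u) (hv : ContDiff ℝ 1 v) (hw : ContDiff ℝ 1 w)
    (hpu : ∀ q, u (q + τ) = u q) (hpv : ∀ q, v (q + τ) = v q) (hpw : ∀ q, w (q + τ) = w q)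
    (hb : BoundedOnSlab x u) :
    ∫ q in slab x, det3 (fderiv ℝ u q) (fderiv ℝ v q) (fderiv ℝ w q) = 0 := by
  set F : Space → ℝ := fun q => unityCut (x q) * u q with hF
  have hFd : ContDiff ℝ 1 F :=
    ((contDiff_unityCut.comp x.contDiff).of_le (by exact_mod_cast le_top)).mul hu
  have hc : HasCompactSupport F := hb.hasCompactSupport
  have cF := fun h => continuous_fderiv_apply hFd h
  have cu := fun h => continuous_fderiv_apply hu h
  have cv := fun h => continuous_fderiv_apply hv h
  have cw := fun h => continuous_fderiv_apply hw h
  have h0 : ∫ q, det3 (fderiv ℝ F q) (fderiv ℝ v q) (fderiv ℝ w q) = 0 :=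
    integral_det3_fderiv_eq_zero hFd hc isOpen_univ (subset_univ _) hv.contDiffOn hw.contDiffOn
  have hi : Integrable fun q => det3 (fderiv ℝ F q) (fderiv ℝ v q) (fderiv ℝ w q) := by
    refine Continuous.integrable_of_hasCompactSupport ?_ ?_
    · simp only [det3]
      exact (((cF _).mul (((cv _).mul (cw _)).sub ((cv _).mul (cw _)))).sub
        ((cF _).mul (((cv _).mul (cw _)).sub ((cv _).mul (cw _))))).add
        ((cF _).mul (((cv _).mul (cw _)).sub ((cv _).mul (cw _))))
    · refine (hc.fderiv (𝕜 := ℝ)).mono fun q hq => ?_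
      contrapose! hq
      simp only [Function.mem_support, not_not] at hq ⊢
      rw [hq]; simp [det3]
  have hcut : Integrable fun q => deriv unityCut (x q) *
      (u q * det3 x (fderiv ℝ v q) (fderiv ℝ w q)) := by
    refine Continuous.integrable_of_hasCompactSupport
      (((contDiff_unityCut.continuous_deriv (by simp)).comp x.continuous).mul
        (hu.continuous.mul ?_)) ?_
    · simp only [det3]
      exact ((continuous_const.mul (((cv _).mul (cw _)).sub ((cv _).mul (cw _)))).sub
        (continuous_const.mul (((cv _).mul (cw _)).sub ((cv _).mul (cw _))))).add
        (continuous_const.mul (((cv _).mul (cw _)).sub ((cv _).mul (cw _))))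
    obtain ⟨r, hr⟩ := hb
    refine HasCompactSupport.of_support_subset_isCompact (isCompact_closedBall (0 : Space) r)
      fun q hq => mem_closedBall_zero_iff.2 (hr q (left_ne_zero_of_mul (right_ne_zero_of_mul hq))
        (abs_le.2 ?_))
    by_contra h
    exact left_ne_zero_of_mul hq (deriv_unityCut_eq_zero h)
  have hsum : ∀ q, det3 (fderiv ℝ F q) (fderiv ℝ v q) (fderiv ℝ w q) =
      unityCut (x q) * det3 (fderiv ℝ u q) (fderiv ℝ v q) (fderiv ℝ w q) +
        deriv unityCut (x q) * (u q * det3 x (fderiv ℝ v q) (fderiv ℝ w q)) := fun q => by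
    rw [hF, fderiv_unityCut_mul x hu]
    simp [det3]; ring
  have hmain : Integrable fun q => unityCut (x q) *
      det3 (fderiv ℝ u q) (fderiv ℝ v q) (fderiv ℝ w q) :=
    (hi.sub hcut).congr (Eventually.of_forall fun q => by simp [hsum])
  simp_rw [hsum] at h0
  have : (volume : Measure Space).IsAddHaarMeasure :=
    inferInstanceAs (((volume : Measure (ℝ × ℝ)).prod (volume : Measure ℝ)).IsAddHaarMeasure)
  rw [integral_add hmain hcut, integral_deriv_unityCut_mul x hτ
      (fun q => by rw [hpu, fderiv_add_period hpv, fderiv_add_period hpw]) hcut, add_zero,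
    integral_unityCut_mul x hτ (fun q => by
      rw [fderiv_add_period hpu, fderiv_add_period hpv, fderiv_add_period hpw]) hmain] at h0
  exact h0

/-! ### The covering of the annulus by the plane -/

theorem angle_eq_angle_iff {s t : ℝ} : angle s = angle t ↔ Real.sin (t - s) = 0 := by
  rw [angle, angle, Projectivization.mk_eq_mk_iff']
  constructor
  · rintro ⟨a, ha⟩
    have h0 : a * Real.cos t = Real.cos s := by simpa using congrFun ha 0
    have h1 : a * Real.sin t = Real.sin s := by simpa using congrFun ha 1
    rw [Real.sin_sub, ← h0, ← h1]; ring
  · intro h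
    have hc : Real.cos (t - s) ^ 2 = 1 := by
      have := Real.sin_sq_add_cos_sq (t - s); rw [h] at this; linarith
    have e1 : Real.cos t = Real.cos (t - s) * Real.cos s := by
      have := Real.cos_add (t - s) s; rw [sub_add_cancel, h] at this; linarith
    have e2 : Real.sin t = Real.cos (t - s) * Real.sin s := by
      have := Real.sin_add (t - s) s; rw [sub_add_cancel, h] at this; linarith
    refine ⟨Real.cos (t - s), ?_⟩
    ext i
    fin_cases i
    · simp [e1, ← mul_assoc, ← pow_two, hc]
    · simp [e2, ← mul_assoc, ← pow_two, hc]

theorem angle_surjective : Function.Surjective angle := by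
  intro p
  induction p using Projectivization.ind with
  | h v hv =>
    set c : ℂ := ⟨v 0, v 1⟩ with hc
    refine ⟨c.arg, ?_⟩
    rw [angle, Projectivization.mk_eq_mk_iff']
    have hc0 : c ≠ 0 := by
      intro h
      apply hv
      have h0 : v 0 = 0 := congrArg Complex.re h
      have h1 : v 1 = 0 := congrArg Complex.im h
      ext i; fin_cases i <;> simp [h0, h1]
    have hn : ‖c‖ ≠ 0 := norm_ne_zero_iff.2 hc0
    refine ⟨‖c‖⁻¹, ?_⟩
    ext i
    fin_cases i
    · change ‖c‖⁻¹ * c.re = Real.cos c.arg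
      rw [Complex.cos_arg hc0, inv_mul_eq_div]
    · change ‖c‖⁻¹ * c.im = Real.sin c.arg
      rw [Complex.sin_arg, inv_mul_eq_div]

theorem angles_eq_iff {z z' : ℝ × ℝ} :
    angles z = angles z' ↔ Real.sin (z'.1 - z.1) = 0 ∧ Real.sin (z'.2 - z.2) = 0 := by
  rw [angles, angles, Prod.mk.injEq, angle_eq_angle_iff, angle_eq_angle_iff]

theorem angles_surjective : Function.Surjective angles := fun p => by
  obtain ⟨s, hs⟩ := angle_surjective p.1
  obtain ⟨t, ht⟩ := angle_surjective p.2
  exact ⟨(s, t), by rw [angles, hs, ht]⟩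

theorem angles_add {z z' : ℝ × ℝ} (h : angles z = angles z') (w : ℝ × ℝ) :
    angles (z + w) = angles (z' + w) := by
  rw [angles_eq_iff] at h ⊢
  simpa using h

theorem angles_add_pi (z : ℝ × ℝ) : angles (z + (Real.pi, Real.pi)) = angles z := by
  rw [angles_eq_iff]; simp

theorem mem_annulusCover {z : ℝ × ℝ} : z ∈ annulusCover ↔ Real.sin (z.2 - z.1) ≠ 0 := by
  rw [annulusCover, mem_preimage, annulus, mem_ofPred_eq, angles, Ne, angle_eq_angle_iff]

theorem isOpen_annulusCover : IsOpen annulusCover := by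
  have : annulusCover = (fun z : ℝ × ℝ => Real.sin (z.2 - z.1)) ⁻¹' {0}ᶜ := by
    ext z; rw [mem_annulusCover]; rfl
  rw [this]
  exact isOpen_compl_singleton.preimage (by fun_prop)

theorem annulusCover_mem_nhds {z : ℝ × ℝ} (hz : z ∈ annulusCover) : annulusCover ∈ 𝓝 z :=
  isOpen_annulusCover.mem_nhds hz

/-- The strip `{x < y < x + π}`, a connected component of the cover of the annulus. -/
def strip : Set (ℝ × ℝ) := {z | z.1 < z.2 ∧ z.2 < z.1 + Real.pi}

theorem strip_subset : strip ⊆ annulusCover := fun z hz => by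
  rw [mem_annulusCover]
  exact (Real.sin_pos_of_pos_of_lt_pi (by linarith [hz.1]) (by linarith [hz.2])).ne'

theorem isOpen_strip : IsOpen strip :=
  (isOpen_lt continuous_fst continuous_snd).inter
    (isOpen_lt continuous_snd (continuous_fst.add continuous_const))

theorem convex_strip : Convex ℝ strip := by
  rintro ⟨a, b⟩ ⟨h1, h2⟩ ⟨c, d⟩ ⟨h3, h4⟩ s t hs ht hst
  have hp := Real.pi_pos
  simp only [strip, mem_ofPred_eq, Prod.smul_mk, Prod.mk_add_mk, smul_eq_mul] at *
  have e : Real.pi = s * Real.pi + t * Real.pi := by rw [← add_mul, hst, one_mul]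
  rcases hs.eq_or_lt with rfl | hs
  · have : t = 1 := by linarith
    subst this; constructor <;> linarith
  · constructor
    · nlinarith [mul_lt_mul_of_pos_left h1 hs, mul_le_mul_of_nonneg_left h3.le ht]
    · rw [e]; nlinarith [mul_lt_mul_of_pos_left h2 hs, mul_le_mul_of_nonneg_left h4.le ht]

/-- The part of the cover of the annulus which lies over a compact set: the sets
`|sin (y - x)| ≥ m` with `m > 0` exhaust the annulus. -/
def core (m : ℝ) : Set (ℝ × ℝ) := {z | m ≤ |Real.sin (z.2 - z.1)|}

theorem isClosed_core (m : ℝ) : IsClosed (core m) := by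
  refine isClosed_le continuous_const ?_
  fun_prop

theorem core_subset {m : ℝ} (hm : 0 < m) : core m ⊆ annulusCover := fun z hz => by
  rw [mem_annulusCover]; intro h
  rw [core, mem_ofPred_eq, h, abs_zero] at hz
  linarith

theorem abs_sin_eq_of_angles_eq {z z' : ℝ × ℝ} (h : angles z = angles z') :
    |Real.sin (z.2 - z.1)| = |Real.sin (z'.2 - z'.1)| := by
  rw [angles_eq_iff] at h
  obtain ⟨m, hm⟩ := Real.sin_eq_zero_iff.1 h.1
  obtain ⟨n, hn⟩ := Real.sin_eq_zero_iff.1 h.2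
  have e : z'.2 - z'.1 = z.2 - z.1 + ((n - m : ℤ) : ℝ) * Real.pi := by push_cast; linarith
  rw [e, Real.sin_add_int_mul_pi, abs_mul]
  simp

theorem IsCompactInAnnulus.exists_core {K : Set (RP1 × RP1)} (hK : IsCompactInAnnulus K) :
    ∃ m > 0, ∀ z, angles z ∈ K → z ∈ core m := by
  obtain ⟨C, hC, hcomp, rfl⟩ := hK
  rcases C.eq_empty_or_nonempty with rfl | hne
  · exact ⟨1, one_pos, fun z hz => by simp at hz⟩
  obtain ⟨z₀, hz₀, hmin⟩ := hcomp.exists_isMinOn hne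
    (f := fun z : ℝ × ℝ => |Real.sin (z.2 - z.1)|) (by fun_prop)
  refine ⟨_, abs_pos.2 (mem_annulusCover.1 (hC hz₀)), ?_⟩
  rintro z ⟨z', hz', h⟩
  rw [core, mem_ofPred_eq, ← abs_sin_eq_of_angles_eq h]
  exact hmin hz'

/-- A function on the plane which descends to `RP1 × RP1`. -/
def AngPeriodic {E : Type*} (F : ℝ × ℝ → E) : Prop := ∀ z z', angles z = angles z' → F z = F z'

theorem AngPeriodic.fderiv {E : Type*} [NormedAddCommGroup E] [NormedSpace ℝ E]
    {F : ℝ × ℝ → E} (hF : AngPeriodic F) : AngPeriodic (fderiv ℝ F) := fun z z' h => by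
  have h1 := fderiv_comp_add_right (𝕜 := ℝ) (f := F) (x := 0) z
  have h2 := fderiv_comp_add_right (𝕜 := ℝ) (f := F) (x := 0) z'
  rw [zero_add] at h1 h2
  rw [← h1, ← h2]
  congr 1
  ext w
  rw [add_comm w z, add_comm w z']
  exact hF _ _ (angles_add h w)

theorem AngPeriodic.add_pi {E : Type*} {F : ℝ × ℝ → E} (hF : AngPeriodic F) (z : ℝ × ℝ) :
    F (z + (Real.pi, Real.pi)) = F z := hF _ _ (angles_add_pi z)

/-- Some angular coordinates of a point of `RP1 × RP1`. The choice is not continuous; it is only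
used inside functions which descend to `RP1 × RP1`. -/
def coords (p : RP1 × RP1) : ℝ × ℝ := Function.surjInv angles_surjective p

theorem angles_coords (p : RP1 × RP1) : angles (coords p) = p :=
  Function.surjInv_eq angles_surjective p

theorem AngPeriodic.coords_angles {E : Type*} {F : ℝ × ℝ → E} (hF : AngPeriodic F) (z : ℝ × ℝ) :
    F (coords (angles z)) = F z := hF _ _ (angles_coords _)

theorem AngPeriodic.comp_coords_comp {E : Type*} {F : ℝ × ℝ → E} (hF : AngPeriodic F) :
    (fun p => F (coords p)) ∘ angles = F := funext hF.coords_angles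

theorem coords_mem {p : RP1 × RP1} (hp : p ∈ annulus) : coords p ∈ annulusCover := by
  rw [annulusCover, mem_preimage, angles_coords]; exact hp

/-! ### Frames of `W` -/

theorem form_comm (u v : W) : form u v = form v u := by simp only [form]; ring
theorem form_add_left (u v w : W) : form (u + v) w = form u w + form v w := by
  simp only [form, Pi.add_apply]; ring
theorem form_add_right (u v w : W) : form u (v + w) = form u v + form u w := by
  simp only [form, Pi.add_apply]; ring
theorem form_sub_left (u v w : W) : form (u - v) w = form u w - form v w := by
  simp only [form, Pi.sub_apply]; ring
theorem form_sub_right (u v w : W) : form u (v - w) = form u v - form u w := by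
  simp only [form, Pi.sub_apply]; ring
theorem form_smul_left (r : ℝ) (u v : W) : form (r • u) v = r * form u v := by
  simp only [form, Pi.smul_apply, smul_eq_mul]; ring
theorem form_smul_right (r : ℝ) (u v : W) : form u (r • v) = r * form u v := by
  simp only [form, Pi.smul_apply, smul_eq_mul]; ring
theorem form_neg_left (u v : W) : form (-u) v = -form u v := by
  simp only [form, Pi.neg_apply]; ring
theorem form_neg_right (u v : W) : form u (-v) = -form u v := by
  simp only [form, Pi.neg_apply]; ring
theorem form_zero_left (v : W) : form 0 v = 0 := by simp [form]

theorem vol_eq (a b c d : W) : vol a b c d =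
    (a 0 * b 1 - a 1 * b 0) * (c 2 * d 3 - c 3 * d 2) -
    (a 0 * b 2 - a 2 * b 0) * (c 1 * d 3 - c 3 * d 1) +
    (a 0 * b 3 - a 3 * b 0) * (c 1 * d 2 - c 2 * d 1) +
    (a 1 * b 2 - a 2 * b 1) * (c 0 * d 3 - c 3 * d 0) -
    (a 1 * b 3 - a 3 * b 1) * (c 0 * d 2 - c 2 * d 0) +
    (a 2 * b 3 - a 3 * b 2) * (c 0 * d 1 - c 1 * d 0) := by
  simp [vol, Matrix.det_succ_row_zero, Fin.sum_univ_succ, Fin.succAbove]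
  ring

/-- The linear combination of `a, b, c, d` with coefficients `m`. -/
def comb (a b c d : W) (m : Fin 4 → ℝ) : W := m 0 • a + m 1 • b + m 2 • c + m 3 • d

theorem vol_comb (a b c d k l m n : W) :
    vol (comb a b c d k) (comb a b c d l) (comb a b c d m) (comb a b c d n) =
      vol k l m n * vol a b c d := by
  simp only [vol]
  rw [← Matrix.det_mul]
  congr 1
  ext i j
  fin_cases i <;> simp [comb, Matrix.mul_apply, Fin.sum_univ_four]

theorem eq_zero_of_form_eq_zero {a b c d v : W} (h : vol a b c d ≠ 0) (ha : form v a = 0)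
    (hb : form v b = 0) (hc : form v c = 0) (hd : form v d = 0) : v = 0 := by
  have := Matrix.eq_zero_of_mulVec_eq_zero (v := ![-v 3, v 2, v 1, -v 0]) h (by
    simp only [form] at ha hb hc hd
    ext i
    fin_cases i <;> simp [Matrix.mulVec, dotProduct, Fin.sum_univ_four] <;> linarith)
  have h0 := congrFun this 0
  have h1 := congrFun this 1
  have h2 := congrFun this 2
  have h3 := congrFun this 3
  simp at h0 h1 h2 h3
  ext i; fin_cases i <;> simp [h0, h1, h2, h3]

/-- The relations satisfied by the frame `(s, s_x, s_y, s_xy)` of a normal lift: its Gram matrix, and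
its orientation in the order `(s, s_y, s_x, s_xy)` given by the split frame `(∂_y, ∂_x)`. -/
structure IsFrame (a b c d : W) : Prop where
  aa : form a a = 0
  ab : form a b = 0
  ac : form a c = 0
  ad : form a d = -1
  bb : form b b = 0
  bc : form b c = 1
  bd : form b d = 0
  cc : form c c = 0
  cd : form c d = 0
  dd : form d d = 0
  vol : vol a c b d = 1

/-- A vector orthogonal to the first three vectors of the frame is a multiple of the first one. The
product `⟨d, d⟩` is not needed. -/
theorem eq_neg_form_smul {a b c d v : W} (hv : AdS.vol a c b d = 1) (hF : form a a = 0)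
    (hab : form a b = 0) (hac : form a c = 0) (had : form a d = -1)
    (ha : form v a = 0) (hb : form v b = 0) (hc : form v c = 0) : v = -form v d • a := by
  rw [← sub_eq_zero]
  refine eq_zero_of_form_eq_zero (a := a) (b := c) (c := b) (d := d) (by rw [hv]; exact one_ne_zero)
    ?_ ?_ ?_ ?_ <;>
  simp [form_add_left, form_smul_left, *]

/-- The frame of `e^ρ s` is, up to scale, the shear of the frame of `s` by the derivatives of `ρ`. -/
theorem IsFrame.shear {a b c d : W} (h : IsFrame a b c d) (α β : ℝ) :
    IsFrame a (b + α • a) (c + β • a) (d + α • c + β • b + (α * β) • a) := by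
  obtain ⟨aa, ab, ac, ad, bb, bc, bd, cc, cd, dd, hv⟩ := h
  have ba := form_comm b a ▸ ab
  have ca := form_comm c a ▸ ac
  have da := form_comm d a ▸ ad
  have cb := form_comm c b ▸ bc
  have db := form_comm d b ▸ bd
  have dc := form_comm d c ▸ cd
  constructor
  case vol =>
    have := vol_comb a c b d ![1, 0, 0, 0] ![β, 1, 0, 0] ![α, 0, 1, 0] ![α * β, α, β, 1]
    rw [hv] at this
    convert this using 1
    · congr 1 <;> simp [comb] <;> abel
    · simp [vol_eq]
  all_goals
    simp only [form_add_left, form_add_right, form_smul_left, form_smul_right, *] <;> ring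

/-! ### Decomposable tensors -/

theorem exists_eq_tensor_left {w : W} {r : V} (hr : r ≠ 0) (h0 : w 0 * r 1 = w 1 * r 0)
    (h1 : w 2 * r 1 = w 3 * r 0) : ∃ p, w = tensor p r := by
  have hn : r 0 ^ 2 + r 1 ^ 2 ≠ 0 := fun h => hr (by
    have e0 : r 0 = 0 := by nlinarith [sq_nonneg (r 0), sq_nonneg (r 1)]
    have e1 : r 1 = 0 := by nlinarith [sq_nonneg (r 0), sq_nonneg (r 1)]
    ext i; fin_cases i <;> simp [e0, e1])
  refine ⟨![(w 0 * r 0 + w 1 * r 1) / (r 0 ^ 2 + r 1 ^ 2),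
    (w 2 * r 0 + w 3 * r 1) / (r 0 ^ 2 + r 1 ^ 2)], ?_⟩
  ext i
  fin_cases i <;> simp [tensor] <;> field_simp <;> linear_combination (norm := ring_nf)
  · linear_combination r 1 * h0
  · linear_combination -r 0 * h0
  · linear_combination r 1 * h1
  · linear_combination -r 0 * h1

theorem exists_eq_tensor_right {w : W} {p : V} (hp : p ≠ 0) (h0 : w 0 * p 1 = w 2 * p 0)
    (h1 : w 1 * p 1 = w 3 * p 0) : ∃ r, w = tensor p r := by
  obtain ⟨r, hr⟩ := exists_eq_tensor_left (w := ![w 0, w 2, w 1, w 3]) hp h0 h1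
  refine ⟨r, ?_⟩
  have e0 := congrFun hr 0
  have e1 := congrFun hr 1
  have e2 := congrFun hr 2
  have e3 := congrFun hr 3
  simp [tensor] at e0 e1 e2 e3
  ext i
  fin_cases i <;> simp [tensor, e0, e1, e2, e3, mul_comm]

/-- The position of the tangent vectors of the leaves determines the orientation of the frame. -/
theorem vol_tensor (A B p r : V) (d : W) :
    vol (tensor A B) (tensor A r) (tensor p B) d =
      -(form (tensor p B) (tensor A r) * form (tensor A B) d) := by
  rw [vol_eq]
  simp [form, tensor]
  ring

/-! ### The volume form of the quadric `⟨x, x⟩ = -1` -/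

/-- The determinant of three vectors of `ℝ³`. -/
def det33 (a b c : Fin 3 → ℝ) : ℝ :=
  a 0 * (b 1 * c 2 - b 2 * c 1) - a 1 * (b 0 * c 2 - b 2 * c 0) + a 2 * (b 0 * c 1 - b 1 * c 0)

/-- With `pz₂`, `pw₁`, `pw₂`, coordinates of `W` for which `2⟨x, x⟩ = w₁² + w₂² - z₁² - z₂²`. -/
def pz₁ (x : W) : ℝ := x 0 + x 3
/-- See `pz₁`. -/
def pz₂ (x : W) : ℝ := x 1 - x 2
/-- See `pz₁`. -/
def pw₁ (x : W) : ℝ := x 0 - x 3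
/-- See `pz₁`. -/
def pw₂ (x : W) : ℝ := x 1 + x 2
/-- The function `R = 2 + w₁² + w₂²`, equal to `z₁² + z₂²` on the quadric `⟨x, x⟩ = -1`. -/
def pR (x : W) : ℝ := 2 + pw₁ x ^ 2 + pw₂ x ^ 2

theorem pR_pos (x : W) : 0 < pR x := by unfold pR; positivity

/-- The derivative at `x` in the direction `a` of the function `w₁ z / R`, for a linear form `z`. -/
def dcoef (z : W → ℝ) (x a : W) : ℝ :=
  (pw₁ a * z x + pw₁ x * z a) / pR x -
    pw₁ x * z x * (2 * (pw₁ x * pw₁ a + pw₂ x * pw₂ a)) / pR x ^ 2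

/-- On the quadric, the volume form is
`½ (d(w₁ z₁ / R) ∧ dw₂ ∧ dz₂ - d(w₁ z₂ / R) ∧ dw₂ ∧ dz₁)`. In polar coordinates `z = √R e^{iθ}`,
this is `½ dw₁ ∧ dw₂ ∧ dθ`. -/
theorem vol_eq_det33 {x : W} {a : Fin 3 → W} (hx : form x x = -1) (ha : ∀ i, form x (a i) = 0) :
    vol x (a 0) (a 1) (a 2) =
      (1 / 2) * (det33 (fun i => dcoef pz₁ x (a i)) (fun i => pw₂ (a i)) (fun i => pz₂ (a i)) -
        det33 (fun i => dcoef pz₂ x (a i)) (fun i => pw₂ (a i)) (fun i => pz₁ (a i))) := by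
  have hz : pz₁ x ^ 2 + pz₂ x ^ 2 = pR x := by
    simp only [form] at hx
    simp only [pR, pz₁, pz₂, pw₁, pw₂]
    linear_combination -2 * hx
  have hT : ∀ i, pz₁ x * pz₁ (a i) + pz₂ x * pz₂ (a i) -
      (pw₁ x * pw₁ (a i) + pw₂ x * pw₂ (a i)) = 0 := fun i => by
    have := ha i
    simp only [form] at this
    simp only [pz₁, pz₂, pw₁, pw₂]
    linear_combination -2 * this
  have hv : vol x (a 0) (a 1) (a 2) = (1 / 4) * (
      pz₁ x * det33 (fun i => pz₂ (a i)) (fun i => pw₁ (a i)) (fun i => pw₂ (a i)) -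
      pz₂ x * det33 (fun i => pz₁ (a i)) (fun i => pw₁ (a i)) (fun i => pw₂ (a i)) +
      pw₁ x * det33 (fun i => pz₁ (a i)) (fun i => pz₂ (a i)) (fun i => pw₂ (a i)) -
      pw₂ x * det33 (fun i => pz₁ (a i)) (fun i => pz₂ (a i)) (fun i => pw₁ (a i))) := by
    simp only [vol_eq, det33, pz₁, pz₂, pw₁, pw₂]
    ring
  have hRdef : pR x = 2 + pw₁ x ^ 2 + pw₂ x ^ 2 := rfl
  have hR : pR x ≠ 0 := (pR_pos x).ne'
  rw [hv]
  simp only [dcoef, det33]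
  have t0 := hT 0
  have t1 := hT 1
  have t2 := hT 2
  generalize pR x = R at *
  generalize pz₁ x = z₁ at *
  generalize pz₂ x = z₂ at *
  generalize pw₁ x = w₁ at *
  generalize pw₂ x = w₂ at *
  generalize pz₁ (a 0) = a₁ at *
  generalize pz₂ (a 0) = a₂ at *
  generalize pw₁ (a 0) = a₃ at *
  generalize pw₂ (a 0) = a₄ at *
  generalize pz₁ (a 1) = b₁ at *
  generalize pz₂ (a 1) = b₂ at *
  generalize pw₁ (a 1) = b₃ at *
  generalize pw₂ (a 1) = b₄ at *
  generalize pz₁ (a 2) = c₁ at *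
  generalize pz₂ (a 2) = c₂ at *
  generalize pw₁ (a 2) = c₃ at *
  generalize pw₂ (a 2) = c₄ at *
  -- on tangent vectors, the contraction of the volume form with `x` is a multiple of
  -- `(z₁ dz₂ - z₂ dz₁) ∧ dw₁ ∧ dw₂ / R`
  have e1 : R * (z₁ * (a₂ * (b₃ * c₄ - c₃ * b₄) - b₂ * (a₃ * c₄ - c₃ * a₄) + c₂ * (a₃ * b₄ -
      b₃ * a₄)) - z₂ * (a₁ * (b₃ * c₄ - c₃ * b₄) - b₁ * (a₃ * c₄ - c₃ * a₄) + c₁ * (a₃ * b₄ -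
      b₃ * a₄)) + w₁ * (a₁ * (b₂ * c₄ - c₂ * b₄) - b₁ * (a₂ * c₄ - c₂ * a₄) + c₁ * (a₂ * b₄ -
      b₂ * a₄)) - w₂ * (a₁ * (b₂ * c₃ - c₂ * b₃) - b₁ * (a₂ * c₃ - c₂ * a₃) + c₁ * (a₂ * b₃ -
      b₂ * a₃))) =
      2 * ((z₁ * a₂ - z₂ * a₁) * (b₃ * c₄ - c₃ * b₄) - (z₁ * b₂ - z₂ * b₁) * (a₃ * c₄ -
        c₃ * a₄) + (z₁ * c₂ - z₂ * c₁) * (a₃ * b₄ - b₃ * a₄)) := by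
    linear_combination (-(z₁ * (a₂ * (b₃ * c₄ - c₃ * b₄) - b₂ * (a₃ * c₄ - c₃ * a₄) +
      c₂ * (a₃ * b₄ - b₃ * a₄)) - z₂ * (a₁ * (b₃ * c₄ - c₃ * b₄) - b₁ * (a₃ * c₄ - c₃ * a₄) +
      c₁ * (a₃ * b₄ - b₃ * a₄)) + w₁ * (a₁ * (b₂ * c₄ - c₂ * b₄) - b₁ * (a₂ * c₄ - c₂ * a₄) +
      c₁ * (a₂ * b₄ - b₂ * a₄)) - w₂ * (a₁ * (b₂ * c₃ - c₂ * b₃) - b₁ * (a₂ * c₃ - c₂ * a₃) +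
      c₁ * (a₂ * b₃ - b₂ * a₃)))) * hz
      + ((z₁ * a₂ - z₂ * a₁) * (b₃ * c₄ - c₃ * b₄) - (z₁ * b₂ - z₂ * b₁) * (a₃ * c₄ - c₃ * a₄) +
        (z₁ * c₂ - z₂ * c₁) * (a₃ * b₄ - b₃ * a₄)) * (hz + hRdef)
      + ((z₁ * b₂ - z₂ * b₁) * (w₁ * c₄ - w₂ * c₃) - (z₁ * c₂ - z₂ * c₁) * (w₁ * b₄ -
        w₂ * b₃)) * t0 - ((z₁ * a₂ - z₂ * a₁) * (w₁ * c₄ - w₂ * c₃) - (z₁ * c₂ -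
        z₂ * c₁) * (w₁ * a₄ - w₂ * a₃)) * t1
      + ((z₁ * a₂ - z₂ * a₁) * (w₁ * b₄ - w₂ * b₃) - (z₁ * b₂ - z₂ * b₁) * (w₁ * a₄ - w₂ * a₃)) * t2
  field_simp
  linear_combination 2 * R * e1 - 8 * w₁ * ((b₄ * (z₁ * c₂ - z₂ * c₁) - c₄ * (z₁ * b₂ -
      z₂ * b₁)) * t0
      - (a₄ * (z₁ * c₂ - z₂ * c₁) - c₄ * (z₁ * a₂ - z₂ * a₁)) * t1 + (a₄ * (z₁ * b₂ - z₂ * b₁) -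
        b₄ * (z₁ * a₂ - z₂ * a₁)) * t2
      - (a₁ * (b₄ * c₂ - c₄ * b₂) - b₁ * (a₄ * c₂ - c₄ * a₂) + c₁ * (a₄ * b₂ - b₄ * a₂)) * hz)

/-! ### Invariance of the volume swept by a family of surfaces -/

theorem continuous_det3 {u v w : Space → ℝ} (hu : ContDiff ℝ 1 u) (hv : ContDiff ℝ 1 v)
    (hw : ContDiff ℝ 1 w) :
    Continuous fun q => det3 (fderiv ℝ u q) (fderiv ℝ v q) (fderiv ℝ w q) := by
  have cu := fun h => continuous_fderiv_apply hu h
  have cv := fun h => continuous_fderiv_apply hv h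
  have cw := fun h => continuous_fderiv_apply hw h
  simp only [det3]
  exact (((cu _).mul (((cv _).mul (cw _)).sub ((cv _).mul (cw _)))).sub
    ((cu _).mul (((cv _).mul (cw _)).sub ((cv _).mul (cw _))))).add
    ((cu _).mul (((cv _).mul (cw _)).sub ((cv _).mul (cw _))))

theorem det3_zero (b c : Space →L[ℝ] ℝ) : det3 0 b c = 0 := by simp [det3]

theorem BoundedOnSlab.integrableOn_det3 {x : Space →L[ℝ] ℝ} {u v w : Space → ℝ}
    (hb : BoundedOnSlab x u) (hu : ContDiff ℝ 1 u) (hv : ContDiff ℝ 1 v) (hw : ContDiff ℝ 1 w) :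
    IntegrableOn (fun q => det3 (fderiv ℝ u q) (fderiv ℝ v q) (fderiv ℝ w q)) (slab x) := by
  obtain ⟨r, hr⟩ := hb
  have h1 := (continuous_det3 hu hv hw).continuousOn.integrableOn_compact (μ := volume)
    (isCompact_closedBall (0 : Space) r)
  refine h1.of_forall_sdiff_eq_zero (measurableSet_slab x) fun q hq => ?_
  have hd : fderiv ℝ u q = 0 := by
    have : u =ᶠ[𝓝 q] fun _ => 0 := by
      have o1 : {p : Space | r < ‖p‖} ∈ 𝓝 q :=
        (isOpen_lt continuous_const continuous_norm).mem_nhds (by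
          simpa using hq.2)
      have o2 : {p : Space | |x p| < Real.pi} ∈ 𝓝 q :=
        (isOpen_lt x.continuous.abs continuous_const).mem_nhds
          (abs_lt.2 ⟨lt_of_lt_of_le (by linarith [Real.pi_pos]) hq.1.1, hq.1.2⟩)
      filter_upwards [o1, o2] with p hp1 hp2
      by_contra h
      exact absurd (hr p h (le_of_lt hp2)) (not_le.2 hp1)
    rw [this.fderiv_eq, fderiv_fun_const]; rfl
  rw [hd, det3_zero]

/-- Two triples of periodic functions which differ on a bounded part of the slab have the
same integral of the Jacobian determinant. -/
theorem integral_slab_det3_sub_eq_zero {u v w u' v' w' : Space → ℝ} (x : Space →L[ℝ] ℝ) {τ : Space}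
    (hτ : x τ = Real.pi) (hu : ContDiff ℝ 1 u) (hv : ContDiff ℝ 1 v) (hw : ContDiff ℝ 1 w)
    (hu' : ContDiff ℝ 1 u') (hv' : ContDiff ℝ 1 v') (hw' : ContDiff ℝ 1 w')
    (pu : ∀ q, u (q + τ) = u q) (pv : ∀ q, v (q + τ) = v q) (pw : ∀ q, w (q + τ) = w q)
    (pu' : ∀ q, u' (q + τ) = u' q) (pv' : ∀ q, v' (q + τ) = v' q) (pw' : ∀ q, w' (q + τ) = w' q)
    (bu : BoundedOnSlab x fun q => u q - u' q) (bv : BoundedOnSlab x fun q => v q - v' q)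
    (bw : BoundedOnSlab x fun q => w q - w' q) :
    IntegrableOn (fun q => det3 (fderiv ℝ u q) (fderiv ℝ v q) (fderiv ℝ w q) -
      det3 (fderiv ℝ u' q) (fderiv ℝ v' q) (fderiv ℝ w' q)) (slab x) ∧
    ∫ q in slab x, (det3 (fderiv ℝ u q) (fderiv ℝ v q) (fderiv ℝ w q) -
      det3 (fderiv ℝ u' q) (fderiv ℝ v' q) (fderiv ℝ w' q)) = 0 := by
  have hd : ∀ f g : Space → ℝ, ContDiff ℝ 1 f → ContDiff ℝ 1 g → ∀ q,
      fderiv ℝ (fun q => f q - g q) q = fderiv ℝ f q - fderiv ℝ g q := fun f g hf hg q =>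
    fderiv_fun_sub (hf.differentiable one_ne_zero q) (hg.differentiable one_ne_zero q)
  have e : ∀ q, det3 (fderiv ℝ u q) (fderiv ℝ v q) (fderiv ℝ w q) -
      det3 (fderiv ℝ u' q) (fderiv ℝ v' q) (fderiv ℝ w' q) =
      det3 (fderiv ℝ (fun q => u q - u' q) q) (fderiv ℝ v q) (fderiv ℝ w q) +
      det3 (fderiv ℝ (fun q => v q - v' q) q) (fderiv ℝ w q) (fderiv ℝ u' q) +
      det3 (fderiv ℝ (fun q => w q - w' q) q) (fderiv ℝ u' q) (fderiv ℝ v' q) := fun q => by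
    -- the three functions are replaced one after the other, up to a cyclic permutation
    rw [hd u u' hu hu', hd v v' hv hv', hd w w' hw hw']
    simp only [det3, sub_apply]; ring
  simp_rw [e]
  have i1 := bu.integrableOn_det3 (hu.sub hu') hv hw
  have i2 := bv.integrableOn_det3 (hv.sub hv') hw hu'
  have i3 := bw.integrableOn_det3 (hw.sub hw') hu' hv'
  have i12 : IntegrableOn (fun q => det3 (fderiv ℝ (fun q => u q - u' q) q) (fderiv ℝ v q)
      (fderiv ℝ w q) + det3 (fderiv ℝ (fun q => v q - v' q) q) (fderiv ℝ w q)
      (fderiv ℝ u' q)) (slab x) := i1.add i2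
  refine ⟨i12.add i3, ?_⟩
  rw [integral_add i12 i3, integral_add i1 i2,
    integral_slab_det3_fderiv_eq_zero x hτ (hu.sub hu') hv hw
      (fun q => by simp [pu, pu']) pv pw bu,
    integral_slab_det3_fderiv_eq_zero x hτ (hv.sub hv') hw hu'
      (fun q => by simp [pv, pv']) pw pu' bv,
    integral_slab_det3_fderiv_eq_zero x hτ (hw.sub hw') hu' hv'
      (fun q => by simp [pw, pw']) pu' pv' bw]
  simp

/-- The pull-back of the volume form of the quadric by `X`, in coordinates. -/
def jac (X : Space → W) (q : Space) : ℝ :=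
  vol (X q) (fderiv ℝ X q ((1, 0), 0)) (fderiv ℝ X q ((0, 1), 0)) (fderiv ℝ X q ((0, 0), 1))

/-- The function `w₁ z / R`, for a linear form `z`; see `vol_eq_det33`. -/
def prim (z : W → ℝ) (x : W) : ℝ := pw₁ x * z x / pR x

theorem contDiff_pR : ContDiff ℝ ∞ pR := by unfold pR pw₁ pw₂; fun_prop

theorem contDiff_prim {z : W → ℝ} (hz : ContDiff ℝ ∞ z) : ContDiff ℝ ∞ (prim z) := by
  have : ContDiff ℝ ∞ pw₁ := by unfold pw₁; fun_prop
  exact (this.mul hz).div contDiff_pR fun x => (pR_pos x).ne'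

theorem fderiv_prim {z : W → ℝ} (hz : ContDiff ℝ ∞ z)
    (hlin : ∀ x a : W, ∀ τ : ℝ, z (x + τ • a) = z x + τ * z a) (x a : W) :
    fderiv ℝ (prim z) x a = dcoef z x a := by
  have h : HasLineDerivAt ℝ (prim z) (fderiv ℝ (prim z) x a) x a :=
    ((contDiff_prim hz).differentiable (by simp) x).hasFDerivAt.hasLineDerivAt a
  refine h.unique ?_
  have haff : ∀ c d : ℝ, HasDerivAt (fun τ : ℝ => c + τ * d) d 0 := fun c d => by
    simpa using ((hasDerivAt_id (0 : ℝ)).mul_const d).const_add c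
  have e : (fun τ : ℝ => prim z (x + τ • a)) = fun τ => (pw₁ x + τ * pw₁ a) * (z x + τ * z a) /
      (2 + (pw₁ x + τ * pw₁ a) ^ 2 + (pw₂ x + τ * pw₂ a) ^ 2) := by
    ext τ
    have e1 : pw₁ (x + τ • a) = pw₁ x + τ * pw₁ a := by simp [pw₁]; ring
    have e2 : pw₂ (x + τ • a) = pw₂ x + τ * pw₂ a := by simp [pw₂]; ring
    rw [prim, pR, hlin, e1, e2]
  have hR : 2 + (pw₁ x + 0 * pw₁ a) ^ 2 + (pw₂ x + 0 * pw₂ a) ^ 2 ≠ 0 := by positivity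
  have hR' : pR x ≠ 0 := (pR_pos x).ne'
  have h1 := ((haff (pw₁ x) (pw₁ a)).fun_mul (haff (z x) (z a))).fun_div
    ((((haff (pw₁ x) (pw₁ a)).fun_pow 2).const_add 2).fun_add ((haff (pw₂ x) (pw₂ a)).fun_pow 2)) hR
  rw [HasLineDerivAt, e]
  refine HasDerivAt.congr_deriv h1 ?_
  have hRe : 2 + pw₁ x ^ 2 + pw₂ x ^ 2 = pR x := rfl
  simp only [zero_mul, add_zero, dcoef]
  rw [hRe]
  field_simp
  push_cast
  ring

theorem contDiff_pz₁ : ContDiff ℝ ∞ pz₁ := by unfold pz₁; fun_prop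
theorem contDiff_pz₂ : ContDiff ℝ ∞ pz₂ := by unfold pz₂; fun_prop
theorem contDiff_pw₂ : ContDiff ℝ ∞ pw₂ := by unfold pw₂; fun_prop

theorem fderiv_linear_comp {z : W → ℝ} (hz : ContDiff ℝ ∞ z)
    (hlin : ∀ x a : W, ∀ τ : ℝ, z (x + τ • a) = z x + τ * z a) {X : Space → W} {q : Space}
    (hX : DifferentiableAt ℝ X q) (h : Space) :
    fderiv ℝ (fun p => z (X p)) q h = z (fderiv ℝ X q h) := by
  have h1 := fderiv_fun_comp (𝕜 := ℝ) q ((hz.differentiable (by simp)) (X q)) hX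
  rw [h1, ContinuousLinearMap.comp_apply]
  have h2 : HasLineDerivAt ℝ z _ (X q) (fderiv ℝ X q h) :=
    ((hz.differentiable (by simp)) (X q)).hasFDerivAt.hasLineDerivAt _
  refine h2.unique ?_
  rw [HasLineDerivAt]
  simp_rw [hlin]
  simpa using ((hasDerivAt_id (0 : ℝ)).mul_const (z (fderiv ℝ X q h))).const_add (z (X q))

theorem fderiv_prim_comp {z : W → ℝ} (hz : ContDiff ℝ ∞ z)
    (hlin : ∀ x a : W, ∀ τ : ℝ, z (x + τ • a) = z x + τ * z a) {X : Space → W} {q : Space}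
    (hX : DifferentiableAt ℝ X q) (h : Space) :
    fderiv ℝ (fun p => prim z (X p)) q h = dcoef z (X q) (fderiv ℝ X q h) := by
  have h1 := fderiv_fun_comp (𝕜 := ℝ) q (((contDiff_prim hz).differentiable (by simp)) (X q)) hX
  rw [h1, ContinuousLinearMap.comp_apply, fderiv_prim hz hlin]

theorem form_fderiv_eq_zero {E : Type*} [NormedAddCommGroup E] [NormedSpace ℝ E] {X : E → W}
    {q : E} {c : ℝ} (hX : DifferentiableAt ℝ X q) (hf : ∀ᶠ p in 𝓝 q, form (X p) (X p) = c) (h : E) :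
    form (X q) (fderiv ℝ X q h) = 0 := by
  have hi : ∀ i, HasFDerivAt (fun p => X p i)
      ((ContinuousLinearMap.proj (R := ℝ) (φ := fun _ : Fin 4 => ℝ) i).comp (fderiv ℝ X q)) q :=
    fun i => hasFDerivAt_pi'.1 hX.hasFDerivAt i
  have h1 := ((((hi 1).mul (hi 2)).add ((hi 2).mul (hi 1))).sub ((hi 0).mul (hi 3))).sub
    ((hi 3).mul (hi 0))
  have h2 : HasFDerivAt (fun p => form (X p) (X p)) (0 : E →L[ℝ] ℝ) q :=
    (hasFDerivAt_const c q).congr_of_eventuallyEq hf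
  have := congrArg (fun L : E →L[ℝ] ℝ => L h) (h1.unique h2)
  simp at this
  simp only [form]
  linarith

/-- The pull-back of the volume form as a combination of Jacobian determinants of scalar functions. -/
theorem jac_eq {X : Space → W} {q : Space} (hX : DifferentiableAt ℝ X q)
    (hf : ∀ᶠ p in 𝓝 q, form (X p) (X p) = -1) :
    jac X q = (1 / 2) * (
      det3 (fderiv ℝ (fun p => prim pz₁ (X p)) q) (fderiv ℝ (fun p => pw₂ (X p)) q)
        (fderiv ℝ (fun p => pz₂ (X p)) q) -
      det3 (fderiv ℝ (fun p => prim pz₂ (X p)) q) (fderiv ℝ (fun p => pw₂ (X p)) q)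
        (fderiv ℝ (fun p => pz₁ (X p)) q)) := by
  have l1 : ∀ x a : W, ∀ τ : ℝ, pz₁ (x + τ • a) = pz₁ x + τ * pz₁ a := fun x a τ => by
    simp [pz₁]; ring
  have l2 : ∀ x a : W, ∀ τ : ℝ, pz₂ (x + τ • a) = pz₂ x + τ * pz₂ a := fun x a τ => by
    simp [pz₂]; ring
  have l3 : ∀ x a : W, ∀ τ : ℝ, pw₂ (x + τ • a) = pw₂ x + τ * pw₂ a := fun x a τ => by
    simp [pw₂]; ring
  simp only [det3, fderiv_prim_comp contDiff_pz₁ l1 hX, fderiv_prim_comp contDiff_pz₂ l2 hX,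
    fderiv_linear_comp contDiff_pz₁ l1 hX, fderiv_linear_comp contDiff_pz₂ l2 hX,
    fderiv_linear_comp contDiff_pw₂ l3 hX]
  exact vol_eq_det33 (x := X q) (a := ![fderiv ℝ X q ((1, 0), 0), fderiv ℝ X q ((0, 1), 0),
    fderiv ℝ X q ((0, 0), 1)]) hf.self_of_nhds fun i => by
      fin_cases i <;> exact form_fderiv_eq_zero hX hf _

/-- A `C¹` family of surfaces in the quadric, parametrised by the strip which covers the annulus
and invariant under the deck transformation `(π, π)` of the strip. -/
structure IsFamily (X : Space → W) : Prop where
  smooth : ContDiffOn ℝ 1 X (strip ×ˢ univ)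
  mem : ∀ q ∈ strip ×ˢ (univ : Set ℝ), form (X q) (X q) = -1
  per : ∀ q, X (q + ((Real.pi, Real.pi), 0)) = X q

/-- A periodic cut-off function of `y - x`, supported in the strip and equal to `1` over a compact
part of the annulus. -/
theorem exists_strip_cutoff {m : ℝ} (hm : 0 < m) : ∃ κ : Space → ℝ, ContDiff ℝ 1 κ ∧
    tsupport κ ⊆ strip ×ˢ univ ∧ (∀ q, κ (q + ((Real.pi, Real.pi), 0)) = κ q) ∧
    ∀ q : Space, q.1 ∈ strip → q.1 ∈ core m → ∀ᶠ p in 𝓝 q, κ p = 1 := by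
  set K : Set ℝ := {b | b ∈ Icc 0 Real.pi ∧ m ≤ |Real.sin b|} with hK
  have hKc : IsCompact K := isCompact_Icc.inter_right
    (isClosed_le continuous_const (Real.continuous_sin.abs))
  have hKO : K ⊆ Ioo 0 Real.pi := by
    rintro b ⟨⟨h0, h1⟩, h2⟩
    refine ⟨lt_of_le_of_ne h0 ?_, lt_of_le_of_ne h1 ?_⟩
    · rintro rfl; simp at h2; linarith
    · rintro rfl; simp at h2; linarith
  obtain ⟨h, hh, -, hs, h1⟩ := exists_contDiff_cutoff hKc isOpen_Ioo hKO
  have hc : Continuous fun q : Space => q.1.2 - q.1.1 := by fun_prop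
  refine ⟨fun q => h (q.1.2 - q.1.1), ?_, ?_, fun q => ?_, fun q hq hq' => ?_⟩
  · exact (hh.of_le (by exact_mod_cast le_top)).comp (by fun_prop)
  · have : tsupport (fun q : Space => h (q.1.2 - q.1.1)) ⊆
        (fun q : Space => q.1.2 - q.1.1) ⁻¹' tsupport h :=
      tsupport_comp_subset_preimage h hc
    intro q hq
    have := hs (this hq)
    exact ⟨⟨by linarith [this.1], by linarith [this.2]⟩, mem_univ _⟩
  · simp
  · exact hc.continuousAt.eventually (h1 (q.1.2 - q.1.1)
      ⟨⟨by linarith [hq.1], by linarith [hq.2]⟩, hq'⟩)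

/-- The projection to the first angular coordinate. -/
def fst₃ : Space →L[ℝ] ℝ := (ContinuousLinearMap.fst ℝ ℝ ℝ).comp (ContinuousLinearMap.fst ℝ (ℝ × ℝ) ℝ)

theorem measurableSet_fundDomain : MeasurableSet fundDomain := by
  have h : fundDomain = {z : ℝ × ℝ | 0 ≤ z.1} ∩ ({z | z.1 < Real.pi} ∩ strip) := rfl
  rw [h]
  exact (isClosed_le continuous_const continuous_fst).measurableSet.inter
    ((isOpen_lt continuous_fst continuous_const).measurableSet.inter isOpen_strip.measurableSet)

theorem fundDomain_subset_strip : fundDomain ⊆ strip := fun _ hz => ⟨hz.2.2.1, hz.2.2.2⟩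

/-- The integral of the pull-back of the volume form depends only on the boundary values. -/
theorem integral_jac_sub_eq_zero {X Y : Space → W} (hX : IsFamily X) (hY : IsFamily Y) {m : ℝ}
    (hm : 0 < m) (hcore : ∀ q : Space, q.1 ∈ strip → q.1 ∉ core m → X q = Y q)
    (htime : ∀ q : Space, q.1 ∈ strip → q.2 ∉ Icc (0 : ℝ) 1 → X q = Y q) :
    IntegrableOn (fun q => jac X q - jac Y q) (fundDomain ×ˢ Icc 0 1) ∧
    ∫ q in fundDomain ×ˢ Icc (0 : ℝ) 1, (jac X q - jac Y q) = 0 := by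
  obtain ⟨κ, hκ, hκs, hκp, hκ1⟩ := exists_strip_cutoff hm
  have hopen : IsOpen (strip ×ˢ (univ : Set ℝ)) := isOpen_strip.prod isOpen_univ
  -- the set outside of which the two families agree
  set S : Set Space := (strip ∩ core m) ×ˢ Icc 0 1 with hS
  have hagree : ∀ q : Space, q.1 ∈ strip → q ∉ S → X q = Y q := fun q hq hqS => by
    by_cases h1 : q.1 ∈ core m
    · exact htime q hq fun h2 => hqS ⟨⟨hq, h1⟩, h2⟩
    · exact hcore q hq h1
  have hcl : ∀ q : Space, q.1 ∈ strip → q ∉ S → ∀ᶠ p in 𝓝 q, X p = Y p := fun q hq hqS => by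
    have o1 : strip ×ˢ (univ : Set ℝ) ∈ 𝓝 q := hopen.mem_nhds ⟨hq, mem_univ _⟩
    have o2 : (core m ×ˢ Icc (0 : ℝ) 1)ᶜ ∈ 𝓝 q :=
      ((isClosed_core m).prod isClosed_Icc).isOpen_compl.mem_nhds fun h => hqS ⟨⟨hq, h.1⟩, h.2⟩
    filter_upwards [o1, o2] with p hp1 hp2
    exact hagree p hp1.1 fun h => hp2 ⟨h.1.2, h.2⟩
  -- the scalar functions which enter the primitive, cut off near the ends of the annulus
  have hsm : ∀ {Z : Space → W}, IsFamily Z → ∀ {f : W → ℝ}, ContDiff ℝ ∞ f →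
      ContDiff ℝ 1 fun q => κ q * f (Z q) := fun hZ f hf =>
    contDiff_mul_of_tsupport_subset hκ hopen hκs
      ((hf.of_le (by exact_mod_cast le_top)).comp_contDiffOn hZ.smooth)
  have hper : ∀ {Z : Space → W}, IsFamily Z → ∀ (f : W → ℝ) q,
      κ (q + ((Real.pi, Real.pi), 0)) * f (Z (q + ((Real.pi, Real.pi), 0))) = κ q * f (Z q) :=
    fun hZ f q => by rw [hκp, hZ.per]
  have hdiff : ∀ (f : W → ℝ) q, q ∉ S → κ q * f (X q) = κ q * f (Y q) := fun f q hq => by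
    by_cases hs : q.1 ∈ strip
    · rw [hagree q hs hq]
    · have : κ q = 0 := by
        by_contra h
        exact hs (hκs (subset_tsupport _ h)).1
      simp [this]
  have hbd : ∀ f : W → ℝ, BoundedOnSlab fst₃ fun q => κ q * f (X q) - κ q * f (Y q) := fun f => by
    refine ⟨2 * Real.pi, fun q hq hx => ?_⟩
    have hqS : q ∈ S := by
      by_contra h
      exact hq (sub_eq_zero.2 (hdiff f q h))
    obtain ⟨⟨⟨h1, h2⟩, -⟩, h3, h4⟩ := hqS
    have hx' := abs_le.1 (show |q.1.1| ≤ Real.pi from hx)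
    have hp := Real.pi_gt_three
    rw [Prod.norm_def, Prod.norm_def, sup_le_iff, sup_le_iff, Real.norm_eq_abs, Real.norm_eq_abs,
      Real.norm_eq_abs, abs_le, abs_le, abs_le]
    refine ⟨⟨⟨?_, ?_⟩, ?_, ?_⟩, ?_, ?_⟩ <;> linarith
  have hτ : fst₃ ((Real.pi, Real.pi), 0) = Real.pi := rfl
  obtain ⟨i1, e1⟩ := integral_slab_det3_sub_eq_zero fst₃ hτ
    (hsm hX (contDiff_prim contDiff_pz₁)) (hsm hX contDiff_pw₂) (hsm hX contDiff_pz₂)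
    (hsm hY (contDiff_prim contDiff_pz₁)) (hsm hY contDiff_pw₂) (hsm hY contDiff_pz₂)
    (hper hX _) (hper hX _) (hper hX _) (hper hY _) (hper hY _) (hper hY _)
    (hbd _) (hbd _) (hbd _)
  obtain ⟨i2, e2⟩ := integral_slab_det3_sub_eq_zero fst₃ hτ
    (hsm hX (contDiff_prim contDiff_pz₂)) (hsm hX contDiff_pw₂) (hsm hX contDiff_pz₁)
    (hsm hY (contDiff_prim contDiff_pz₂)) (hsm hY contDiff_pw₂) (hsm hY contDiff_pz₁)
    (hper hX _) (hper hX _) (hper hX _) (hper hY _) (hper hY _) (hper hY _)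
    (hbd _) (hbd _) (hbd _)
  -- the cut-off does not matter where the two families differ
  have hκf : ∀ {Z : Space → W} {q : Space}, q ∈ S → ∀ f : W → ℝ,
      fderiv ℝ (fun p => κ p * f (Z p)) q = fderiv ℝ (fun p => f (Z p)) q := fun hq f => by
    refine Filter.EventuallyEq.fderiv_eq ?_
    filter_upwards [hκ1 _ hq.1.1 hq.1.2] with p hp
    rw [hp, one_mul]
  have hoff : ∀ q ∉ S, ∀ f : W → ℝ,
      fderiv ℝ (fun p => κ p * f (X p)) q = fderiv ℝ (fun p => κ p * f (Y p)) q := by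
    intro q hq f
    refine Filter.EventuallyEq.fderiv_eq ?_
    by_cases hs : q.1 ∈ strip
    · filter_upwards [hcl q hs hq] with p hp
      rw [hp]
    · filter_upwards [notMem_tsupport_iff_eventuallyEq.1 fun h => hs (hκs h).1] with p hp
      simp [hp]
  set T : Space → ℝ := fun q => (1 / 2) * (
    (det3 (fderiv ℝ (fun p => κ p * prim pz₁ (X p)) q) (fderiv ℝ (fun p => κ p * pw₂ (X p)) q)
        (fderiv ℝ (fun p => κ p * pz₂ (X p)) q) -
      det3 (fderiv ℝ (fun p => κ p * prim pz₁ (Y p)) q) (fderiv ℝ (fun p => κ p * pw₂ (Y p)) q)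
        (fderiv ℝ (fun p => κ p * pz₂ (Y p)) q)) -
    (det3 (fderiv ℝ (fun p => κ p * prim pz₂ (X p)) q) (fderiv ℝ (fun p => κ p * pw₂ (X p)) q)
        (fderiv ℝ (fun p => κ p * pz₁ (X p)) q) -
      det3 (fderiv ℝ (fun p => κ p * prim pz₂ (Y p)) q) (fderiv ℝ (fun p => κ p * pw₂ (Y p)) q)
        (fderiv ℝ (fun p => κ p * pz₁ (Y p)) q))) with hT
  have hTi : IntegrableOn T (slab fst₃) := (i1.sub i2).const_mul _
  have hT0 : ∫ q in slab fst₃, T q = 0 := by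
    rw [integral_const_mul, integral_sub i1 i2, e1, e2, sub_zero, mul_zero]
  have hToff : ∀ q ∉ S, T q = 0 := fun q hq => by
    simp only [hT, hoff q hq, sub_self, mul_zero]
  have hjac : ∀ {Z : Space → W}, IsFamily Z → ∀ q : Space, q.1 ∈ strip → jac Z q = (1 / 2) * (
      det3 (fderiv ℝ (fun p => prim pz₁ (Z p)) q) (fderiv ℝ (fun p => pw₂ (Z p)) q)
        (fderiv ℝ (fun p => pz₂ (Z p)) q) -
      det3 (fderiv ℝ (fun p => prim pz₂ (Z p)) q) (fderiv ℝ (fun p => pw₂ (Z p)) q)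
        (fderiv ℝ (fun p => pz₁ (Z p)) q)) := fun {Z} hZ q hq =>
    have hn : strip ×ˢ (univ : Set ℝ) ∈ 𝓝 q := hopen.mem_nhds ⟨hq, mem_univ _⟩
    jac_eq ((hZ.smooth.contDiffAt hn).differentiableAt one_ne_zero)
      (Filter.mem_of_superset hn hZ.mem)
  have hTjac : ∀ q : Space, q.1 ∈ strip → jac X q - jac Y q = T q := fun q hq => by
    by_cases hqS : q ∈ S
    · rw [hjac hX q hq, hjac hY q hq]
      simp only [hT, hκf hqS]
      ring
    · have h : X =ᶠ[𝓝 q] Y := hcl q hq hqS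
      rw [hToff q hqS, jac, jac, h.fderiv_eq, hagree q hq hqS, sub_self]
  have hstrip : ∀ q ∈ fundDomain ×ˢ Icc (0 : ℝ) 1, q.1 ∈ strip := fun q hq =>
    ⟨hq.1.2.2.1, hq.1.2.2.2⟩
  have hsub : fundDomain ×ˢ Icc (0 : ℝ) 1 ⊆ slab fst₃ := fun q hq => ⟨hq.1.1, hq.1.2.1⟩
  have hmeas : MeasurableSet (fundDomain ×ˢ Icc (0 : ℝ) 1) :=
    measurableSet_fundDomain.prod measurableSet_Icc
  refine ⟨(hTi.mono_set hsub).congr_fun (fun q hq => (hTjac q (hstrip q hq)).symm) hmeas, ?_⟩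
  rw [setIntegral_congr_fun hmeas fun q hq => hTjac q (hstrip q hq)]
  refine Eq.trans (Eq.symm ?_) hT0
  refine setIntegral_eq_of_subset_of_forall_sdiff_eq_zero (measurableSet_slab _) hsub fun q hq => ?_
  refine hToff q fun h => hq.2 ⟨⟨hq.1.1, hq.1.2, h.1.1.1, h.1.1.2⟩, h.2⟩

/-! ### The integral of `ω` over a lens cobordism -/

theorem integrableOn_of_core {G : Space → ℝ} {m : ℝ} (hm : 0 < m)
    (hG : ContinuousOn G (annulusCover ×ˢ Icc (0 : ℝ) 1))
    (h0 : ∀ q ∈ annulusCover ×ˢ Icc (0 : ℝ) 1, q.1 ∉ core m → G q = 0) :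
    IntegrableOn G (fundDomain ×ˢ Icc 0 1) := by
  set K : Set Space := ((Icc (0 : ℝ) Real.pi ×ˢ Icc (0 : ℝ) (2 * Real.pi)) ∩ core m) ×ˢ Icc (0 : ℝ) 1
  have hK : IsCompact K :=
    ((isCompact_Icc.prod isCompact_Icc).inter_right (isClosed_core m)).prod isCompact_Icc
  have hsub : K ⊆ annulusCover ×ˢ Icc (0 : ℝ) 1 := fun q hq => ⟨core_subset hm hq.1.2, hq.2⟩
  refine ((hG.mono hsub).integrableOn_compact (μ := volume) hK).of_forall_sdiff_eq_zero
    (measurableSet_fundDomain.prod measurableSet_Icc) fun q hq => ?_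
  refine h0 q ⟨strip_subset (fundDomain_subset_strip hq.1.1), hq.1.2⟩ fun h => hq.2 ?_
  obtain ⟨⟨⟨h1, h2, h3, h4⟩, h5⟩, -⟩ := hq
  exact ⟨⟨⟨⟨h1, h2.le⟩, by linarith, by linarith⟩, h⟩, h5⟩

theorem uniqueDiffOn_cobordism : UniqueDiffOn ℝ (annulusCover ×ˢ Icc (0 : ℝ) 1) :=
  isOpen_annulusCover.uniqueDiffOn.prod (uniqueDiffOn_Icc one_pos)

theorem continuousOn_vol {T : Type*} [TopologicalSpace T] {a b c d : T → W} {s : Set T}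
    (ha : ContinuousOn a s) (hb : ContinuousOn b s) (hc : ContinuousOn c s)
    (hd : ContinuousOn d s) : ContinuousOn (fun q => vol (a q) (b q) (c q) (d q)) s := by
  have ha' := fun i => continuousOn_pi.1 ha i
  have hb' := fun i => continuousOn_pi.1 hb i
  have hc' := fun i => continuousOn_pi.1 hc i
  have hd' := fun i => continuousOn_pi.1 hd i
  simp only [vol_eq]
  fun_prop

theorem IsLensCobordism.contDiffOn_one {k : ℕ∞} (hk : 1 ≤ k) {φ : RP1 × RP1 → ℝ → W × W}
    (h : IsLensCobordism k φ) :
    ContDiffOn ℝ 1 (cobordismLift φ) (annulusCover ×ˢ Icc (0 : ℝ) 1) :=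
  h.smooth.of_le (by exact_mod_cast hk)

theorem IsLensCobordism.exists_core {k : ℕ∞} {φ : RP1 × RP1 → ℝ → W × W}
    (h : IsLensCobordism k φ) : ∃ m > 0, ∀ z ∈ annulusCover, z ∉ core m →
      ∀ t ∈ Icc (0 : ℝ) 1, φ (angles z) t = φ (angles z) 0 := by
  obtain ⟨K, hK, hc⟩ := h.constant
  obtain ⟨m, hm, hKm⟩ := hK.exists_core
  exact ⟨m, hm, fun z hz hzm => hc _ hz fun h => hzm (hKm z h)⟩

theorem fderivWithin_time_eq_zero {Φ : Space → W × W}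
    (hΦ : ContDiffOn ℝ 1 Φ (annulusCover ×ˢ Icc (0 : ℝ) 1)) {z : ℝ × ℝ} (hz : z ∈ annulusCover)
    (hc : ∀ t ∈ Icc (0 : ℝ) 1, Φ (z, t) = Φ (z, 0)) {t : ℝ} (ht : t ∈ Icc (0 : ℝ) 1) :
    fderivWithin ℝ Φ (annulusCover ×ˢ Icc (0 : ℝ) 1) (z, t) (0, 1) = 0 := by
  have h1 : HasFDerivWithinAt Φ _ (annulusCover ×ˢ Icc (0 : ℝ) 1) (z, t) :=
    ((hΦ.differentiableOn one_ne_zero) (z, t) ⟨hz, ht⟩).hasFDerivWithinAt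
  have h2 : HasDerivWithinAt (fun τ : ℝ => (z, τ)) ((0 : ℝ × ℝ), (1 : ℝ)) (Icc 0 1) t :=
    (hasDerivWithinAt_const t _ z).prodMk (hasDerivWithinAt_id t _)
  have h3 := h1.comp_hasDerivWithinAt t h2 fun τ hτ => ⟨hz, hτ⟩
  have h4 : HasDerivWithinAt (Φ ∘ fun τ : ℝ => (z, τ)) 0 (Icc 0 1) t :=
    (hasDerivWithinAt_const t _ (Φ (z, 0))).congr (fun τ hτ => hc τ hτ) (hc t ht)
  exact (uniqueDiffOn_Icc one_pos t ht).eq_deriv _ h3 h4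

theorem IsLensCobordism.continuousOn_omegaDensity {k : ℕ∞} (hk : 1 ≤ k)
    {φ : RP1 × RP1 → ℝ → W × W} (h : IsLensCobordism k φ) :
    ContinuousOn (omegaDensity φ) (annulusCover ×ˢ Icc (0 : ℝ) 1) := by
  have hD := (h.contDiffOn_one hk).continuousOn_fderivWithin uniqueDiffOn_cobordism le_rfl
  have h0 := (h.contDiffOn_one hk).continuousOn
  exact continuousOn_vol (continuous_fst.comp_continuousOn h0)
    (continuous_fst.comp_continuousOn (hD.clm_apply continuousOn_const))
    (continuous_fst.comp_continuousOn (hD.clm_apply continuousOn_const))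
    (continuous_fst.comp_continuousOn (hD.clm_apply continuousOn_const))

theorem vol_neg₂ (a b c d : W) : vol a (-b) c d = -vol a b c d := by
  simp only [vol_eq, Pi.neg_apply]; ring

/-- The frame `(-∂ₜ, e₁, e₂)`, with `e₁ = ∂_y` and `e₂ = ∂_x`, has the orientation of
`(∂_x, ∂_y, ∂ₜ)`. -/
theorem omegaDensity_eq {φ : RP1 × RP1 → ℝ → W × W} (q : Space) :
    omegaDensity φ q = vol (cobordismLift φ q).1
      (fderivWithin ℝ (cobordismLift φ) (annulusCover ×ˢ Icc (0 : ℝ) 1) q ((1, 0), 0)).1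
      (fderivWithin ℝ (cobordismLift φ) (annulusCover ×ˢ Icc (0 : ℝ) 1) q ((0, 1), 0)).1
      (fderivWithin ℝ (cobordismLift φ) (annulusCover ×ˢ Icc (0 : ℝ) 1) q ((0, 0), 1)).1 := by
  have e : ((0 : ℝ × ℝ), (-1 : ℝ)) = -((0, 0), 1) := by
    rw [Prod.neg_mk, ← Prod.zero_eq_mk, neg_zero]
  simp only [omegaDensity, omegaForm, e, map_neg, Prod.fst_neg, vol_neg₂]
  simp only [vol_eq, e₁, e₂]
  ring

theorem IsLensCobordism.omegaDensity_eq_zero {k : ℕ∞} (hk : 1 ≤ k) {φ : RP1 × RP1 → ℝ → W × W}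
    (h : IsLensCobordism k φ) {z : ℝ × ℝ} (hz : z ∈ annulusCover)
    (hc : ∀ t ∈ Icc (0 : ℝ) 1, φ (angles z) t = φ (angles z) 0) {t : ℝ} (ht : t ∈ Icc (0 : ℝ) 1) :
    omegaDensity φ (z, t) = 0 := by
  have := fderivWithin_time_eq_zero (h.contDiffOn_one hk) hz hc ht
  rw [omegaDensity_eq]
  rw [show (((0 : ℝ), (0 : ℝ)), (1 : ℝ)) = (0, 1) from rfl, this]
  simp [vol_eq]

/-- The family of surfaces traced by a cobordism, with time reparametrised so that it is
stationary outside `[0, 1]`. -/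
def family (φ : RP1 × RP1 → ℝ → W × W) (q : Space) : W :=
  (cobordismLift φ (q.1, Real.smoothTransition q.2)).1

theorem smoothTransition_mem (t : ℝ) : Real.smoothTransition t ∈ Icc (0 : ℝ) 1 :=
  ⟨Real.smoothTransition.nonneg t, Real.smoothTransition.le_one t⟩

theorem IsLensCobordism.isFamily {k : ℕ∞} (hk : 1 ≤ k) {φ : RP1 × RP1 → ℝ → W × W}
    (h : IsLensCobordism k φ) : IsFamily (family φ) where
  smooth := by
    have hT : ContDiff ℝ 1 fun q : Space => (q.1, Real.smoothTransition q.2) :=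
      contDiff_fst.prodMk (Real.smoothTransition.contDiff.comp contDiff_snd)
    exact contDiff_fst.comp_contDiffOn ((h.contDiffOn_one hk).comp hT.contDiffOn
      fun q hq => ⟨strip_subset hq.1, smoothTransition_mem _⟩)
  mem q hq := (h.mem _ (strip_subset hq.1) _ (smoothTransition_mem _)).1
  per q := by
    simp only [family, cobordismLift, Prod.fst_add, Prod.snd_add, add_zero]
    rw [angles_add_pi]

theorem IsLensCobordism.jac_family {k : ℕ∞} (hk : 1 ≤ k) {φ : RP1 × RP1 → ℝ → W × W}
    (h : IsLensCobordism k φ) {z : ℝ × ℝ} (hz : z ∈ strip) (t : ℝ) :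
    jac (family φ) (z, t) =
      omegaDensity φ (z, Real.smoothTransition t) * deriv Real.smoothTransition t := by
  set D := fderivWithin ℝ (cobordismLift φ) (annulusCover ×ˢ Icc (0 : ℝ) 1)
    (z, Real.smoothTransition t) with hD
  have h1 : HasFDerivWithinAt (cobordismLift φ) D (annulusCover ×ˢ Icc (0 : ℝ) 1)
      (z, Real.smoothTransition t) :=
    ((h.contDiffOn_one hk).differentiableOn one_ne_zero _
      ⟨strip_subset hz, smoothTransition_mem _⟩).hasFDerivWithinAt
  have hT : HasDerivAt Real.smoothTransition (deriv Real.smoothTransition t) t :=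
    ((Real.smoothTransition.contDiff (n := 1)).differentiable one_ne_zero t).hasDerivAt
  have hsnd : HasFDerivAt (fun q : Space => q.2) (ContinuousLinearMap.snd ℝ (ℝ × ℝ) ℝ) (z, t) :=
    hasFDerivAt_snd
  have hT' : HasFDerivAt (fun q : Space => Real.smoothTransition q.2)
      (deriv Real.smoothTransition t • ContinuousLinearMap.snd ℝ (ℝ × ℝ) ℝ) (z, t) :=
    HasDerivAt.comp_hasFDerivAt (f := fun q : Space => q.2) (z, t) hT hsnd
  have h2 : HasFDerivAt (fun q : Space => (q.1, Real.smoothTransition q.2))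
      ((ContinuousLinearMap.fst ℝ (ℝ × ℝ) ℝ).prod
        (deriv Real.smoothTransition t • ContinuousLinearMap.snd ℝ (ℝ × ℝ) ℝ)) (z, t) :=
    hasFDerivAt_fst.prodMk hT'
  have hn : strip ×ˢ (univ : Set ℝ) ∈ 𝓝 (z, t) :=
    (isOpen_strip.prod isOpen_univ).mem_nhds ⟨hz, mem_univ _⟩
  have h3 := HasFDerivWithinAt.comp_hasFDerivAt
    (f := fun q : Space => (q.1, Real.smoothTransition q.2)) (z, t) h1 h2 (by
      filter_upwards [hn] with q hq
      exact ⟨strip_subset hq.1, smoothTransition_mem _⟩)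
  have h4 : HasFDerivAt (family φ) _ (z, t) :=
    ((ContinuousLinearMap.fst ℝ W W).hasFDerivAt).comp (z, t) h3
  have e : D ((0, 0), deriv Real.smoothTransition t) =
      deriv Real.smoothTransition t • D ((0, 0), 1) := by
    rw [← map_smul]; simp
  rw [jac, h4.fderiv, omegaDensity_eq, ← hD]
  simp [e, family, vol_eq]
  ring

/-- The reparametrisation of time does not change the volume. -/
theorem IsLensCobordism.integral_omegaDensity {k : ℕ∞} (hk : 1 ≤ k) {φ : RP1 × RP1 → ℝ → W × W}
    (h : IsLensCobordism k φ) :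
    IntegrableOn (jac (family φ)) (fundDomain ×ˢ Icc (0 : ℝ) 1) ∧
    ∫ q in fundDomain ×ˢ Icc (0 : ℝ) 1, omegaDensity φ q =
      ∫ q in fundDomain ×ˢ Icc (0 : ℝ) 1, jac (family φ) q := by
  obtain ⟨m, hm, hc⟩ := h.exists_core
  have hcont := h.continuousOn_omegaDensity hk
  have hi : IntegrableOn (omegaDensity φ) (fundDomain ×ˢ Icc 0 1) :=
    integrableOn_of_core hm hcont fun q hq hqm =>
      h.omegaDensity_eq_zero hk hq.1 (hc _ hq.1 hqm) hq.2
  have hT1 : ContDiff ℝ 1 Real.smoothTransition := Real.smoothTransition.contDiff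
  have hTd : Continuous (deriv Real.smoothTransition) := hT1.continuous_deriv le_rfl
  set J : Space → ℝ := fun q =>
    omegaDensity φ (q.1, Real.smoothTransition q.2) * deriv Real.smoothTransition q.2 with hJ
  have hJc : ContinuousOn J (annulusCover ×ˢ Icc (0 : ℝ) 1) := by
    refine ContinuousOn.mul (hcont.comp (f := fun q : Space => (q.1, Real.smoothTransition q.2))
      (continuous_fst.prodMk (hT1.continuous.comp continuous_snd)).continuousOn
      fun q hq => ⟨hq.1, smoothTransition_mem _⟩) (hTd.comp continuous_snd).continuousOn
  have hJi : IntegrableOn J (fundDomain ×ˢ Icc 0 1) :=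
    integrableOn_of_core hm hJc fun q hq hqm => by
      rw [hJ]
      simp only
      rw [h.omegaDensity_eq_zero hk hq.1 (hc _ hq.1 hqm) (smoothTransition_mem _), zero_mul]
  have hmeas : MeasurableSet (fundDomain ×ˢ Icc (0 : ℝ) 1) :=
    measurableSet_fundDomain.prod measurableSet_Icc
  have hjJ : ∀ q ∈ fundDomain ×ˢ Icc (0 : ℝ) 1, jac (family φ) q = J q := fun q hq =>
    h.jac_family hk (fundDomain_subset_strip hq.1) q.2
  refine ⟨hJi.congr_fun (fun q hq => (hjJ q hq).symm) hmeas, ?_⟩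
  rw [setIntegral_congr_fun hmeas hjJ, Measure.volume_eq_prod, setIntegral_prod _ hi,
    setIntegral_prod _ hJi]
  refine setIntegral_congr_fun measurableSet_fundDomain fun z hz => ?_
  have hz' := strip_subset (fundDomain_subset_strip hz)
  simp only [integral_Icc_eq_integral_Ioc, ← intervalIntegral.integral_of_le zero_le_one, hJ]
  have key := intervalIntegral.integral_comp_mul_deriv' (a := 0) (b := 1)
    (f := Real.smoothTransition) (f' := deriv Real.smoothTransition)
    (g := fun t => omegaDensity φ (z, t))
    (fun t _ => ((hT1.differentiable one_ne_zero) t).hasDerivAt) hTd.continuousOn ?_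
  · rw [Real.smoothTransition.zero, Real.smoothTransition.one] at key
    exact key.symm
  · refine hcont.comp (f := fun t : ℝ => (z, t)) (by fun_prop) ?_
    rintro _ ⟨t, -, rfl⟩
    exact ⟨hz', smoothTransition_mem t⟩

theorem jac_smul {δ : ℝ} (hδ : δ ^ 2 = 1) (X : Space → W) (q : Space) :
    jac (fun p => δ • X p) q = jac X q := by
  have e : fderiv ℝ (fun p => δ • X p) q = δ • fderiv ℝ X q :=
    congrFun (fderiv_const_smul_field (𝕜 := ℝ) (f := X) δ) q
  simp only [jac, e, vol_eq, smul_apply, Pi.smul_apply, smul_eq_mul]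
  have h4 : δ ^ 4 = 1 := by rw [show δ ^ 4 = (δ ^ 2) ^ 2 by ring, hδ, one_pow]
  ring_nf
  simp only [h4, one_mul]

theorem IsFamily.smul {δ : ℝ} (hδ : δ ^ 2 = 1) {X : Space → W} (hX : IsFamily X) :
    IsFamily fun q => δ • X q where
  smooth := contDiffOn_const.fun_smul hX.smooth
  mem q hq := by
    rw [form_smul_left, form_smul_right, hX.mem q hq, ← mul_assoc, ← pow_two, hδ, one_mul]
  per q := by rw [hX.per]

/-- Two lens cobordisms have the same volume if their ends agree, or if they are opposite at both
ends: `-1` preserves the volume form of the quadric. -/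
theorem integral_omegaDensity_eq {k : ℕ∞} (hk : 1 ≤ k) {φ φ' : RP1 × RP1 → ℝ → W × W}
    (h : IsLensCobordism k φ) (h' : IsLensCobordism k φ') {δ : ℝ} (hδ : δ ^ 2 = 1)
    (h0 : ∀ z ∈ strip, φ (angles z) 0 = δ • φ' (angles z) 0)
    (h1 : ∀ z ∈ strip, φ (angles z) 1 = δ • φ' (angles z) 1) :
    ∫ q in fundDomain ×ˢ Icc (0 : ℝ) 1, omegaDensity φ q =
      ∫ q in fundDomain ×ˢ Icc (0 : ℝ) 1, omegaDensity φ' q := by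
  obtain ⟨m, hm, hc⟩ := h.exists_core
  obtain ⟨m', hm', hc'⟩ := h'.exists_core
  obtain ⟨i, e⟩ := h.integral_omegaDensity hk
  obtain ⟨i', e'⟩ := h'.integral_omegaDensity hk
  have hcore : ∀ q : Space, q.1 ∈ strip → q.1 ∉ core (min m m') →
      family φ q = δ • family φ' q := fun q hq hqm => by
    have a1 : q.1 ∉ core m := fun h => hqm ((min_le_left m m').trans h)
    have a2 : q.1 ∉ core m' := fun h => hqm ((min_le_right m m').trans h)
    simp only [family, cobordismLift, hc _ (strip_subset hq) a1 _ (smoothTransition_mem _),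
      hc' _ (strip_subset hq) a2 _ (smoothTransition_mem _), h0 _ hq, Prod.smul_fst]
  have htime : ∀ q : Space, q.1 ∈ strip → q.2 ∉ Icc (0 : ℝ) 1 →
      family φ q = δ • family φ' q := fun q hq hqt => by
    rcases lt_or_ge q.2 0 with ht | ht
    · simp only [family, cobordismLift, Real.smoothTransition.zero_of_nonpos ht.le, h0 _ hq,
        Prod.smul_fst]
    · have : 1 ≤ q.2 := by
        by_contra hlt
        exact hqt ⟨ht, (not_le.1 hlt).le⟩
      simp only [family, cobordismLift, Real.smoothTransition.one_of_one_le this, h1 _ hq,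
        Prod.smul_fst]
  have key := (integral_jac_sub_eq_zero (h.isFamily hk) ((h'.isFamily hk).smul hδ)
    (lt_min hm hm') hcore htime).2
  simp only [jac_smul hδ] at key
  rw [integral_sub i i', sub_eq_zero] at key
  rw [e, e', key]

/-! ### Partial derivatives and normal lifts -/

section Partial
variable {E : Type*} [NormedAddCommGroup E] [NormedSpace ℝ E]

/-- The partial derivative along `∂_x = e₂`. -/
def dx (F : ℝ × ℝ → E) (z : ℝ × ℝ) : E := fderiv ℝ F z e₂
/-- The partial derivative along `∂_y = e₁`. -/
def dy (F : ℝ × ℝ → E) (z : ℝ × ℝ) : E := fderiv ℝ F z e₁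

theorem AngPeriodic.dx {F : ℝ × ℝ → E} (hF : AngPeriodic F) : AngPeriodic (dx F) :=
  fun z z' h => by rw [AdS.dx, AdS.dx, hF.fderiv z z' h]
theorem AngPeriodic.dy {F : ℝ × ℝ → E} (hF : AngPeriodic F) : AngPeriodic (dy F) :=
  fun z z' h => by rw [AdS.dy, AdS.dy, hF.fderiv z z' h]

theorem contDiffOn_fderiv_apply {F : ℝ × ℝ → E} {m n : WithTop ℕ∞} (hmn : m + 1 ≤ n)
    (hF : ContDiffOn ℝ n F annulusCover) (e : ℝ × ℝ) :
    ContDiffOn ℝ m (fun z => fderiv ℝ F z e) annulusCover :=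
  (hF.fderiv_of_isOpen isOpen_annulusCover hmn).clm_apply contDiffOn_const

theorem contDiffOn_dx {F : ℝ × ℝ → E} {m n : WithTop ℕ∞} (hmn : m + 1 ≤ n)
    (hF : ContDiffOn ℝ n F annulusCover) : ContDiffOn ℝ m (dx F) annulusCover :=
  contDiffOn_fderiv_apply hmn hF e₂
theorem contDiffOn_dy {F : ℝ × ℝ → E} {m n : WithTop ℕ∞} (hmn : m + 1 ≤ n)
    (hF : ContDiffOn ℝ n F annulusCover) : ContDiffOn ℝ m (dy F) annulusCover :=
  contDiffOn_fderiv_apply hmn hF e₁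

theorem fderiv_congr_cover {F G : ℝ × ℝ → E} (h : EqOn F G annulusCover) {z : ℝ × ℝ}
    (hz : z ∈ annulusCover) : fderiv ℝ F z = fderiv ℝ G z :=
  (h.eventuallyEq_of_mem (annulusCover_mem_nhds hz)).fderiv_eq

theorem differentiableAt_cover {F : ℝ × ℝ → E} {n : WithTop ℕ∞} (hn : 1 ≤ n)
    (hF : ContDiffOn ℝ n F annulusCover) {z : ℝ × ℝ} (hz : z ∈ annulusCover) :
    DifferentiableAt ℝ F z :=
  (hF.contDiffAt (annulusCover_mem_nhds hz)).differentiableAt (by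
    rintro rfl; simp at hn)

theorem dx_dy_comm {F : ℝ × ℝ → E} (hF : ContDiffOn ℝ 2 F annulusCover) {z : ℝ × ℝ}
    (hz : z ∈ annulusCover) : dy (dx F) z = dx (dy F) z := by
  have hs := (hF.contDiffAt (annulusCover_mem_nhds hz)).isSymmSndFDerivAt (by simp)
  have hd : DifferentiableAt ℝ (fderiv ℝ F) z :=
    differentiableAt_cover le_rfl (hF.fderiv_of_isOpen isOpen_annulusCover (m := 1) (by norm_num)) hz
  have e : ∀ a b, fderiv ℝ (fun z => fderiv ℝ F z a) z b = fderiv ℝ (fderiv ℝ F) z b a :=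
    fun a b => by
      rw [fderiv_clm_apply hd (differentiableAt_const a)]
      simp
  change fderiv ℝ (fun z => fderiv ℝ F z e₂) z e₁ = fderiv ℝ (fun z => fderiv ℝ F z e₁) z e₂
  rw [e, e]
  exact hs e₁ e₂

end Partial

theorem fderiv_form {E : Type*} [NormedAddCommGroup E] [NormedSpace ℝ E] {F G : E → W}
    {z : E} (hF : DifferentiableAt ℝ F z) (hG : DifferentiableAt ℝ G z) (h : E) :
    fderiv ℝ (fun z => form (F z) (G z)) z h =
      form (fderiv ℝ F z h) (G z) + form (F z) (fderiv ℝ G z h) := by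
  have hi : ∀ {X : E → W}, DifferentiableAt ℝ X z → ∀ i, HasFDerivAt (fun p => X p i)
      ((ContinuousLinearMap.proj (R := ℝ) (φ := fun _ : Fin 4 => ℝ) i).comp (fderiv ℝ X z)) z :=
    fun hX i => hasFDerivAt_pi'.1 hX.hasFDerivAt i
  have h1 := (((((hi hF 1).mul (hi hG 2)).add ((hi hF 2).mul (hi hG 1))).sub
    ((hi hF 0).mul (hi hG 3))).sub ((hi hF 3).mul (hi hG 0))).fderiv
  have h2 := congrArg (fun L : E →L[ℝ] ℝ => L h) h1
  simp only [form]
  refine Eq.trans h2 ?_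
  simp
  ring

theorem contDiffOn_form {E : Type*} [NormedAddCommGroup E] [NormedSpace ℝ E] {F G : E → W}
    {n : WithTop ℕ∞} {s : Set E} (hF : ContDiffOn ℝ n F s) (hG : ContDiffOn ℝ n G s) :
    ContDiffOn ℝ n (fun z => form (F z) (G z)) s := by
  have hF' := fun i => contDiffOn_pi.1 hF i
  have hG' := fun i => contDiffOn_pi.1 hG i
  simp only [form]
  exact ((((hF' 1).mul (hG' 2)).add ((hF' 2).mul (hG' 1))).sub ((hF' 0).mul (hG' 3))).sub
    ((hF' 3).mul (hG' 0))

/-- Rescaling an isotropic map multiplies its first fundamental form by a square. -/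
theorem form_fderiv_smul {E : Type*} [NormedAddCommGroup E] [NormedSpace ℝ E] {Z Y : E → W}
    {κ : E → ℝ} {z : E} (hZ : DifferentiableAt ℝ Z z) (hκ : DifferentiableAt ℝ κ z)
    (h0 : ∀ᶠ p in 𝓝 z, form (Z p) (Z p) = 0) (hY : ∀ᶠ p in 𝓝 z, Y p = κ p • Z p) (a b : E) :
    form (fderiv ℝ Y z a) (fderiv ℝ Y z b) =
      κ z ^ 2 * form (fderiv ℝ Z z a) (fderiv ℝ Z z b) := by
  have hd : ∀ h, fderiv ℝ Y z h = κ z • fderiv ℝ Z z h + fderiv ℝ κ z h • Z z := fun h => by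
    rw [Filter.EventuallyEq.fderiv_eq hY, fderiv_fun_smul hκ hZ]
    simp
  have e1 := form_fderiv_eq_zero hZ h0 a
  have e2 := form_fderiv_eq_zero hZ h0 b
  have e1' := form_comm _ _ ▸ e1
  simp only [hd, form_add_left, form_add_right, form_smul_left, form_smul_right, e1', e2,
    h0.self_of_nhds]
  ring

/-- A lift `s` of `ψ` to the isotropic cone which induces the flat metric `2 dx dy`. The field
`orient` fixes the sign of the volume of `(s, s_y, s_x, d)` for every `d`; for an admissible
immersion it holds because the leaves of each foliation go to leaves of the same foliation. -/
structure IsNormalLift (ψ : RP1 × RP1 → Projectivization ℝ W) (s : ℝ × ℝ → W) : Prop where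
  smooth : ContDiffOn ℝ ∞ s annulusCover
  per : AngPeriodic s
  lift : ∀ z ∈ annulusCover, ∃ h : s z ≠ 0, ψ (angles z) = Projectivization.mk ℝ (s z) h
  null : ∀ z ∈ annulusCover, form (s z) (s z) = 0
  null_x : ∀ z ∈ annulusCover, form (dx s z) (dx s z) = 0
  null_y : ∀ z ∈ annulusCover, form (dy s z) (dy s z) = 0
  conf : ∀ z ∈ annulusCover, form (dx s z) (dy s z) = 1
  orient : ∀ z ∈ annulusCover, ∀ d, vol (s z) (dy s z) (dx s z) d = -form (s z) d

theorem fderiv_form_eq_zero_of_const {F G : ℝ × ℝ → W} {c : ℝ}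
    (hF : ContDiffOn ℝ ∞ F annulusCover) (hG : ContDiffOn ℝ ∞ G annulusCover)
    (hc : ∀ z ∈ annulusCover, form (F z) (G z) = c) {z : ℝ × ℝ} (hz : z ∈ annulusCover)
    (e : ℝ × ℝ) : form (fderiv ℝ F z e) (G z) + form (F z) (fderiv ℝ G z e) = 0 := by
  rw [← fderiv_form (differentiableAt_cover (by simp) hF hz)
    (differentiableAt_cover (by simp) hG hz), fderiv_congr_cover (G := fun _ => c) hc hz]
  simp

/-- The potential `q` of Hill's equation `s_xx = -q s`. -/
def potX (s : ℝ × ℝ → W) (z : ℝ × ℝ) : ℝ := form (dx (dx s) z) (dx (dy s) z)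
/-- The potential `Q` of Hill's equation `s_yy = -Q s`. -/
def potY (s : ℝ × ℝ → W) (z : ℝ × ℝ) : ℝ := form (dy (dy s) z) (dx (dy s) z)

namespace IsNormalLift
variable {ψ : RP1 × RP1 → Projectivization ℝ W} {s : ℝ × ℝ → W} {z : ℝ × ℝ}

theorem smooth_dx (h : IsNormalLift ψ s) : ContDiffOn ℝ ∞ (dx s) annulusCover :=
  contDiffOn_dx le_rfl h.smooth
theorem smooth_dy (h : IsNormalLift ψ s) : ContDiffOn ℝ ∞ (dy s) annulusCover :=
  contDiffOn_dy le_rfl h.smooth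
theorem smooth_dxdy (h : IsNormalLift ψ s) : ContDiffOn ℝ ∞ (dx (dy s)) annulusCover :=
  contDiffOn_dx le_rfl h.smooth_dy
theorem smooth_dxdx (h : IsNormalLift ψ s) : ContDiffOn ℝ ∞ (dx (dx s)) annulusCover :=
  contDiffOn_dx le_rfl h.smooth_dx
theorem smooth_dydy (h : IsNormalLift ψ s) : ContDiffOn ℝ ∞ (dy (dy s)) annulusCover :=
  contDiffOn_dy le_rfl h.smooth_dy

theorem comm {E : Type*} [NormedAddCommGroup E] [NormedSpace ℝ E] {F : ℝ × ℝ → E}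
    (hF : ContDiffOn ℝ ∞ F annulusCover) (hz : z ∈ annulusCover) : dy (dx F) z = dx (dy F) z :=
  dx_dy_comm (hF.of_le (WithTop.coe_le_coe.2 (le_top : (2 : ℕ∞) ≤ ⊤))) hz

theorem ab (h : IsNormalLift ψ s) (hz : z ∈ annulusCover) : form (s z) (dx s z) = 0 := by
  have := fderiv_form_eq_zero_of_const h.smooth h.smooth h.null hz e₂
  rw [form_comm] at this
  change form (s z) (dx s z) + form (s z) (dx s z) = 0 at this
  linarith

theorem ac (h : IsNormalLift ψ s) (hz : z ∈ annulusCover) : form (s z) (dy s z) = 0 := by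
  have := fderiv_form_eq_zero_of_const h.smooth h.smooth h.null hz e₁
  rw [form_comm] at this
  change form (s z) (dy s z) + form (s z) (dy s z) = 0 at this
  linarith

theorem ad (h : IsNormalLift ψ s) (hz : z ∈ annulusCover) : form (s z) (dx (dy s) z) = -1 := by
  have := fderiv_form_eq_zero_of_const h.smooth h.smooth_dy (fun z hz => h.ac hz) hz e₂
  change form (dx s z) (dy s z) + form (s z) (dx (dy s) z) = 0 at this
  rw [h.conf z hz] at this
  linarith

theorem bd (h : IsNormalLift ψ s) (hz : z ∈ annulusCover) :
    form (dx s z) (dx (dy s) z) = 0 := by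
  have := fderiv_form_eq_zero_of_const h.smooth_dx h.smooth_dx h.null_x hz e₁
  change form (dy (dx s) z) (dx s z) + form (dx s z) (dy (dx s) z) = 0 at this
  rw [comm h.smooth hz, form_comm] at this
  linarith

theorem cd (h : IsNormalLift ψ s) (hz : z ∈ annulusCover) :
    form (dy s z) (dx (dy s) z) = 0 := by
  have := fderiv_form_eq_zero_of_const h.smooth_dy h.smooth_dy h.null_y hz e₂
  change form (dx (dy s) z) (dy s z) + form (dy s z) (dx (dy s) z) = 0 at this
  rw [form_comm] at this
  linarith

theorem vol_eq_one (h : IsNormalLift ψ s) (hz : z ∈ annulusCover) :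
    vol (s z) (dy s z) (dx s z) (dx (dy s) z) = 1 := by
  rw [h.orient z hz, h.ad hz, neg_neg]

theorem smooth_potX (h : IsNormalLift ψ s) : ContDiffOn ℝ ∞ (potX s) annulusCover :=
  contDiffOn_form h.smooth_dxdx h.smooth_dxdy
theorem smooth_potY (h : IsNormalLift ψ s) : ContDiffOn ℝ ∞ (potY s) annulusCover :=
  contDiffOn_form h.smooth_dydy h.smooth_dxdy

theorem dxdx_eq (h : IsNormalLift ψ s) (hz : z ∈ annulusCover) :
    dx (dx s) z = -potX s z • s z := by
  refine eq_neg_form_smul (h.vol_eq_one hz) (h.null z hz) (h.ab hz) (h.ac hz) (h.ad hz) ?_ ?_ ?_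
  · have := fderiv_form_eq_zero_of_const h.smooth_dx h.smooth
      (fun z hz => (form_comm _ _).trans (h.ab hz)) hz e₂
    change form (dx (dx s) z) (s z) + form (dx s z) (dx s z) = 0 at this
    rw [h.null_x z hz] at this
    linarith
  · have := fderiv_form_eq_zero_of_const h.smooth_dx h.smooth_dx h.null_x hz e₂
    change form (dx (dx s) z) (dx s z) + form (dx s z) (dx (dx s) z) = 0 at this
    rw [form_comm (dx s z)] at this
    linarith
  · have := fderiv_form_eq_zero_of_const h.smooth_dx h.smooth_dy h.conf hz e₂
    change form (dx (dx s) z) (dy s z) + form (dx s z) (dx (dy s) z) = 0 at this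
    rw [h.bd hz] at this
    linarith

theorem dydy_eq (h : IsNormalLift ψ s) (hz : z ∈ annulusCover) :
    dy (dy s) z = -potY s z • s z := by
  refine eq_neg_form_smul (h.vol_eq_one hz) (h.null z hz) (h.ab hz) (h.ac hz) (h.ad hz) ?_ ?_ ?_
  · have := fderiv_form_eq_zero_of_const h.smooth_dy h.smooth
      (fun z hz => (form_comm _ _).trans (h.ac hz)) hz e₁
    change form (dy (dy s) z) (s z) + form (dy s z) (dy s z) = 0 at this
    rw [h.null_y z hz] at this
    linarith
  · have := fderiv_form_eq_zero_of_const h.smooth_dy h.smooth_dx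
      (fun z hz => (form_comm _ _).trans (h.conf z hz)) hz e₁
    change form (dy (dy s) z) (dx s z) + form (dy s z) (dy (dx s) z) = 0 at this
    rw [comm h.smooth hz, h.cd hz] at this
    linarith
  · have := fderiv_form_eq_zero_of_const h.smooth_dy h.smooth_dy h.null_y hz e₁
    change form (dy (dy s) z) (dy s z) + form (dy s z) (dy (dy s) z) = 0 at this
    rw [form_comm (dy s z)] at this
    linarith

theorem fderiv_neg_smul {q : ℝ × ℝ → ℝ} {F : ℝ × ℝ → W} (hq : ContDiffOn ℝ ∞ q annulusCover)
    (hF : ContDiffOn ℝ ∞ F annulusCover) (hz : z ∈ annulusCover) (e : ℝ × ℝ) :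
    fderiv ℝ (fun z => -q z • F z) z e =
      -(fderiv ℝ q z e) • F z - q z • fderiv ℝ F z e := by
  have h1 := differentiableAt_cover (by simp) hq hz
  rw [fderiv_fun_smul h1.fun_neg (differentiableAt_cover (by simp) hF hz), fderiv_fun_neg]
  simp
  abel

theorem dxdxdy_eq (h : IsNormalLift ψ s) (hz : z ∈ annulusCover) :
    dx (dx (dy s)) z = -(dy (potX s) z) • s z - potX s z • dy s z := by
  have e1 : dx (dx (dy s)) z = dx (dy (dx s)) z := by
    rw [dx, dx, fderiv_congr_cover (fun z hz => (comm h.smooth hz).symm) hz]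
  rw [e1, ← comm h.smooth_dx hz, dy, fderiv_congr_cover (fun z hz => h.dxdx_eq hz) hz]
  exact fderiv_neg_smul h.smooth_potX h.smooth hz e₁

theorem dydxdy_eq (h : IsNormalLift ψ s) (hz : z ∈ annulusCover) :
    dy (dx (dy s)) z = -(dx (potY s) z) • s z - potY s z • dx s z := by
  rw [comm h.smooth_dy hz, dx, fderiv_congr_cover (fun z hz => h.dydy_eq hz) hz]
  exact fderiv_neg_smul h.smooth_potY h.smooth hz e₂

theorem dd (h : IsNormalLift ψ s) (hz : z ∈ annulusCover) :
    form (dx (dy s) z) (dx (dy s) z) = 0 := by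
  have := fderiv_form_eq_zero_of_const h.smooth_dy h.smooth_dxdy (fun z hz => h.cd hz) hz e₂
  change form (dx (dy s) z) (dx (dy s) z) + form (dy s z) (dx (dx (dy s)) z) = 0 at this
  rw [h.dxdxdy_eq hz, form_sub_right, form_smul_right, form_smul_right, h.null_y z hz,
    form_comm (dy s z), h.ac hz] at this
  linarith

/-- The potential `q` is a function of `x` only. -/
theorem dy_potX (h : IsNormalLift ψ s) (hz : z ∈ annulusCover) : dy (potX s) z = 0 := by
  have := fderiv_form_eq_zero_of_const h.smooth_dxdy h.smooth_dxdy (fun z hz => h.dd hz) hz e₂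
  change form (dx (dx (dy s)) z) (dx (dy s) z) + form (dx (dy s) z) (dx (dx (dy s)) z) = 0 at this
  rw [form_comm (dx (dy s) z), h.dxdxdy_eq hz, form_sub_left, form_smul_left, form_smul_left,
    h.ad hz, h.cd hz] at this
  linarith

/-- The potential `Q` is a function of `y` only. -/
theorem dx_potY (h : IsNormalLift ψ s) (hz : z ∈ annulusCover) : dx (potY s) z = 0 := by
  have := fderiv_form_eq_zero_of_const h.smooth_dxdy h.smooth_dxdy (fun z hz => h.dd hz) hz e₁
  change form (dy (dx (dy s)) z) (dx (dy s) z) + form (dx (dy s) z) (dy (dx (dy s)) z) = 0 at this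
  rw [form_comm (dx (dy s) z), h.dydxdy_eq hz, form_sub_left, form_smul_left, form_smul_left,
    h.ad hz, h.bd hz] at this
  linarith

/-- The moving frame of a normal lift. -/
theorem isFrame (h : IsNormalLift ψ s) (hz : z ∈ annulusCover) :
    IsFrame (s z) (dx s z) (dy s z) (dx (dy s) z) :=
  ⟨h.null z hz, h.ab hz, h.ac hz, h.ad hz, h.null_x z hz, h.conf z hz, h.bd hz, h.null_y z hz,
    h.cd hz, h.dd hz, h.vol_eq_one hz⟩

theorem potX_per (h : IsNormalLift ψ s) : AngPeriodic (potX s) := fun z z' hz => by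
  rw [potX, potX, h.per.dx.dx z z' hz, h.per.dy.dx z z' hz]
theorem potY_per (h : IsNormalLift ψ s) : AngPeriodic (potY s) := fun z z' hz => by
  rw [potY, potY, h.per.dy.dy z z' hz, h.per.dy.dx z z' hz]

end IsNormalLift

/-! ### Existence of the normal lift -/

/-- The Euclidean norm of `W`. -/
def eucl (w : W) : ℝ := Real.sqrt (∑ i, w i ^ 2)

theorem eucl_arg_pos {w : W} (hw : w ≠ 0) : 0 < ∑ i, w i ^ 2 := by
  obtain ⟨i, hi⟩ := Function.ne_iff.1 hw
  exact Finset.sum_pos' (fun j _ => sq_nonneg _) ⟨i, Finset.mem_univ _, sq_pos_of_ne_zero hi⟩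

theorem eucl_pos {w : W} (hw : w ≠ 0) : 0 < eucl w := Real.sqrt_pos.2 (eucl_arg_pos hw)

theorem eucl_smul (c : ℝ) (w : W) : eucl (c • w) = |c| * eucl w := by
  rw [eucl, eucl, ← Real.sqrt_sq_eq_abs, ← Real.sqrt_mul (sq_nonneg c), Finset.mul_sum]
  congr 1
  refine Finset.sum_congr rfl fun i _ => ?_
  simp [mul_pow]

theorem contDiffAt_eucl {w : W} (hw : w ≠ 0) : ContDiffAt ℝ ∞ eucl w := by
  refine ContDiffAt.sqrt ?_ (eucl_arg_pos hw).ne'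
  exact (ContDiff.sum fun i _ => (contDiff_apply ℝ ℝ i).pow 2).contDiffAt

/-- Two nowhere vanishing lifts of the same map, one continuous and one smooth, have the same
Euclidean normalisation up to a locally constant sign. -/
theorem exists_normalize_eq_smul {S s' : ℝ × ℝ → W} {z : ℝ × ℝ} (hS : ContinuousAt S z)
    (hs' : ContinuousAt s' z)
    (hprop : ∀ᶠ p in 𝓝 z, S p ≠ 0 ∧ s' p ≠ 0 ∧ ∃ c : ℝ, S p = c • s' p) :
    ∃ ε : ℝ, ε ≠ 0 ∧ ∀ᶠ p in 𝓝 z, (eucl (S p))⁻¹ • S p = (ε * (eucl (s' p))⁻¹) • s' p := by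
  set D : ℝ × ℝ → ℝ := fun p => (∑ i, S p i * s' p i) / (eucl (S p) * eucl (s' p)) with hD
  have key : ∀ᶠ p in 𝓝 z, (D p = 1 ∨ D p = -1) ∧
      (eucl (S p))⁻¹ • S p = (D p * (eucl (s' p))⁻¹) • s' p := by
    filter_upwards [hprop] with p hp
    obtain ⟨h1, h2, c, hc⟩ := hp
    have hc0 : c ≠ 0 := by rintro rfl; exact h1 (by rw [hc, zero_smul])
    have he := eucl_pos h2
    have hsq : ∑ i, s' p i ^ 2 = eucl (s' p) ^ 2 :=
      (Real.sq_sqrt (eucl_arg_pos h2).le).symm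
    have hDp : D p = c / |c| := by
      have : ∑ i, S p i * s' p i = c * eucl (s' p) ^ 2 := by
        rw [← hsq, Finset.mul_sum]
        refine Finset.sum_congr rfl fun i _ => ?_
        rw [hc]; simp; ring
      have ha : |c| ≠ 0 := abs_ne_zero.2 hc0
      simp only [hD]
      rw [this, hc, eucl_smul]
      field_simp
    refine ⟨?_, ?_⟩
    · rw [hDp]
      rcases lt_or_gt_of_ne hc0 with h | h
      · right; rw [abs_of_neg h, div_neg, div_self hc0]
      · left; rw [abs_of_pos h, div_self hc0]
    · rw [hDp, hc, eucl_smul, smul_smul]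
      congr 1
      rw [mul_inv]; ring
  have hcont : ContinuousAt D z := by
    have hz := hprop.self_of_nhds
    have hSi := fun i => continuousAt_pi.1 hS i
    have hsi := fun i => continuousAt_pi.1 hs' i
    refine ContinuousAt.div ?_ ?_ (mul_pos (eucl_pos hz.1) (eucl_pos hz.2.1)).ne'
    · exact tendsto_finsetSum _ fun i _ => (hSi i).mul (hsi i)
    · exact ((contDiffAt_eucl hz.1).continuousAt.comp hS).mul
        ((contDiffAt_eucl hz.2.1).continuousAt.comp hs')
  refine ⟨D z, ?_, ?_⟩
  · rcases key.self_of_nhds.1 with h | h <;> rw [h] <;> norm_num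
  · have hnear : ∀ᶠ p in 𝓝 z, |D p - D z| < 1 := by
      have := Metric.continuousAt_iff'.1 hcont 1 one_pos
      simpa [Real.dist_eq] using this
    filter_upwards [key, hnear] with p hp hp'
    have hz := key.self_of_nhds.1
    have : D p = D z := by
      rcases hp.1 with h | h <;> rcases hz with h' | h' <;> rw [h, h'] at hp' ⊢ <;>
        norm_num at hp'
    rw [hp.2, this]

theorem exists_smul_of_mk_eq {w w' : W} {hw : w ≠ 0} {hw' : w' ≠ 0}
    (h : Projectivization.mk ℝ w hw = Projectivization.mk ℝ w' hw') : ∃ c : ℝ, w = c • w' := by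
  rw [Projectivization.mk_eq_mk_iff'] at h
  obtain ⟨c, hc⟩ := h
  exact ⟨c, hc.symm⟩

theorem form_eq_zero_of_mem_ein {ℓ : Projectivization ℝ W} (hℓ : ℓ ∈ Ein) {w : W} (hw : w ≠ 0)
    (h : ℓ = Projectivization.mk ℝ w hw) : form w w = 0 := by
  refine hℓ w ?_
  rw [h, Projectivization.submodule_mk]
  exact Submodule.mem_span_singleton_self w

/-- The pull-back of the tautological bundle has a smooth nowhere vanishing section which
induces a nondegenerate first fundamental form. It is the Euclidean normalisation of a continuous
section, which is smooth because it agrees locally with that of a smooth lift up to a sign. -/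
theorem exists_smooth_section {ψ : RP1 × RP1 → Projectivization ℝ W} (hψ : IsSplitImmersion ψ)
    (hτ : TautologicalTrivial ψ) : ∃ u : ℝ × ℝ → W, ContDiffOn ℝ ∞ u annulusCover ∧
      AngPeriodic u ∧
      (∀ z ∈ annulusCover, ∃ h : u z ≠ 0, ψ (angles z) = Projectivization.mk ℝ (u z) h) ∧
      ∀ z ∈ annulusCover, 0 < form (dx u z) (dy u z) := by
  obtain ⟨s₀, hc, hs₀⟩ := hτ
  set S : ℝ × ℝ → W := s₀ ∘ angles with hS
  have hSlift : ∀ z ∈ annulusCover, ∃ h : S z ≠ 0, ψ (angles z) = Projectivization.mk ℝ (S z) h :=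
    fun z hz => hs₀ _ hz
  set u : ℝ × ℝ → W := fun z => (eucl (S z))⁻¹ • S z with hu
  have hulift : ∀ z ∈ annulusCover, ∃ h : u z ≠ 0, ψ (angles z) = Projectivization.mk ℝ (u z) h := by
    intro z hz
    obtain ⟨h, e⟩ := hSlift z hz
    have hne := inv_ne_zero (eucl_pos h).ne'
    refine ⟨smul_ne_zero hne h, ?_⟩
    rw [e, Projectivization.mk_eq_mk_iff']
    exact ⟨eucl (S z), by rw [hu, smul_smul, mul_inv_cancel₀ (eucl_pos h).ne', one_smul]⟩
  have hloc : ∀ z ∈ annulusCover, ContDiffAt ℝ ∞ u z ∧ 0 < form (dx u z) (dy u z) := by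
    intro z hz
    obtain ⟨s', hs', -, hpos⟩ := hψ.immersion z hz
    have hsm : ContDiffAt ℝ ∞ s' z := hs'.self_of_nhds.1
    have hn := annulusCover_mem_nhds hz
    obtain ⟨ε, hε, hev⟩ := exists_normalize_eq_smul (hc.continuousAt hn) hsm.continuousAt (by
      filter_upwards [hs', hn] with p hp hp'
      obtain ⟨-, h1, e1⟩ := hp
      obtain ⟨h2, e2⟩ := hSlift p hp'
      exact ⟨h2, h1, exists_smul_of_mk_eq (e2.symm.trans e1)⟩)
    have hne : s' z ≠ 0 := hs'.self_of_nhds.2.1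
    have hκ : ContDiffAt ℝ ∞ (fun p => ε * (eucl (s' p))⁻¹) z :=
      contDiffAt_const.mul (((contDiffAt_eucl hne).comp z hsm).inv (eucl_pos hne).ne')
    have hnull : ∀ᶠ p in 𝓝 z, form (s' p) (s' p) = 0 := by
      filter_upwards [hs', hn] with p hp hp'
      obtain ⟨-, h1, e1⟩ := hp
      exact form_eq_zero_of_mem_ein (hψ.mem_ein _ hp') h1 e1
    refine ⟨(hκ.smul hsm).congr_of_eventuallyEq hev, ?_⟩
    rw [dx, dy, form_fderiv_smul (hsm.differentiableAt (by simp)) (hκ.differentiableAt (by simp))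
      hnull hev, form_comm]
    have := inv_ne_zero (eucl_pos hne).ne'
    positivity
  refine ⟨u, fun z hz => (hloc z hz).1.contDiffWithinAt, fun z z' h => ?_, hulift,
    fun z hz => (hloc z hz).2⟩
  simp only [hu, hS, Function.comp_apply, h]

theorem exists_smul_of_leaf {ψ : RP1 × RP1 → Projectivization ℝ W} {p : RP1 × RP1} {w : W}
    {hw : w ≠ 0} (h : ψ p = Projectivization.mk ℝ w hw) {a b : RP1} (h' : ψ p = segre a b) :
    ∃ c : ℝ, w = c • tensor a.rep b.rep := exists_smul_of_mk_eq (h.symm.trans h')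

/-- A linear relation between two components of a map which holds along a line also holds for
the derivative. -/
theorem fderiv_relation {s : ℝ × ℝ → W} {z e : ℝ × ℝ} (hs : DifferentiableAt ℝ s z) {i j : Fin 4}
    {a b : ℝ} (h : ∀ᶠ τ in 𝓝 (0 : ℝ), s (z + τ • e) i * a = s (z + τ • e) j * b) :
    fderiv ℝ s z e i * a = fderiv ℝ s z e j * b := by
  have h1 := fun i => hasDerivAt_pi.1 (hs.hasFDerivAt.hasLineDerivAt e) i
  exact (((h1 i).mul_const a).congr_of_eventuallyEq (h.mono fun _ h => h.symm)).unique
    ((h1 j).mul_const b)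

/-- Along an admissible immersion, the tangent vectors of the leaves are decomposable. -/
theorem exists_tensor_of_leaves {ψ : RP1 × RP1 → Projectivization ℝ W} (hψ : IsSplitImmersion ψ)
    {u : ℝ × ℝ → W} (hu : ContDiffOn ℝ ∞ u annulusCover)
    (hl : ∀ z ∈ annulusCover, ∃ h : u z ≠ 0, ψ (angles z) = Projectivization.mk ℝ (u z) h)
    {z : ℝ × ℝ} (hz : z ∈ annulusCover) :
    ∃ A B p r : V, u z = tensor A B ∧ dy u z = tensor A r ∧ dx u z = tensor p B := by
  have hd : DifferentiableAt ℝ u z := differentiableAt_cover (by simp) hu hz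
  have hline : ∀ e : ℝ × ℝ, ∀ᶠ τ in 𝓝 (0 : ℝ), z + τ • e ∈ annulusCover := fun e => by
    have : ContinuousAt (fun τ : ℝ => z + τ • e) 0 := by fun_prop
    exact this (by simpa using annulusCover_mem_nhds hz)
  obtain ⟨a', ha'⟩ := hψ.leaf₁ (angle z.1)
  obtain ⟨b', hb'⟩ := hψ.leaf₂ (angle z.2)
  have hy : ∀ y, (z.1, y) ∈ annulusCover → ∃ B, u (z.1, y) = tensor a'.rep B := fun y hy => by
    obtain ⟨b, hb⟩ := ha' (angle y) hy
    obtain ⟨h, e⟩ := hl _ hy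
    obtain ⟨c, hc⟩ := exists_smul_of_leaf e hb
    exact ⟨c • b.rep, by rw [hc]; ext i; fin_cases i <;> simp [tensor] <;> ring⟩
  have hx : ∀ x, (x, z.2) ∈ annulusCover → ∃ A, u (x, z.2) = tensor A b'.rep := fun x hx => by
    obtain ⟨a, ha⟩ := hb' (angle x) hx
    obtain ⟨h, e⟩ := hl _ hx
    obtain ⟨c, hc⟩ := exists_smul_of_leaf e ha
    exact ⟨c • a.rep, by rw [hc]; ext i; fin_cases i <;> simp [tensor] <;> ring⟩
  have ey : ∀ τ : ℝ, z + τ • e₁ = (z.1, z.2 + τ) := fun τ => by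
    simp [e₁, Prod.ext_iff]
  have ex : ∀ τ : ℝ, z + τ • e₂ = (z.1 + τ, z.2) := fun τ => by
    simp [e₂, Prod.ext_iff]
  obtain ⟨r, hr⟩ : ∃ r, dy u z = tensor a'.rep r := by
    refine exists_eq_tensor_right a'.rep_nonzero ?_ ?_ <;>
    · refine fderiv_relation hd ?_
      filter_upwards [hline e₁] with τ hτ
      rw [ey] at hτ ⊢
      obtain ⟨B, hB⟩ := hy _ hτ
      rw [hB]; simp [tensor]; ring
  obtain ⟨p, hp⟩ : ∃ p, dx u z = tensor p b'.rep := by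
    refine exists_eq_tensor_left b'.rep_nonzero ?_ ?_ <;>
    · refine fderiv_relation hd ?_
      filter_upwards [hline e₂] with τ hτ
      rw [ex] at hτ ⊢
      obtain ⟨A, hA⟩ := hx _ hτ
      rw [hA]; simp [tensor]; ring
  obtain ⟨B, hB⟩ := hy z.2 hz
  obtain ⟨A, hA⟩ := hx z.1 hz
  -- the two factorisations of `u z` agree up to a scalar `c`
  obtain ⟨j, hj⟩ := Function.ne_iff.1 b'.rep_nonzero
  have hAB : tensor A b'.rep = tensor a'.rep B := hA.symm.trans hB
  have hcomp : ∀ i, A i * b'.rep j = a'.rep i * B j := fun i => by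
    have t0 := congrFun hAB 0
    have t1 := congrFun hAB 1
    have t2 := congrFun hAB 2
    have t3 := congrFun hAB 3
    simp [tensor] at t0 t1 t2 t3
    fin_cases i <;> fin_cases j <;> simp [t0, t1, t2, t3]
  set c := B j / b'.rep j with hcdef
  have hj' : b'.rep j ≠ 0 := hj
  have hAc : A = c • a'.rep := by
    ext i
    rw [Pi.smul_apply, smul_eq_mul, hcdef, div_mul_eq_mul_div, eq_div_iff hj', hcomp]
    ring
  have hc : c ≠ 0 := by
    intro h0
    obtain ⟨hne, -⟩ := hl z hz
    apply hne
    have : u z = tensor A b'.rep := hA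
    rw [this, hAc, h0]
    ext i; fin_cases i <;> simp [tensor]
  refine ⟨a'.rep, c • b'.rep, c⁻¹ • p, r, ?_, hr, ?_⟩
  · have : u z = tensor A b'.rep := hA
    rw [this, hAc]
    ext i; fin_cases i <;> simp [tensor] <;> ring
  · rw [hp]
    ext i; fin_cases i <;> simp [tensor] <;> field_simp

/-- The rescaling of a smooth section by `⟨u_x, u_y⟩^{-1/2}` is a normal lift. -/
theorem exists_normalLift {ψ : RP1 × RP1 → Projectivization ℝ W} (hψ : IsSplitImmersion ψ)
    (hτ : TautologicalTrivial ψ) : ∃ s, IsNormalLift ψ s := by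
  obtain ⟨u, hu, hper, hl, hpos⟩ := exists_smooth_section hψ hτ
  set κ : ℝ × ℝ → ℝ := fun z => (Real.sqrt (form (dx u z) (dy u z)))⁻¹ with hκ
  have hκs : ContDiffOn ℝ ∞ κ annulusCover :=
    ((contDiffOn_form (contDiffOn_dx le_rfl hu) (contDiffOn_dy le_rfl hu)).sqrt
      fun z hz => (hpos z hz).ne').inv fun z hz => (Real.sqrt_pos.2 (hpos z hz)).ne'
  have hκ0 : ∀ z ∈ annulusCover, κ z ≠ 0 := fun z hz =>
    inv_ne_zero (Real.sqrt_pos.2 (hpos z hz)).ne'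
  set s : ℝ × ℝ → W := fun z => κ z • u z with hs
  have hss : ContDiffOn ℝ ∞ s annulusCover := hκs.smul hu
  have hsl : ∀ z ∈ annulusCover, ∃ h : s z ≠ 0, ψ (angles z) = Projectivization.mk ℝ (s z) h := by
    intro z hz
    obtain ⟨h, e⟩ := hl z hz
    refine ⟨smul_ne_zero (hκ0 z hz) h, ?_⟩
    rw [e, Projectivization.mk_eq_mk_iff']
    exact ⟨(κ z)⁻¹, by rw [hs, smul_smul, inv_mul_cancel₀ (hκ0 z hz), one_smul]⟩
  have hnullu : ∀ z ∈ annulusCover, form (u z) (u z) = 0 := fun z hz => by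
    obtain ⟨h, e⟩ := hl z hz
    exact form_eq_zero_of_mem_ein (hψ.mem_ein _ hz) h e
  have hconf : ∀ z ∈ annulusCover, form (dx s z) (dy s z) = 1 := fun z hz => by
    rw [dx, dy, form_fderiv_smul (differentiableAt_cover (by simp) hu hz)
      (differentiableAt_cover (by simp) hκs hz)
      (Filter.mem_of_superset (annulusCover_mem_nhds hz) hnullu) (Eventually.of_forall fun _ => rfl)]
    change κ z ^ 2 * form (dx u z) (dy u z) = 1
    rw [hκ, inv_pow, Real.sq_sqrt (hpos z hz).le, inv_mul_cancel₀ (hpos z hz).ne']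
  refine ⟨s, hss, fun z z' h => ?_, hsl, fun z hz => ?_, fun z hz => ?_, fun z hz => ?_, hconf,
    fun z hz d => ?_⟩
  · simp only [hs, hκ, hper z z' h, hper.dx z z' h, hper.dy z z' h]
  · rw [hs, form_smul_left, form_smul_right, hnullu z hz, mul_zero, mul_zero]
  · obtain ⟨A, B, p, r, -, -, h⟩ := exists_tensor_of_leaves hψ hss hsl hz
    rw [h, form_tensor]; simp [areaV]; ring_nf; simp
  · obtain ⟨A, B, p, r, -, h, -⟩ := exists_tensor_of_leaves hψ hss hsl hz
    rw [h, form_tensor]; simp [areaV]; ring_nf; simp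
  · obtain ⟨A, B, p, r, h1, h2, h3⟩ := exists_tensor_of_leaves hψ hss hsl hz
    have h4 := hconf z hz
    rw [h1, h2, h3] at *
    rw [vol_tensor, h4, one_mul]

/-! ### Explicit Epstein surfaces -/

/-- The function `ρ` with `g = e^{2ρ} · 2 dx dy`. -/
def logFactor (g : BilinField) (z : ℝ × ℝ) : ℝ := Real.log (g (angles z) e₁ e₂) / 2

theorem logFactor_per (g : BilinField) : AngPeriodic (logFactor g) := fun _ _ h => by
  rw [logFactor, logFactor, h]

theorem IsCompatibleMetric.exp_logFactor_sq {n : ℕ∞} {g : BilinField} (hg : IsCompatibleMetric n g)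
    {z : ℝ × ℝ} (hz : z ∈ annulusCover) : Real.exp (logFactor g z) ^ 2 = g (angles z) e₁ e₂ := by
  rw [logFactor, ← Real.exp_nat_mul, Nat.cast_ofNat, mul_div_cancel₀ _ two_ne_zero,
    Real.exp_log (hg.pos _ hz)]

theorem IsCompatibleMetric.smooth_logFactor {n : ℕ∞} {g : BilinField}
    (hg : IsCompatibleMetric n g) : ContDiffOn ℝ n (logFactor g) annulusCover :=
  (((hg.smooth.clm_apply contDiffOn_const).clm_apply contDiffOn_const).log
    fun _ hz => (hg.pos _ hz).ne').div_const 2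

theorem IsCompatibleMetric.apply_eq {n : ℕ∞} {g : BilinField} (hg : IsCompatibleMetric n g)
    {p : RP1 × RP1} (hp : p ∈ annulus) (u v : ℝ × ℝ) :
    g p u v = (u.2 * v.1 + u.1 * v.2) * g p e₁ e₂ := by
  have e : ∀ u : ℝ × ℝ, u = u.2 • e₁ + u.1 • e₂ := fun u => by
    simp [e₁, e₂]
  have h21 : g p e₂ e₁ = g p e₁ e₂ := hg.symm p hp _ _
  conv_lhs => rw [e u, e v]
  simp only [map_add, map_smul, add_apply, smul_apply, smul_eq_mul, hg.isotropic₁ p hp,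
    hg.isotropic₂ p hp, h21]
  ring

/-- The position and the unit normal of the Epstein surface through a point, in terms of the
logarithm `r` of the conformal factor, its derivatives `α`, `β`, and the `2`-jet of the normal
lift. -/
def epsteinPair (r α β : ℝ) (a b c d : W) : W × W :=
  ((Real.sqrt 2 / 2) • (Real.exp r • a - -(Real.exp (-r) • (d + α • c + β • b + (α * β) • a))),
   (Real.sqrt 2 / 2) • (Real.exp r • a + -(Real.exp (-r) • (d + α • c + β • b + (α * β) • a))))

/-- The isotropic surface whose metric is `e^{2ρ}` times the flat metric. -/
def isoSurf (ρ : ℝ × ℝ → ℝ) (s : ℝ × ℝ → W) (z : ℝ × ℝ) : W := Real.exp (ρ z) • s z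

/-- The dual of `isoSurf`. -/
def dualSurf (ρ : ℝ × ℝ → ℝ) (s : ℝ × ℝ → W) (z : ℝ × ℝ) : W :=
  -(Real.exp (-ρ z) • (dx (dy s) z + dx ρ z • dy s z + dy ρ z • dx s z +
    (dx ρ z * dy ρ z) • s z))

/-- The cobordism which interpolates linearly between the logarithms of two conformal factors. -/
def epsteinCob (ρ₀ ρ₁ : ℝ × ℝ → ℝ) (s : ℝ × ℝ → W) (q : Space) : W × W :=
  epsteinPair (ρ₀ q.1 + q.2 * (ρ₁ q.1 - ρ₀ q.1)) (dx ρ₀ q.1 + q.2 * (dx ρ₁ q.1 - dx ρ₀ q.1))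
    (dy ρ₀ q.1 + q.2 * (dy ρ₁ q.1 - dy ρ₀ q.1)) (s q.1) (dx s q.1) (dy s q.1) (dx (dy s) q.1)

theorem epsteinCob_zero (ρ₀ ρ₁ : ℝ × ℝ → ℝ) (s : ℝ × ℝ → W) (z : ℝ × ℝ) :
    epsteinCob ρ₀ ρ₁ s (z, 0) = ((Real.sqrt 2 / 2) • (isoSurf ρ₀ s z - dualSurf ρ₀ s z),
      (Real.sqrt 2 / 2) • (isoSurf ρ₀ s z + dualSurf ρ₀ s z)) := by
  simp [epsteinCob, epsteinPair, isoSurf, dualSurf]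

theorem epsteinCob_one (ρ₀ ρ₁ : ℝ × ℝ → ℝ) (s : ℝ × ℝ → W) (z : ℝ × ℝ) :
    epsteinCob ρ₀ ρ₁ s (z, 1) = ((Real.sqrt 2 / 2) • (isoSurf ρ₁ s z - dualSurf ρ₁ s z),
      (Real.sqrt 2 / 2) • (isoSurf ρ₁ s z + dualSurf ρ₁ s z)) := by
  simp [epsteinCob, epsteinPair, isoSurf, dualSurf]

theorem dA_coords {E : Type*} [NormedAddCommGroup E] [NormedSpace ℝ E] {F : ℝ × ℝ → E}
    (hF : AngPeriodic F) : dA (fun p => F (coords p)) = fderiv ℝ F := by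
  ext1 z
  rw [dA, hF.comp_coords_comp]

theorem fderiv_isoSurf {ρ : ℝ × ℝ → ℝ} {s : ℝ × ℝ → W} {z : ℝ × ℝ}
    (hρ : DifferentiableAt ℝ ρ z) (hs : DifferentiableAt ℝ s z) (u : ℝ × ℝ) :
    fderiv ℝ (isoSurf ρ s) z u = Real.exp (ρ z) • (fderiv ℝ s z u + fderiv ℝ ρ z u • s z) := by
  have h : fderiv ℝ (isoSurf ρ s) z = _ := fderiv_fun_smul hρ.exp hs
  rw [h, fderiv_exp hρ]
  simp [smul_smul]

theorem fderiv_eq_dx_dy {E : Type*} [NormedAddCommGroup E] [NormedSpace ℝ E] (F : ℝ × ℝ → E)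
    (z u : ℝ × ℝ) : fderiv ℝ F z u = u.2 • dy F z + u.1 • dx F z := by
  rw [dx, dy, ← map_smul, ← map_smul, ← map_add]
  congr 1
  simp [e₁, e₂]

theorem linearIndependent_of_null {a u v : W} (ha : a ≠ 0) (hau : form a u = 0)
    (hav : form a v = 0) (hu : form u u = 0) (hv : form v v = 0) (huv : form u v ≠ 0) :
    LinearIndependent ℝ ![a, u, v] := by
  rw [Fintype.linearIndependent_iff]
  intro c hc
  simp only [Fin.sum_univ_three, Matrix.cons_val] at hc
  have h1 := congrArg (fun x => form x v) hc
  have h2 := congrArg (fun x => form x u) hc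
  simp only [form_add_left, form_smul_left, form_zero_left, hau, hav, hu, hv,
    form_comm v u] at h1 h2
  have c1 : c 1 = 0 := by simpa [huv] using h1
  have c2 : c 2 = 0 := by simpa [huv] using h2
  have c0 : c 0 = 0 := by simpa [c1, c2, ha] using hc
  intro i
  fin_cases i <;> assumption

section Surfaces
variable {ψ : RP1 × RP1 → Projectivization ℝ W} {s : ℝ × ℝ → W} {ρ : ℝ × ℝ → ℝ} {z : ℝ × ℝ}

theorem isoSurf_per (h : IsNormalLift ψ s) (hρ : AngPeriodic ρ) : AngPeriodic (isoSurf ρ s) :=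
  fun z z' e => by rw [isoSurf, isoSurf, hρ z z' e, h.per z z' e]

theorem dualSurf_per (h : IsNormalLift ψ s) (hρ : AngPeriodic ρ) : AngPeriodic (dualSurf ρ s) :=
  fun z z' e => by
    rw [dualSurf, dualSurf, hρ z z' e, h.per z z' e, hρ.dx z z' e, hρ.dy z z' e,
      h.per.dx z z' e, h.per.dy z z' e, h.per.dy.dx z z' e]

theorem form_dualSurf (h : IsNormalLift ψ s) (hz : z ∈ annulusCover) :
    form (dualSurf ρ s z) (dualSurf ρ s z) = 0 ∧ form (dualSurf ρ s z) (isoSurf ρ s z) = 1 ∧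
    form (dualSurf ρ s z) (dx s z + dx ρ z • s z) = 0 ∧
    form (dualSurf ρ s z) (dy s z + dy ρ z • s z) = 0 := by
  obtain ⟨aa, ab, ac, ad, bb, bc, bd, cc, cd, dd, hv⟩ := (h.isFrame hz).shear (dx ρ z) (dy ρ z)
  have e : Real.exp (-ρ z) * Real.exp (ρ z) = 1 := by rw [← Real.exp_add]; simp
  refine ⟨?_, ?_, ?_, ?_⟩ <;> rw [dualSurf]
  · rw [form_neg_left, form_neg_right, form_smul_left, form_smul_right, dd]; ring
  · rw [isoSurf, form_neg_left, form_smul_left, form_smul_right, form_comm, ad]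
    linear_combination e
  · rw [form_neg_left, form_smul_left, form_comm, bd]; ring
  · rw [form_neg_left, form_smul_left, form_comm, cd]; ring

theorem isIsotropicSurface {n : ℕ∞} (hn : 1 ≤ n) {g : BilinField} (hg : IsCompatibleMetric n g)
    (h : IsNormalLift ψ s) :
    IsIsotropicSurface n ψ g fun p => isoSurf (logFactor g) s (coords p) := by
  have hper := isoSurf_per h (logFactor_per g)
  have hn' : (1 : WithTop ℕ∞) ≤ n := by exact_mod_cast hn
  have hρ := hg.smooth_logFactor
  have hdρ : ∀ z ∈ annulusCover, DifferentiableAt ℝ (logFactor g) z := fun z hz =>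
    differentiableAt_cover hn' hρ hz
  have hds : ∀ z ∈ annulusCover, DifferentiableAt ℝ s z := fun z hz =>
    differentiableAt_cover (by simp) h.smooth hz
  have hmet : ∀ z ∈ annulusCover, ∀ u v, form (fderiv ℝ (isoSurf (logFactor g) s) z u)
      (fderiv ℝ (isoSurf (logFactor g) s) z v) = g (angles z) u v := by
    intro z hz u v
    rw [form_fderiv_smul (Z := s) (Y := isoSurf (logFactor g) s)
      (κ := fun z => Real.exp (logFactor g z)) (hds z hz) (hdρ z hz).exp
      (Filter.mem_of_superset (annulusCover_mem_nhds hz) h.null)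
      (Eventually.of_forall fun _ => rfl), hg.exp_logFactor_sq hz, hg.apply_eq hz u v,
      fderiv_eq_dx_dy s z u, fderiv_eq_dx_dy s z v]
    simp only [form_add_left, form_add_right, form_smul_left, form_smul_right, h.null_x z hz,
      h.null_y z hz, h.conf z hz, form_comm (dy s z) (dx s z)]
    ring
  have hisoE : ∀ z, isoSurf (logFactor g) s (coords (angles z)) = isoSurf (logFactor g) s z :=
    hper.coords_angles
  refine ⟨?_, fun p hp => ?_, fun p hp => ?_, fun z hz => ?_, fun z hz u v => ?_⟩
  · rw [SmoothOnAnnulus, hper.comp_coords_comp]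
    exact hρ.exp.smul (h.smooth.of_le (by exact_mod_cast le_top))
  · obtain ⟨h1, e⟩ := h.lift _ (coords_mem hp)
    rw [angles_coords] at e
    have hne : isoSurf (logFactor g) s (coords p) ≠ 0 := smul_ne_zero (Real.exp_pos _).ne' h1
    refine ⟨hne, e.trans ((Projectivization.mk_eq_mk_iff' ℝ _ _ h1 hne).2 ?_)⟩
    exact ⟨(Real.exp (logFactor g (coords p)))⁻¹, by
      rw [isoSurf, smul_smul, inv_mul_cancel₀ (Real.exp_pos _).ne', one_smul]⟩
  · rw [isoSurf, form_smul_left, form_smul_right, h.null _ (coords_mem hp)]; ring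
  · rw [dA_coords hper, hisoE]
    have h12 : form (fderiv ℝ (isoSurf (logFactor g) s) z e₁)
      (fderiv ℝ (isoSurf (logFactor g) s) z e₂) ≠ 0 := by
      rw [hmet z hz]; exact (hg.pos _ hz).ne'
    have h11 := (hmet z hz e₁ e₁).trans (hg.isotropic₁ _ hz)
    have h22 := (hmet z hz e₂ e₂).trans (hg.isotropic₂ _ hz)
    have hnull : ∀ᶠ p in 𝓝 z, form (isoSurf (logFactor g) s p) (isoSurf (logFactor g) s p) = 0 := by
      filter_upwards [annulusCover_mem_nhds hz] with p hp
      rw [isoSurf, form_smul_left, form_smul_right, h.null p hp]; ring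
    have hd : DifferentiableAt ℝ (isoSurf (logFactor g) s) z :=
      ((hdρ z hz).exp).fun_smul (hds z hz)
    have h01 := form_fderiv_eq_zero hd hnull e₁
    have h02 := form_fderiv_eq_zero hd hnull e₂
    have hne : isoSurf (logFactor g) s z ≠ 0 :=
      smul_ne_zero (Real.exp_pos _).ne' (h.lift z hz).1
    exact linearIndependent_of_null hne h01 h02 h11 h22 h12
  · rw [dA_coords hper, hmet z hz]

theorem isDualSurface {n : ℕ∞} (hn : 1 ≤ n) {g : BilinField} (hg : IsCompatibleMetric n g)
    (h : IsNormalLift ψ s) :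
    IsDualSurface (fun p => isoSurf (logFactor g) s (coords p))
      (fun p => dualSurf (logFactor g) s (coords p)) := by
  have hper := isoSurf_per h (logFactor_per g)
  refine ⟨fun p hp => (form_dualSurf h (coords_mem hp)).2.1,
    fun p hp => (form_dualSurf h (coords_mem hp)).1, fun z hz u => ?_⟩
  have hn' : (1 : WithTop ℕ∞) ≤ n := by exact_mod_cast hn
  obtain ⟨-, -, h1, h2⟩ := form_dualSurf (ρ := logFactor g) h hz
  rw [dA_coords hper, (dualSurf_per h (logFactor_per g)).coords_angles,
    fderiv_isoSurf (differentiableAt_cover hn' hg.smooth_logFactor hz)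
      (differentiableAt_cover (by simp) h.smooth hz), fderiv_eq_dx_dy s, fderiv_eq_dx_dy (logFactor g)]
  have e : u.2 • dy s z + u.1 • dx s z +
      (u.2 • dy (logFactor g) z + u.1 • dx (logFactor g) z) • s z =
      u.2 • (dy s z + dy (logFactor g) z • s z) + u.1 • (dx s z + dx (logFactor g) z • s z) := by
    simp only [smul_eq_mul]; module
  rw [e, form_smul_right, form_add_right, form_smul_right, form_smul_right, h1, h2]
  ring

end Surfaces

/-! ### Existence of Epstein cobordisms -/

theorem sqrt_two_half_sq : Real.sqrt 2 / 2 * (Real.sqrt 2 / 2) = 1 / 2 := by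
  have := Real.mul_self_sqrt (show (0 : ℝ) ≤ 2 by norm_num)
  linear_combination this / 4

/-- The Epstein surface of an isotropic surface with a dual of class `C^k` is holonomic. -/
theorem IsIsotropicSurface.isHolonomicSurface {k : ℕ∞} (hk : 1 ≤ k)
    {ψ : RP1 × RP1 → Projectivization ℝ W} {g : BilinField} {σ η : RP1 × RP1 → W}
    (hg : IsCompatibleMetric (k + 1) g) (hσ : IsIsotropicSurface (k + 1) ψ g σ)
    (hη : IsDualSurface σ η) (hs : SmoothOnAnnulus k η) :
    IsHolonomicSurface k
      fun p => ((Real.sqrt 2 / 2) • (σ p - η p), (Real.sqrt 2 / 2) • (σ p + η p)) := by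
  have hk' : (1 : WithTop ℕ∞) ≤ k := by exact_mod_cast hk
  have hσs : ContDiffOn ℝ k (σ ∘ angles) annulusCover :=
    hσ.smooth.of_le (by exact_mod_cast le_self_add)
  have hσd : ∀ z ∈ annulusCover, DifferentiableAt ℝ (σ ∘ angles) z := fun z hz =>
    differentiableAt_cover hk' hσs hz
  have hηd : ∀ z ∈ annulusCover, DifferentiableAt ℝ (η ∘ angles) z := fun z hz =>
    differentiableAt_cover hk' hs hz
  have hd : ∀ z ∈ annulusCover, ∀ u, dA (fun p => ((Real.sqrt 2 / 2) • (σ p - η p),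
      (Real.sqrt 2 / 2) • (σ p + η p))) z u = ((Real.sqrt 2 / 2) • (dA σ z u - dA η z u),
      (Real.sqrt 2 / 2) • (dA σ z u + dA η z u)) := by
    intro z hz u
    have h := (((hσd z hz).hasFDerivAt.sub (hηd z hz).hasFDerivAt).const_smul
      (Real.sqrt 2 / 2)).prodMk (((hσd z hz).hasFDerivAt.add (hηd z hz).hasFDerivAt).const_smul
      (Real.sqrt 2 / 2))
    exact congrArg (fun L => L u) h.fderiv
  have h1 : ∀ z ∈ annulusCover, ∀ u, form (σ (angles z)) (dA σ z u) = 0 := fun z hz u =>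
    form_fderiv_eq_zero (hσd z hz)
      (Filter.mem_of_superset (annulusCover_mem_nhds hz) fun z hz => hσ.isotropic _ hz) u
  have h2 : ∀ z ∈ annulusCover, ∀ u, form (η (angles z)) (dA η z u) = 0 := fun z hz u =>
    form_fderiv_eq_zero (hηd z hz)
      (Filter.mem_of_superset (annulusCover_mem_nhds hz) fun z hz => hη.isotropic _ hz) u
  have h3 : ∀ z ∈ annulusCover, ∀ u, form (σ (angles z)) (dA η z u) = 0 := fun z hz u => by
    have h := fderiv_form (hηd z hz) (hσd z hz) u
    have e : (fun z => form ((η ∘ angles) z) ((σ ∘ angles) z)) =ᶠ[𝓝 z] fun _ => 1 :=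
      Filter.mem_of_superset (annulusCover_mem_nhds hz) fun z hz => hη.pairing _ hz
    rw [e.fderiv_eq] at h
    have h' := hη.orthogonal z hz u
    simp only [fderiv_fun_const, Pi.zero_apply, zero_apply,
      Function.comp_apply] at h
    change form (η (angles z)) (fderiv ℝ (σ ∘ angles) z u) = 0 at h'
    rw [h', add_zero] at h
    rw [form_comm]
    exact h.symm
  refine ⟨?_, fun p hp => ?_, fun z hz => ?_, fun z hz u => ?_⟩
  · exact ((hσs.sub hs).const_smul (Real.sqrt 2 / 2)).prodMk
      ((hσs.add hs).const_smul (Real.sqrt 2 / 2))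
  · have e1 := hσ.isotropic p hp
    have e2 := hη.isotropic p hp
    have e3 := hη.pairing p hp
    have e4 := form_comm (σ p) (η p)
    have e5 := sqrt_two_half_sq
    refine ⟨?_, ?_, ?_⟩ <;>
      simp only [form_smul_left, form_smul_right, form_sub_left, form_sub_right, form_add_left,
        form_add_right, e1, e2, e4, e3]
    · linear_combination -2 * e5
    · linear_combination 2 * e5
    · ring
  · rw [injective_iff_map_eq_zero]
    intro u hu
    rw [hd z hz] at hu
    obtain ⟨e1, e2⟩ := Prod.mk.inj hu
    have e3 : dA σ z u - dA η z u = 0 := by simpa using e1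
    have e4 : dA σ z u + dA η z u = 0 := by simpa [-smul_add] using e2
    have e5 : dA σ z u = 0 := by
      have : (2 : ℝ) • dA σ z u = 0 := by rw [two_smul]; linear_combination e3 + e4
      simpa using this
    have e6 : ∀ v, g (angles z) u v = 0 := fun v => by
      rw [hσ.metric z hz, e5, form_zero_left]
    have hp := (hg.pos _ hz).ne'
    have e7 := e6 e₁
    have e8 := e6 e₂
    rw [hg.apply_eq hz u] at e7 e8
    ext
    · simpa [hp, show e₁.1 = 0 from rfl, show e₁.2 = 1 from rfl] using e7
    · simpa [hp, show e₂.1 = 1 from rfl, show e₂.2 = 0 from rfl] using e8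
  · rw [hd z hz]
    have a1 := h1 z hz u
    have a2 := h2 z hz u
    have a3 := h3 z hz u
    have a4 := hη.orthogonal z hz u
    constructor <;> simp only [form_smul_left, form_smul_right, form_sub_left, form_sub_right,
      form_add_left, form_add_right, a1, a2, a3, a4] <;> ring

theorem IsFrame.epsteinPair_mem {a b c d : W} (h : IsFrame a b c d) (r α β : ℝ) :
    epsteinPair r α β a b c d ∈ unitTangent := by
  obtain ⟨aa, -, -, ad, -, -, -, -, -, dd, -⟩ := h.shear α β
  have e : Real.exp r * Real.exp (-r) = 1 := by rw [← Real.exp_add]; simp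
  have hs := sqrt_two_half_sq
  have da := (form_comm _ _).trans ad
  rw [epsteinPair]
  generalize d + α • c + β • b + (α * β) • a = D at ad dd da
  refine ⟨?_, ?_, ?_⟩ <;>
    simp only [form_smul_left, form_smul_right, form_sub_left, form_sub_right, form_add_left,
      form_add_right, form_neg_left, form_neg_right, aa, ad, da, dd]
  · linear_combination -2 * (Real.sqrt 2 / 2 * (Real.sqrt 2 / 2)) * e - 2 * hs
  · linear_combination 2 * (Real.sqrt 2 / 2 * (Real.sqrt 2 / 2)) * e + 2 * hs
  · ring

theorem contDiffOn_epsteinCob {k : ℕ∞} {ψ : RP1 × RP1 → Projectivization ℝ W} {s : ℝ × ℝ → W}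
    (h : IsNormalLift ψ s) {ρ₀ ρ₁ : ℝ × ℝ → ℝ}
    (h₀ : ContDiffOn ℝ (k + 1 : ℕ∞) ρ₀ annulusCover)
    (h₁ : ContDiffOn ℝ (k + 1 : ℕ∞) ρ₁ annulusCover) :
    ContDiffOn ℝ k (epsteinCob ρ₀ ρ₁ s) (annulusCover ×ˢ univ) := by
  have hk : ((k : WithTop ℕ∞) + 1) ≤ ((k + 1 : ℕ∞) : WithTop ℕ∞) := by simp
  have hk' : (k : WithTop ℕ∞) ≤ ((k + 1 : ℕ∞) : WithTop ℕ∞) := by exact_mod_cast le_self_add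
  have lift : ∀ {E : Type} [NormedAddCommGroup E] [NormedSpace ℝ E] {F : ℝ × ℝ → E},
      ContDiffOn ℝ k F annulusCover →
      ContDiffOn ℝ k (fun q : Space => F q.1) (annulusCover ×ˢ univ) := fun hF =>
    hF.comp contDiffOn_fst fun q hq => hq.1
  have hi : (k : WithTop ℕ∞) ≤ (∞ : WithTop ℕ∞) := by exact_mod_cast le_top
  have interp : ∀ {f₀ f₁ : ℝ × ℝ → ℝ}, ContDiffOn ℝ k f₀ annulusCover →
      ContDiffOn ℝ k f₁ annulusCover →
      ContDiffOn ℝ k (fun q : Space => f₀ q.1 + q.2 * (f₁ q.1 - f₀ q.1)) (annulusCover ×ˢ univ) :=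
    fun a b => (lift a).add (contDiffOn_snd.mul ((lift b).sub (lift a)))
  have r := interp (h₀.of_le hk') (h₁.of_le hk')
  have α := interp (contDiffOn_dx hk h₀) (contDiffOn_dx hk h₁)
  have β := interp (contDiffOn_dy hk h₀) (contDiffOn_dy hk h₁)
  have a := lift (h.smooth.of_le hi)
  have b := lift (h.smooth_dx.of_le hi)
  have c := lift (h.smooth_dy.of_le hi)
  have d := lift (h.smooth_dxdy.of_le hi)
  have A := r.exp.smul a
  have B := (r.neg.exp.smul (((d.add (α.smul c)).add (β.smul b)).add ((α.mul β).smul a))).neg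
  exact ((A.sub B).const_smul _).prodMk ((A.add B).const_smul _)

/-- Every point of the torus has angular coordinates in `[0, π]`. -/
theorem exists_angles_eq (p : RP1 × RP1) :
    ∃ z ∈ Icc (0 : ℝ) Real.pi ×ˢ Icc (0 : ℝ) Real.pi, angles z = p := by
  have h1 : ∀ x : RP1, ∃ t ∈ Icc (0 : ℝ) Real.pi, angle t = x := fun x => by
    obtain ⟨t, rfl⟩ := angle_surjective x
    refine ⟨toIcoMod Real.pi_pos 0 t, ?_, ?_⟩
    · have := toIcoMod_mem_Ico Real.pi_pos 0 t
      rw [zero_add] at this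
      exact Ico_subset_Icc_self this
    · rw [angle_eq_angle_iff, self_sub_toIcoMod, zsmul_eq_mul, Real.sin_int_mul_pi]
  obtain ⟨t, ht, e⟩ := h1 p.1
  obtain ⟨t', ht', e'⟩ := h1 p.2
  exact ⟨(t, t'), ⟨ht, ht'⟩, Prod.ext e e'⟩

/-- The set covered by `core m` is compact: it is covered by the part of `core m` in a square. -/
theorem isCompactInAnnulus_image_core {m : ℝ} (hm : 0 < m) : IsCompactInAnnulus (angles '' core m) := by
  refine ⟨(Icc 0 Real.pi ×ˢ Icc 0 Real.pi) ∩ core m, fun z hz => core_subset hm hz.2,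
    (isCompact_Icc.prod isCompact_Icc).inter_right (isClosed_core m),
    Subset.antisymm ?_ (image_mono inter_subset_right)⟩
  rintro p ⟨z, hz, rfl⟩
  obtain ⟨z', hz', e⟩ := exists_angles_eq (angles z)
  refine ⟨z', ⟨hz', ?_⟩, e⟩
  rw [core, mem_ofPred_eq] at hz ⊢
  rwa [abs_sin_eq_of_angles_eq e]

/-- Two functions agree near every point outside `core m`. -/
def AgreeOffCore (m : ℝ) (ρ₀ ρ₁ : ℝ × ℝ → ℝ) : Prop :=
  ∀ ⦃z⦄, z ∈ annulusCover → z ∉ core m → ρ₁ =ᶠ[𝓝 z] ρ₀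

theorem EqualOutsideCompact.exists_agree {g₀ g₁ : BilinField} (h : EqualOutsideCompact g₀ g₁) :
    ∃ m > 0, AgreeOffCore m (logFactor g₀) (logFactor g₁) := by
  obtain ⟨K, hK, he⟩ := h
  obtain ⟨m, hm, hc⟩ := hK.exists_core
  refine ⟨m, hm, fun z hz hzm => ?_⟩
  filter_upwards [annulusCover_mem_nhds hz, (isClosed_core m).isOpen_compl.mem_nhds hzm]
    with p hp hpm
  rw [logFactor, logFactor, he _ hp fun hpK => hpm (hc _ hpK)]

theorem dx_congr {F G : ℝ × ℝ → ℝ} {z : ℝ × ℝ} (h : F =ᶠ[𝓝 z] G) : dx F =ᶠ[𝓝 z] dx G := by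
  filter_upwards [h.eventuallyEq_nhds] with p hp
  rw [dx, dx, hp.fderiv_eq]

theorem dy_congr {F G : ℝ × ℝ → ℝ} {z : ℝ × ℝ} (h : F =ᶠ[𝓝 z] G) : dy F =ᶠ[𝓝 z] dy G := by
  filter_upwards [h.eventuallyEq_nhds] with p hp
  rw [dy, dy, hp.fderiv_eq]

/-- The cobordism `epsteinCob` seen on the annulus. -/
def epsteinMap (g₀ g₁ : BilinField) (s : ℝ × ℝ → W) (p : RP1 × RP1) (t : ℝ) : W × W :=
  epsteinCob (logFactor g₀) (logFactor g₁) s (coords p, t)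

theorem epsteinCob_coords {ψ : RP1 × RP1 → Projectivization ℝ W} {s : ℝ × ℝ → W}
    (h : IsNormalLift ψ s) {ρ₀ ρ₁ : ℝ × ℝ → ℝ} (h₀ : AngPeriodic ρ₀) (h₁ : AngPeriodic ρ₁)
    (z : ℝ × ℝ) (t : ℝ) :
    epsteinCob ρ₀ ρ₁ s (coords (angles z), t) = epsteinCob ρ₀ ρ₁ s (z, t) := by
  rw [epsteinCob, epsteinCob]
  simp only [h₀.coords_angles, h₁.coords_angles, h₀.dx.coords_angles, h₁.dx.coords_angles,
    h₀.dy.coords_angles, h₁.dy.coords_angles, h.per.coords_angles, h.per.dx.coords_angles,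
    h.per.dy.coords_angles, h.per.dy.dx.coords_angles]

theorem cobordismLift_epsteinMap {ψ : RP1 × RP1 → Projectivization ℝ W} {s : ℝ × ℝ → W}
    (h : IsNormalLift ψ s) (g₀ g₁ : BilinField) :
    cobordismLift (epsteinMap g₀ g₁ s) = epsteinCob (logFactor g₀) (logFactor g₁) s :=
  funext fun q => epsteinCob_coords h (logFactor_per g₀) (logFactor_per g₁) q.1 q.2

theorem epsteinMap_zero (g₀ g₁ : BilinField) (s : ℝ × ℝ → W) :
    (fun p => epsteinMap g₀ g₁ s p 0) = fun p =>
      ((Real.sqrt 2 / 2) • (isoSurf (logFactor g₀) s (coords p) - dualSurf (logFactor g₀) s (coords p)),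
       (Real.sqrt 2 / 2) • (isoSurf (logFactor g₀) s (coords p) + dualSurf (logFactor g₀) s (coords p))) :=
  funext fun p => epsteinCob_zero _ _ s (coords p)

theorem epsteinMap_one (g₀ g₁ : BilinField) (s : ℝ × ℝ → W) :
    (fun p => epsteinMap g₀ g₁ s p 1) = fun p =>
      ((Real.sqrt 2 / 2) • (isoSurf (logFactor g₁) s (coords p) - dualSurf (logFactor g₁) s (coords p)),
       (Real.sqrt 2 / 2) • (isoSurf (logFactor g₁) s (coords p) + dualSurf (logFactor g₁) s (coords p))) :=
  funext fun p => epsteinCob_one _ _ s (coords p)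

theorem smoothOnAnnulus_dualSurf {k : ℕ∞} {ψ : RP1 × RP1 → Projectivization ℝ W} {s : ℝ × ℝ → W}
    (h : IsNormalLift ψ s) {g : BilinField} (hg : IsCompatibleMetric (k + 1) g) :
    SmoothOnAnnulus k fun p => dualSurf (logFactor g) s (coords p) := by
  have hk : ((k : WithTop ℕ∞) + 1) ≤ ((k + 1 : ℕ∞) : WithTop ℕ∞) := by simp
  have hk' : (k : WithTop ℕ∞) ≤ ((k + 1 : ℕ∞) : WithTop ℕ∞) := by exact_mod_cast le_self_add
  have hi : (k : WithTop ℕ∞) ≤ (∞ : WithTop ℕ∞) := by exact_mod_cast le_top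
  rw [SmoothOnAnnulus, (dualSurf_per h (logFactor_per g)).comp_coords_comp]
  have r := hg.smooth_logFactor.of_le hk'
  have α := contDiffOn_dx hk hg.smooth_logFactor
  have β := contDiffOn_dy hk hg.smooth_logFactor
  exact (r.neg.exp.smul ((((h.smooth_dxdy.of_le hi).add (α.smul (h.smooth_dy.of_le hi))).add
    (β.smul (h.smooth_dx.of_le hi))).add ((α.mul β).smul (h.smooth.of_le hi)))).neg

/-- Linear interpolation of the logarithms of the conformal factors joins the two Epstein surfaces.
Every surface of the family is again an Epstein surface, so it stays in the unit tangent bundle. -/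
theorem isEpsteinCobordism_epsteinMap {k : ℕ∞} (hk : 1 ≤ k) {g₀ g₁ : BilinField}
    (hg₀ : IsCompatibleMetric (k + 1) g₀) (hg₁ : IsCompatibleMetric (k + 1) g₁)
    (hg : EqualOutsideCompact g₀ g₁) {ψ : RP1 × RP1 → Projectivization ℝ W} {s : ℝ × ℝ → W}
    (h : IsNormalLift ψ s) : IsEpsteinCobordism k ψ g₀ g₁ (epsteinMap g₀ g₁ s) := by
  have hk1 : 1 ≤ k + 1 := hk.trans le_self_add
  refine ⟨⟨?_, fun p hp t _ => (h.isFrame (coords_mem hp)).epsteinPair_mem _ _ _, ?_, ?_, ?_⟩,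
    ⟨_, _, isIsotropicSurface hk1 hg₀ h, isDualSurface hk1 hg₀ h, fun p _ =>
      congrFun (epsteinMap_zero g₀ g₁ s) p⟩,
    ⟨_, _, isIsotropicSurface hk1 hg₁ h, isDualSurface hk1 hg₁ h, fun p _ =>
      congrFun (epsteinMap_one g₀ g₁ s) p⟩⟩
  · rw [cobordismLift_epsteinMap h]
    exact (contDiffOn_epsteinCob h hg₀.smooth_logFactor hg₁.smooth_logFactor).mono
      (prod_mono_right (subset_univ _))
  · rw [epsteinMap_zero]
    exact (isIsotropicSurface hk1 hg₀ h).isHolonomicSurface hk hg₀ (isDualSurface hk1 hg₀ h)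
      (smoothOnAnnulus_dualSurf h hg₀)
  · rw [epsteinMap_one]
    exact (isIsotropicSurface hk1 hg₁ h).isHolonomicSurface hk hg₁ (isDualSurface hk1 hg₁ h)
      (smoothOnAnnulus_dualSurf h hg₁)
  · obtain ⟨m, hm, hc⟩ := hg.exists_agree
    refine ⟨_, isCompactInAnnulus_image_core hm, fun p hp hpm t _ => ?_⟩
    have hz := hc (coords_mem hp) fun hz => hpm ⟨_, hz, angles_coords p⟩
    simp only [epsteinMap, epsteinCob, hz.self_of_nhds, (dx_congr hz).self_of_nhds,
      (dy_congr hz).self_of_nhds, sub_self, mul_zero]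

/-! ### Uniqueness of Epstein surfaces -/

/-- An isotropic vector with prescribed product with `a`, orthogonal to `b` and `c`, is unique. -/
theorem IsFrame.eq_neg_smul {a b c d : W} (h : IsFrame a b c d) {v : W} {r : ℝ} (hr : r ≠ 0)
    (ha : form v a = r) (hb : form v b = 0) (hc : form v c = 0) (hv : form v v = 0) :
    v = -r • d := by
  have da := (form_comm d a).trans h.ad
  have e := eq_neg_form_smul (v := v + r • d) h.vol h.aa h.ab h.ac h.ad
    (by rw [form_add_left, form_smul_left, ha, da]; ring)
    (by rw [form_add_left, form_smul_left, hb, form_comm d b, h.bd]; ring)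
    (by rw [form_add_left, form_smul_left, hc, form_comm d c, h.cd]; ring)
  generalize form (v + r • d) d = κ at e
  have e' : v = -r • d - κ • a := by rw [eq_sub_of_add_eq e]; module
  have : 2 * r * κ = 0 := by
    rw [e'] at hv
    simp only [form_sub_left, form_sub_right, form_smul_left, form_smul_right, h.aa, h.ad, da,
      h.dd] at hv
    linarith
  have hκ : κ = 0 := by simpa [hr] using this
  rw [e', hκ, zero_smul, sub_zero]

section Uniqueness
variable {ψ : RP1 × RP1 → Projectivization ℝ W} {s : ℝ × ℝ → W} {n : ℕ∞} {g : BilinField}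

/-- An isotropic surface of metric `e^{2ρ} · 2 dx dy` is `c s` with `c² = e^{2ρ}`, and the sign of `c`
is constant on the strip, which is connected. -/
theorem IsIsotropicSurface.exists_sign (hn : 1 ≤ n) (hg : IsCompatibleMetric n g)
    (h : IsNormalLift ψ s) {σ : RP1 × RP1 → W} (hσ : IsIsotropicSurface n ψ g σ) :
    ∃ δ : ℝ, δ ^ 2 = 1 ∧ ∀ z ∈ strip, σ (angles z) = δ • isoSurf (logFactor g) s z := by
  have hn' : (1 : WithTop ℕ∞) ≤ n := by exact_mod_cast hn
  have hn'' : (n : WithTop ℕ∞) ≤ (∞ : WithTop ℕ∞) := by exact_mod_cast le_top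
  set c : ℝ × ℝ → ℝ := fun z => -form (σ (angles z)) (dx (dy s) z) with hc
  have hcs : ContDiffOn ℝ n c annulusCover :=
    (contDiffOn_form hσ.smooth (h.smooth_dxdy.of_le hn'')).neg
  have hsc : ∀ z ∈ annulusCover, σ (angles z) = c z • s z := fun z hz => by
    obtain ⟨h1, e1⟩ := hσ.lift _ hz
    obtain ⟨h2, e2⟩ := h.lift z hz
    obtain ⟨κ, hκ⟩ := exists_smul_of_mk_eq (e1.symm.trans e2)
    have : c z = κ := by
      simp only [hc, hκ, form_smul_left, h.ad hz]; ring
    rw [this, hκ]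
  have hsq : ∀ z ∈ annulusCover, c z ^ 2 = Real.exp (logFactor g z) ^ 2 := fun z hz => by
    have e := form_fderiv_smul (differentiableAt_cover (by simp) h.smooth hz)
      (differentiableAt_cover hn' hcs hz)
      (Filter.mem_of_superset (annulusCover_mem_nhds hz) h.null)
      (Y := σ ∘ angles) (Filter.mem_of_superset (annulusCover_mem_nhds hz) hsc) e₁ e₂
    have e' := hσ.metric z hz e₁ e₂
    change form (fderiv ℝ (σ ∘ angles) z e₁) (fderiv ℝ (σ ∘ angles) z e₂) =
      c z ^ 2 * form (dy s z) (dx s z) at e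
    rw [form_comm (dy s z), h.conf z hz, mul_one] at e
    rw [hg.exp_logFactor_sq hz, e', ← e]
    rfl
  have hE : ContinuousOn (fun z => Real.exp (logFactor g z)) strip :=
    (Real.continuous_exp.comp_continuousOn (hg.smooth_logFactor.continuousOn)).mono strip_subset
  rcases convex_strip.isPreconnected.eq_or_eq_neg_of_sq_eq (hcs.continuousOn.mono strip_subset) hE
    (fun z hz => hsq z (strip_subset hz)) (fun {z} _ => (Real.exp_pos _).ne') with hp | hp
  · refine ⟨1, by norm_num, fun z hz => ?_⟩
    rw [hsc z (strip_subset hz), hp hz, one_smul, isoSurf]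
  · refine ⟨-1, by norm_num, fun z hz => ?_⟩
    rw [hsc z (strip_subset hz), hp hz, isoSurf, Pi.neg_apply, neg_smul, neg_smul, one_smul]

/-- The Epstein surface is determined, up to a sign, by the metric and the immersion. -/
theorem IsEpsteinSurface.exists_sign (hn : 1 ≤ n) (hg : IsCompatibleMetric n g)
    (h : IsNormalLift ψ s) {ε : RP1 × RP1 → W × W} (hε : IsEpsteinSurface n ψ g ε) :
    ∃ δ : ℝ, δ ^ 2 = 1 ∧ ∀ z ∈ strip, ε (angles z) =
      δ • ((Real.sqrt 2 / 2) • (isoSurf (logFactor g) s z - dualSurf (logFactor g) s z),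
        (Real.sqrt 2 / 2) • (isoSurf (logFactor g) s z + dualSurf (logFactor g) s z)) := by
  obtain ⟨σ, η, hσ, hη, e⟩ := hε
  obtain ⟨δ, hδ, hs⟩ := hσ.exists_sign hn hg h
  have hn' : (1 : WithTop ℕ∞) ≤ n := by exact_mod_cast hn
  have hδ0 : δ ≠ 0 := by rintro rfl; norm_num at hδ
  refine ⟨δ, hδ, fun z hz => ?_⟩
  have hz' := strip_subset hz
  have hρd := differentiableAt_cover hn' hg.smooth_logFactor hz'
  have hsd : DifferentiableAt ℝ s z := differentiableAt_cover (by simp) h.smooth hz'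
  have hd : ∀ u, dA σ z u = δ • fderiv ℝ (isoSurf (logFactor g) s) z u := fun u => by
    have e1 : σ ∘ angles =ᶠ[𝓝 z] δ • isoSurf (logFactor g) s :=
      Filter.mem_of_superset (isOpen_strip.mem_nhds hz) hs
    have e2 : DifferentiableAt ℝ (isoSurf (logFactor g) s) z := hρd.exp.fun_smul hsd
    rw [dA, e1.fderiv_eq, fderiv_const_smul e2]
    rfl
  have hpair := hη.pairing _ hz'
  have hE := Real.exp_ne_zero (logFactor g z)
  have hEE : Real.exp (-logFactor g z) * Real.exp (logFactor g z) = 1 := by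
    rw [← Real.exp_add]; simp
  rw [hs z hz, isoSurf, form_smul_right, form_smul_right] at hpair
  have orth : ∀ u, form (η (angles z)) (fderiv ℝ s z u + fderiv ℝ (logFactor g) z u • s z) = 0 :=
    fun u => by
      have := hη.orthogonal z hz' u
      rw [hd, fderiv_isoSurf hρd hsd, form_smul_right, form_smul_right] at this
      simpa [hδ0, hE] using this
  have hdual : η (angles z) = δ • dualSurf (logFactor g) s z := by
    rw [((h.isFrame hz').shear (dx (logFactor g) z) (dy (logFactor g) z)).eq_neg_smul
      (r := δ * Real.exp (-logFactor g z)) (mul_ne_zero hδ0 (Real.exp_ne_zero _))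
      (by linear_combination (δ * Real.exp (-logFactor g z)) * hpair -
            form (η (angles z)) (s z) * (δ ^ 2 * hEE + hδ))
      (orth e₂) (orth e₁) (hη.isotropic _ hz'), dualSurf]
    module
  rw [e _ hz', hs z hz, hdual, Prod.smul_mk]
  congr 1 <;> module

end Uniqueness

theorem eq_of_smul_eq_smul {v : W × W} (hv : v ∈ unitTangent) {δ δ' : ℝ} (h : δ • v = δ' • v) :
    δ = δ' := by
  by_contra hne
  have : v = 0 := by
    have e : (δ - δ') • v = 0 := by rw [sub_smul, h, sub_self]
    exact (smul_eq_zero.1 e).resolve_left (sub_ne_zero.2 hne)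
  have h1 := hv.1
  simp [this, form_zero_left] at h1

/-- The form `α` is invariant under `-1`. -/
theorem alphaDensity_congr {ε ε' : RP1 × RP1 → W × W} {δ : ℝ} (hδ : δ ^ 2 = 1)
    (h : ∀ z ∈ strip, ε (angles z) = δ • ε' (angles z)) {z : ℝ × ℝ} (hz : z ∈ strip) :
    alphaDensity ε z = alphaDensity ε' z := by
  have e1 : ε ∘ angles =ᶠ[𝓝 z] δ • (ε' ∘ angles) :=
    Filter.mem_of_superset (isOpen_strip.mem_nhds hz) h
  have hd : ∀ u, dA ε z u = δ • dA ε' z u := fun u => by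
    rw [dA, e1.fderiv_eq, dA]
    rw [fderiv_const_smul_field]
    rfl
  have hv : ∀ a b c d : W, vol (δ • a) (δ • b) (δ • c) (δ • d) = vol a b c d := fun a b c d => by
    simp only [vol_eq, Pi.smul_apply, smul_eq_mul]
    have : δ ^ 4 = 1 := by rw [show (4 : ℕ) = 2 * 2 from rfl, pow_mul, hδ, one_pow]
    linear_combination vol a b c d * this + (1 - δ ^ 4) * vol_eq a b c d
  simp only [alphaDensity, alphaForm, hd, h z hz, Prod.smul_fst, Prod.smul_snd, hv]

/-- The `W`-volume only depends on the Epstein surfaces which bound the cobordism.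
The signs of these at the two ends agree, since both cobordisms are constant in time near the
ends of the annulus. -/
theorem wVolume_eq {k : ℕ∞} (hk : 1 ≤ k) {g₀ g₁ : BilinField}
    (hg₀ : IsCompatibleMetric (k + 1) g₀) (hg₁ : IsCompatibleMetric (k + 1) g₁)
    (hg : EqualOutsideCompact g₀ g₁) {ψ : RP1 × RP1 → Projectivization ℝ W} {s : ℝ × ℝ → W}
    (h : IsNormalLift ψ s) {φ : RP1 × RP1 → ℝ → W × W} (hφ : IsEpsteinCobordism k ψ g₀ g₁ φ) :
    wVolume φ = wVolume (epsteinMap g₀ g₁ s) := by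
  have hk1 : 1 ≤ k + 1 := hk.trans le_self_add
  have hmap := isEpsteinCobordism_epsteinMap hk hg₀ hg₁ hg h
  have hlift : ∀ z t, epsteinMap g₀ g₁ s (angles z) t =
      epsteinCob (logFactor g₀) (logFactor g₁) s (z, t) := fun z t =>
    congrFun (cobordismLift_epsteinMap h g₀ g₁) (z, t)
  obtain ⟨δ, hδ, h0⟩ := hφ.epstein₀.exists_sign hk1 hg₀ h
  obtain ⟨δ', hδ', h1⟩ := hφ.epstein₁.exists_sign hk1 hg₁ h
  simp only [← epsteinCob_zero (logFactor g₀) (logFactor g₁), ← hlift] at h0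
  simp only [← epsteinCob_one (logFactor g₀) (logFactor g₁), ← hlift] at h1
  have hδδ : δ' = δ := by
    obtain ⟨m, hm, hc⟩ := hφ.lens.exists_core
    obtain ⟨m', hm', hc'⟩ := hmap.lens.exists_core
    -- a point of the strip close enough to its edge
    obtain ⟨z, hz, hzm, hzm'⟩ : ∃ z ∈ strip, z ∉ core m ∧ z ∉ core m' := by
      set r := min (min (m / 2) (m' / 2)) 1
      have hr : 0 < r := by positivity
      have hr1 : r ≤ 1 := min_le_right _ _
      have hlt : |Real.sin (r - 0)| ≤ r := by
        rw [sub_zero, abs_of_pos (Real.sin_pos_of_pos_of_le_one hr hr1)]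
        exact Real.sin_le hr.le
      refine ⟨(0, r), ⟨hr, by simp; linarith [Real.pi_gt_three]⟩, fun hh => ?_, fun hh => ?_⟩
      · have : m ≤ |Real.sin (r - 0)| := hh
        have : r ≤ m / 2 := (min_le_left _ _).trans (min_le_left _ _)
        linarith
      · have : m' ≤ |Real.sin (r - 0)| := hh
        have : r ≤ m' / 2 := (min_le_left _ _).trans (min_le_right _ _)
        linarith
    have hz' := strip_subset hz
    have h1m : (1 : ℝ) ∈ Icc (0 : ℝ) 1 := ⟨zero_le_one, le_rfl⟩
    have e := h1 z hz
    rw [hc z hz' hzm 1 h1m, h0 z hz, hc' z hz' hzm' 1 h1m] at e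
    exact (eq_of_smul_eq_smul (hmap.lens.mem _ hz' 0 ⟨le_rfl, zero_le_one⟩) e).symm
  rw [hδδ] at h1
  rw [wVolume, wVolume, integral_omegaDensity_eq hk hφ.lens hmap.lens hδ h0 h1]
  congr 1
  refine setIntegral_congr_fun measurableSet_fundDomain fun z hz => ?_
  have hz' := fundDomain_subset_strip hz
  change alphaDensity _ z - alphaDensity _ z = _
  rw [alphaDensity_congr (ε := fun p => φ p 0) (ε' := fun p => epsteinMap g₀ g₁ s p 0) hδ h0 hz',
    alphaDensity_congr (ε := fun p => φ p 1) (ε' := fun p => epsteinMap g₀ g₁ s p 1) hδ h1 hz']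

/-! ### Densities of the explicit cobordism -/

theorem vol_smul (κ : ℝ) (a b c d : W) :
    vol (κ • a) (κ • b) (κ • c) (κ • d) = κ ^ 4 * vol a b c d := by
  simp only [vol_eq, Pi.smul_apply, smul_eq_mul]
  ring

theorem hasDerivAt_epsteinPair {r α β : ℝ → ℝ} {a b c d : ℝ → W} {r' α' β' : ℝ} {a' b' c' d' : W}
    {τ : ℝ} (hr : HasDerivAt r r' τ) (hα : HasDerivAt α α' τ) (hβ : HasDerivAt β β' τ)
    (ha : HasDerivAt a a' τ) (hb : HasDerivAt b b' τ) (hc : HasDerivAt c c' τ)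
    (hd : HasDerivAt d d' τ) :
    HasDerivAt (fun τ => epsteinPair (r τ) (α τ) (β τ) (a τ) (b τ) (c τ) (d τ))
      ((Real.sqrt 2 / 2) • (Real.exp (r τ) • (a' + r' • a τ) + Real.exp (-r τ) •
          (d' + (α τ • c' + α' • c τ) + (β τ • b' + β' • b τ) +
          ((α τ * β τ) • a' + (α' * β τ + α τ * β') • a τ) -
          r' • (d τ + α τ • c τ + β τ • b τ + (α τ * β τ) • a τ))),
        (Real.sqrt 2 / 2) • (Real.exp (r τ) • (a' + r' • a τ) - Real.exp (-r τ) •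
          (d' + (α τ • c' + α' • c τ) + (β τ • b' + β' • b τ) +
          ((α τ * β τ) • a' + (α' * β τ + α τ * β') • a τ) -
          r' • (d τ + α τ • c τ + β τ • b τ + (α τ * β τ) • a τ)))) τ := by
  have A := hr.exp.smul ha
  have B := (hr.fun_neg.exp.fun_smul (((hd.fun_add (hα.fun_smul hc)).fun_add
    (hβ.fun_smul hb)).fun_add ((hα.fun_mul hβ).fun_smul ha))).fun_neg
  refine HasDerivAt.congr_deriv (((A.sub B).const_smul (Real.sqrt 2 / 2)).prodMk
    ((A.add B).const_smul (Real.sqrt 2 / 2))) ?_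
  rw [Prod.mk.injEq]
  constructor <;> module

/-- The linear interpolation of two functions of the plane. -/
def interp (f₀ f₁ : ℝ × ℝ → ℝ) (q : Space) : ℝ := f₀ q.1 + q.2 * (f₁ q.1 - f₀ q.1)

theorem hasDerivAt_line {E : Type*} [NormedAddCommGroup E] [NormedSpace ℝ E] {F : ℝ × ℝ → E}
    {z : ℝ × ℝ} (hF : DifferentiableAt ℝ F z) (v : ℝ × ℝ) :
    HasDerivAt (fun τ : ℝ => F (z + τ • v)) (fderiv ℝ F z v) 0 :=
  hF.hasFDerivAt.hasLineDerivAt v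

theorem hasDerivAt_interp_line {f₀ f₁ : ℝ × ℝ → ℝ} {q : Space} (h₀ : DifferentiableAt ℝ f₀ q.1)
    (h₁ : DifferentiableAt ℝ f₁ q.1) (v : Space) :
    HasDerivAt (fun τ : ℝ => interp f₀ f₁ (q + τ • v))
      (interp (fun z => fderiv ℝ f₀ z v.1) (fun z => fderiv ℝ f₁ z v.1) q +
        v.2 * (f₁ q.1 - f₀ q.1)) 0 := by
  have a₀ := hasDerivAt_line h₀ v.1
  have a₁ := hasDerivAt_line h₁ v.1
  have t : HasDerivAt (fun τ : ℝ => q.2 + τ * v.2) v.2 0 := by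
    simpa using ((hasDerivAt_id (0 : ℝ)).mul_const v.2).const_add q.2
  refine HasDerivAt.congr_deriv (a₀.add (t.mul (a₁.sub a₀))) ?_
  simp [interp]
  ring

section Density
variable {ψ : RP1 × RP1 → Projectivization ℝ W} {s : ℝ × ℝ → W} {ρ₀ ρ₁ : ℝ × ℝ → ℝ} {k : ℕ∞}

/-- The coefficient `ρ_xx - ρ_x² - q`, for the interpolation `ρ` of `ρ₀` and `ρ₁`. -/
def coefX (ρ₀ ρ₁ : ℝ × ℝ → ℝ) (s : ℝ × ℝ → W) (q : Space) : ℝ :=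
  interp (dx (dx ρ₀)) (dx (dx ρ₁)) q - interp (dx ρ₀) (dx ρ₁) q ^ 2 - potX s q.1

/-- The coefficient `ρ_yy - ρ_y² - Q` along `∂_y`, as in `coefX`. -/
def coefY (ρ₀ ρ₁ : ℝ × ℝ → ℝ) (s : ℝ × ℝ → W) (q : Space) : ℝ :=
  interp (dy (dy ρ₀)) (dy (dy ρ₁)) q - interp (dy ρ₀) (dy ρ₁) q ^ 2 - potY s q.1

/-- The derivative of the cobordism in the direction `v`, in terms of the derivatives of the
interpolated functions and of the frame in that direction. -/
theorem fderiv_epsteinCob (hk : 1 ≤ k) (h : IsNormalLift ψ s)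
    (h₀ : ContDiffOn ℝ (k + 1 : ℕ∞) ρ₀ annulusCover)
    (h₁ : ContDiffOn ℝ (k + 1 : ℕ∞) ρ₁ annulusCover) {q : Space} (hq : q.1 ∈ annulusCover)
    (v : Space) {r' α' β' : ℝ} {a' b' c' d' : W}
    (hr : interp (fun z => fderiv ℝ ρ₀ z v.1) (fun z => fderiv ℝ ρ₁ z v.1) q +
      v.2 * (ρ₁ q.1 - ρ₀ q.1) = r')
    (hα : interp (fun z => fderiv ℝ (dx ρ₀) z v.1) (fun z => fderiv ℝ (dx ρ₁) z v.1) q +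
      v.2 * (dx ρ₁ q.1 - dx ρ₀ q.1) = α')
    (hβ : interp (fun z => fderiv ℝ (dy ρ₀) z v.1) (fun z => fderiv ℝ (dy ρ₁) z v.1) q +
      v.2 * (dy ρ₁ q.1 - dy ρ₀ q.1) = β')
    (ha : fderiv ℝ s q.1 v.1 = a') (hb : fderiv ℝ (dx s) q.1 v.1 = b')
    (hc : fderiv ℝ (dy s) q.1 v.1 = c') (hd : fderiv ℝ (dx (dy s)) q.1 v.1 = d') :
    let r := interp ρ₀ ρ₁ q
    let α := interp (dx ρ₀) (dx ρ₁) q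
    let β := interp (dy ρ₀) (dy ρ₁) q
    let J := d' + (α • c' + α' • dy s q.1) + (β • b' + β' • dx s q.1) +
          ((α * β) • a' + (α' * β + α * β') • s q.1) -
          r' • (dx (dy s) q.1 + α • dy s q.1 + β • dx s q.1 + (α * β) • s q.1)
    fderiv ℝ (epsteinCob ρ₀ ρ₁ s) q v =
      ((Real.sqrt 2 / 2) • (Real.exp r • (a' + r' • s q.1) + Real.exp (-r) • J),
       (Real.sqrt 2 / 2) • (Real.exp r • (a' + r' • s q.1) - Real.exp (-r) • J)) := by
  intro r α β J
  have hk' : (1 : WithTop ℕ∞) ≤ k := by exact_mod_cast hk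
  have hk1 : (1 : WithTop ℕ∞) ≤ (k + 1 : ℕ∞) := by exact_mod_cast hk.trans le_self_add
  have hkk : ((k : WithTop ℕ∞) + 1) ≤ ((k + 1 : ℕ∞) : WithTop ℕ∞) := by simp
  have hopen : annulusCover ×ˢ (univ : Set ℝ) ∈ 𝓝 q :=
    (isOpen_annulusCover.prod isOpen_univ).mem_nhds ⟨hq, mem_univ _⟩
  have hd0 : DifferentiableAt ℝ (epsteinCob ρ₀ ρ₁ s) q :=
    (((contDiffOn_epsteinCob h h₀ h₁).of_le hk').contDiffAt hopen).differentiableAt one_ne_zero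
  have key := hasDerivAt_epsteinPair
    (hasDerivAt_interp_line (differentiableAt_cover hk1 h₀ hq) (differentiableAt_cover hk1 h₁ hq) v)
    (hasDerivAt_interp_line (differentiableAt_cover hk' (contDiffOn_dx hkk h₀) hq)
      (differentiableAt_cover hk' (contDiffOn_dx hkk h₁) hq) v)
    (hasDerivAt_interp_line (differentiableAt_cover hk' (contDiffOn_dy hkk h₀) hq)
      (differentiableAt_cover hk' (contDiffOn_dy hkk h₁) hq) v)
    (hasDerivAt_line (differentiableAt_cover (by simp) h.smooth hq) v.1)
    (hasDerivAt_line (differentiableAt_cover (by simp) h.smooth_dx hq) v.1)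
    (hasDerivAt_line (differentiableAt_cover (by simp) h.smooth_dy hq) v.1)
    (hasDerivAt_line (differentiableAt_cover (by simp) h.smooth_dxdy hq) v.1)
  rw [hr, hα, hβ, ha, hb, hc, hd] at key
  simp only [zero_smul, add_zero] at key
  rw [← hd0.lineDeriv_eq_fderiv]
  exact HasLineDerivAt.lineDeriv key

/-- The cobordism and its partial derivatives in the sheared frame
`(s, s_y + ρ_y s, s_x + ρ_x s, s_xy + ρ_x s_y + ρ_y s_x + ρ_x ρ_y s)`. -/
theorem epsteinCob_derivs (hk : 1 ≤ k) (h : IsNormalLift ψ s)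
    (h₀ : ContDiffOn ℝ (k + 1 : ℕ∞) ρ₀ annulusCover)
    (h₁ : ContDiffOn ℝ (k + 1 : ℕ∞) ρ₁ annulusCover) {q : Space} (hq : q.1 ∈ annulusCover) :
    let E := Real.exp (interp ρ₀ ρ₁ q)
    let E' := Real.exp (-interp ρ₀ ρ₁ q)
    let α := interp (dx ρ₀) (dx ρ₁) q
    let β := interp (dy ρ₀) (dy ρ₁) q
    let μ := interp (dx (dy ρ₀)) (dx (dy ρ₁)) q
    let f := ρ₁ q.1 - ρ₀ q.1
    let F := comb (s q.1) (dy s q.1 + β • s q.1) (dx s q.1 + α • s q.1)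
      (dx (dy s) q.1 + α • dy s q.1 + β • dx s q.1 + (α * β) • s q.1)
    epsteinCob ρ₀ ρ₁ s q = ((Real.sqrt 2 / 2) • F ![E, 0, 0, E'],
      (Real.sqrt 2 / 2) • F ![E, 0, 0, -E']) ∧
    fderiv ℝ (epsteinCob ρ₀ ρ₁ s) q (e₂, 0) =
      ((Real.sqrt 2 / 2) • F ![0, E' * coefX ρ₀ ρ₁ s q, E + E' * μ, 0],
       (Real.sqrt 2 / 2) • F ![0, -(E' * coefX ρ₀ ρ₁ s q), E - E' * μ, 0]) ∧
    fderiv ℝ (epsteinCob ρ₀ ρ₁ s) q (e₁, 0) =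
      ((Real.sqrt 2 / 2) • F ![0, E + E' * μ, E' * coefY ρ₀ ρ₁ s q, 0],
       (Real.sqrt 2 / 2) • F ![0, E - E' * μ, -(E' * coefY ρ₀ ρ₁ s q), 0]) ∧
    (fderiv ℝ (epsteinCob ρ₀ ρ₁ s) q (0, 1)).1 =
      (Real.sqrt 2 / 2) • F ![E * f, E' * (dx ρ₁ q.1 - dx ρ₀ q.1),
        E' * (dy ρ₁ q.1 - dy ρ₀ q.1), -(E' * f)] := by
  intro E E' α β μ f F
  have hC2 : (2 : WithTop ℕ∞) ≤ (k + 1 : ℕ∞) := by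
    have : (1 : ℕ∞) + 1 ≤ k + 1 := by gcongr
    rw [one_add_one_eq_two] at this
    exact WithTop.coe_le_coe.2 this
  have cm₀ := dx_dy_comm (h₀.of_le hC2) hq
  have cm₁ := dx_dy_comm (h₁.of_le hC2) hq
  refine ⟨?_, ?_, ?_, ?_⟩
  · simp only [epsteinCob, epsteinPair, F, comb, Matrix.cons_val]
    rw [Prod.mk.injEq]
    constructor <;> congr 1 <;> simp only [E, E', α, β, interp] <;> module
  · rw [fderiv_epsteinCob hk h h₀ h₁ hq (e₂, 0) (r' := α)
      (α' := interp (dx (dx ρ₀)) (dx (dx ρ₁)) q) (β' := μ) (a' := dx s q.1)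
      (b' := -potX s q.1 • s q.1) (c' := dx (dy s) q.1)
      (d' := -potX s q.1 • dy s q.1) (by rw [zero_mul, add_zero]; rfl)
      (by rw [zero_mul, add_zero]; rfl) (by rw [zero_mul, add_zero]; rfl) rfl (h.dxdx_eq hq) rfl
      ((h.dxdxdy_eq hq).trans (by rw [h.dy_potX hq]; module)), Prod.mk.injEq]
    constructor <;> congr 1 <;> simp only [F, comb, Matrix.cons_val, coefX] <;> module
  · rw [fderiv_epsteinCob hk h h₀ h₁ hq (e₁, 0) (r' := β)
      (α' := μ) (β' := interp (dy (dy ρ₀)) (dy (dy ρ₁)) q) (a' := dy s q.1)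
      (b' := dx (dy s) q.1) (c' := -potY s q.1 • s q.1)
      (d' := -potY s q.1 • dx s q.1) (by rw [zero_mul, add_zero]; rfl)
      (by
        rw [zero_mul, add_zero]
        change dy (dx ρ₀) q.1 + q.2 * (dy (dx ρ₁) q.1 - dy (dx ρ₀) q.1) = μ
        rw [cm₀, cm₁]; rfl)
      (by rw [zero_mul, add_zero]; rfl) rfl (IsNormalLift.comm h.smooth hq) (h.dydy_eq hq)
      ((h.dydxdy_eq hq).trans (by rw [h.dx_potY hq]; module)), Prod.mk.injEq]
    constructor <;> congr 1 <;> simp only [F, comb, Matrix.cons_val, coefY] <;> module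
  · rw [fderiv_epsteinCob hk h h₀ h₁ hq (0, 1) (r' := f) (α' := dx ρ₁ q.1 - dx ρ₀ q.1)
      (β' := dy ρ₁ q.1 - dy ρ₀ q.1) (a' := 0) (b' := 0) (c' := 0) (d' := 0)
      (by simp [interp, f]) (by simp [interp]) (by simp [interp]) (map_zero _) (map_zero _)
      (map_zero _) (map_zero _)]
    simp only [F, comb, Matrix.cons_val]
    module

theorem fderivWithin_epsteinCob (hk : 1 ≤ k) (h : IsNormalLift ψ s)
    (h₀ : ContDiffOn ℝ (k + 1 : ℕ∞) ρ₀ annulusCover)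
    (h₁ : ContDiffOn ℝ (k + 1 : ℕ∞) ρ₁ annulusCover) {q : Space}
    (hq : q ∈ annulusCover ×ˢ Icc (0 : ℝ) 1) :
    fderivWithin ℝ (epsteinCob ρ₀ ρ₁ s) (annulusCover ×ˢ Icc (0 : ℝ) 1) q =
      fderiv ℝ (epsteinCob ρ₀ ρ₁ s) q := by
  have hopen : annulusCover ×ˢ (univ : Set ℝ) ∈ 𝓝 q :=
    (isOpen_annulusCover.prod isOpen_univ).mem_nhds ⟨hq.1, mem_univ _⟩
  exact fderivWithin_eq_fderiv (uniqueDiffOn_cobordism q hq)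
    (((contDiffOn_epsteinCob h h₀ h₁).contDiffAt hopen).differentiableAt (by
      exact_mod_cast (zero_lt_one.trans_le hk).ne'))

theorem sqrt_two_half_pow : (Real.sqrt 2 / 2) ^ 4 = 1 / 4 := by
  have := sqrt_two_half_sq
  nlinarith

theorem omegaDensity_epsteinMap (hk : 1 ≤ k) (h : IsNormalLift ψ s) {g₀ g₁ : BilinField}
    (hg₀ : IsCompatibleMetric (k + 1) g₀) (hg₁ : IsCompatibleMetric (k + 1) g₁) {q : Space}
    (hq : q ∈ annulusCover ×ˢ Icc (0 : ℝ) 1) :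
    omegaDensity (epsteinMap g₀ g₁ s) q =
      1 / 2 * (logFactor g₁ q.1 - logFactor g₀ q.1) *
        (Real.exp (2 * interp (logFactor g₀) (logFactor g₁) q) +
          2 * interp (dx (dy (logFactor g₀))) (dx (dy (logFactor g₁))) q +
          Real.exp (-2 * interp (logFactor g₀) (logFactor g₁) q) *
            (interp (dx (dy (logFactor g₀))) (dx (dy (logFactor g₁))) q ^ 2 -
              coefX (logFactor g₀) (logFactor g₁) s q * coefY (logFactor g₀) (logFactor g₁) s q)) := by
  obtain ⟨e0, ex, ey, et⟩ := epsteinCob_derivs hk h hg₀.smooth_logFactor hg₁.smooth_logFactor hq.1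
  have hv := ((h.isFrame hq.1).shear (interp (dx (logFactor g₀)) (dx (logFactor g₁)) q)
    (interp (dy (logFactor g₀)) (dy (logFactor g₁)) q)).vol
  change fderiv ℝ _ q ((1, 0), 0) = _ at ex
  change fderiv ℝ _ q ((0, 1), 0) = _ at ey
  change (fderiv ℝ (epsteinCob (logFactor g₀) (logFactor g₁) s) q ((0, 0), 1)).1 = _ at et
  rw [omegaDensity_eq, cobordismLift_epsteinMap h,
    fderivWithin_epsteinCob hk h hg₀.smooth_logFactor hg₁.smooth_logFactor hq, e0, ex, ey, et,
    vol_smul, vol_comb, hv, sqrt_two_half_pow]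
  generalize interp (logFactor g₀) (logFactor g₁) q = r
  have e1 : Real.exp (2 * r) = Real.exp r ^ 2 := by rw [← Real.exp_nat_mul]; norm_cast
  have e2 : Real.exp (-2 * r) = Real.exp (-r) ^ 2 := by rw [← Real.exp_nat_mul]; norm_num
  have e3 : Real.exp r * Real.exp (-r) = 1 := by rw [← Real.exp_add]; simp
  rw [e1, e2, vol_eq]
  simp only [Matrix.cons_val]
  generalize Real.exp r = E at *
  generalize Real.exp (-r) = E' at *
  generalize interp (dx (dy (logFactor g₀))) (dx (dy (logFactor g₁))) q = μ
  generalize coefX (logFactor g₀) (logFactor g₁) s q = U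
  generalize coefY (logFactor g₀) (logFactor g₁) s q = T
  linear_combination (1 / 2 * (logFactor g₁ q.1 - logFactor g₀ q.1)) *
    ((E + E' * μ) ^ 2 - E' ^ 2 * U * T + 2 * μ) * e3

theorem alphaDensity_epsteinMap (hk : 1 ≤ k) (h : IsNormalLift ψ s) {g₀ g₁ : BilinField}
    (hg₀ : IsCompatibleMetric (k + 1) g₀) (hg₁ : IsCompatibleMetric (k + 1) g₁) {z : ℝ × ℝ}
    (hz : z ∈ annulusCover) (t : ℝ) :
    alphaDensity (fun p => epsteinMap g₀ g₁ s p t) z =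
      -(1 / 4) * (Real.exp (2 * interp (logFactor g₀) (logFactor g₁) (z, t)) -
          Real.exp (-2 * interp (logFactor g₀) (logFactor g₁) (z, t)) *
            (interp (dx (dy (logFactor g₀))) (dx (dy (logFactor g₁))) (z, t) ^ 2 -
              coefX (logFactor g₀) (logFactor g₁) s (z, t) *
                coefY (logFactor g₀) (logFactor g₁) s (z, t))) := by
  obtain ⟨e0, ex, ey, -⟩ := epsteinCob_derivs hk h hg₀.smooth_logFactor hg₁.smooth_logFactor
    (q := (z, t)) hz
  have hv := ((h.isFrame hz).shear (interp (dx (logFactor g₀)) (dx (logFactor g₁)) (z, t))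
    (interp (dy (logFactor g₀)) (dy (logFactor g₁)) (z, t))).vol
  have hl : ∀ z t, epsteinMap g₀ g₁ s (angles z) t =
      epsteinCob (logFactor g₀) (logFactor g₁) s (z, t) := fun z t =>
    congrFun (cobordismLift_epsteinMap h g₀ g₁) (z, t)
  have hopen : annulusCover ×ˢ (univ : Set ℝ) ∈ 𝓝 (z, t) :=
    (isOpen_annulusCover.prod isOpen_univ).mem_nhds ⟨hz, mem_univ _⟩
  have hd0 : DifferentiableAt ℝ (epsteinCob (logFactor g₀) (logFactor g₁) s) (z, t) :=
    (((contDiffOn_epsteinCob h hg₀.smooth_logFactor hg₁.smooth_logFactor)).contDiffAt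
      hopen).differentiableAt (by exact_mod_cast (zero_lt_one.trans_le hk).ne')
  have hdA : ∀ u, dA (fun p => epsteinMap g₀ g₁ s p t) z u =
      fderiv ℝ (epsteinCob (logFactor g₀) (logFactor g₁) s) (z, t) (u, 0) := fun u => by
    have e : (fun p => epsteinMap g₀ g₁ s p t) ∘ angles =
        epsteinCob (logFactor g₀) (logFactor g₁) s ∘ fun z => (z, t) := funext fun z => hl z t
    rw [dA, e, (hd0.hasFDerivAt.comp z (hasFDerivAt_prodMk_left z t)).fderiv]
    rfl
  rw [alphaDensity, alphaForm, hdA, hdA, hl, e0, ex, ey, vol_smul, vol_smul, vol_comb, vol_comb,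
    hv, sqrt_two_half_pow]
  generalize interp (logFactor g₀) (logFactor g₁) (z, t) = r
  have e1 : Real.exp (2 * r) = Real.exp r ^ 2 := by rw [← Real.exp_nat_mul]; norm_cast
  have e2 : Real.exp (-2 * r) = Real.exp (-r) ^ 2 := by rw [← Real.exp_nat_mul]; norm_num
  have e3 : Real.exp r * Real.exp (-r) = 1 := by rw [← Real.exp_add]; simp
  rw [e1, e2, vol_eq, vol_eq]
  simp only [Matrix.cons_val]
  generalize Real.exp r = E at *
  generalize Real.exp (-r) = E' at *
  generalize interp (dx (dy (logFactor g₀))) (dx (dy (logFactor g₁))) (z, t) = μ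
  generalize coefX (logFactor g₀) (logFactor g₁) s (z, t) = U
  generalize coefY (logFactor g₀) (logFactor g₁) s (z, t) = T
  linear_combination (-(1 / 4) * (E ^ 2 - E' ^ 2 * (μ ^ 2 - U * T))) * e3

end Density

/-! ### The divergence theorem on the annulus -/

theorem integrableOn_fundDomain_of_core {F : ℝ × ℝ → ℝ} {m : ℝ} (hm : 0 < m)
    (hF : ContinuousOn F annulusCover) (h0 : ∀ z ∈ annulusCover, z ∉ core m → F z = 0) :
    IntegrableOn F fundDomain := by
  have hK : IsCompact ((Icc (0 : ℝ) Real.pi ×ˢ Icc (0 : ℝ) (2 * Real.pi)) ∩ core m) :=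
    (isCompact_Icc.prod isCompact_Icc).inter_right (isClosed_core m)
  refine ((hF.mono fun z hz => core_subset hm hz.2).integrableOn_compact (μ := volume)
    hK).of_forall_sdiff_eq_zero measurableSet_fundDomain fun z hz => ?_
  refine h0 z (strip_subset (fundDomain_subset_strip hz.1)) fun h => hz.2 ?_
  obtain ⟨⟨h1, h2, h3, h4⟩, -⟩ := hz
  exact ⟨⟨⟨h1, h2.le⟩, by linarith, by linarith⟩, h⟩

/-- Divergence theorem on the annulus, for functions which vanish near its ends. -/
theorem integral_fundDomain_fderiv_eq_zero {F : ℝ × ℝ → ℝ} {m : ℝ} (hm : 0 < m)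
    (hF : ContDiffOn ℝ 1 F annulusCover) (hper : AngPeriodic F)
    (h0 : ∀ z ∈ annulusCover, z ∉ core m → F z = 0) (e : ℝ × ℝ) :
    IntegrableOn (fun z => fderiv ℝ F z e) fundDomain ∧ ∫ z in fundDomain, fderiv ℝ F z e = 0 := by
  have h0' : ∀ z ∈ annulusCover, z ∉ core m → fderiv ℝ F z = 0 := fun z hz hzm => by
    have : F =ᶠ[𝓝 z] fun _ => 0 := by
      filter_upwards [annulusCover_mem_nhds hz, (isClosed_core m).isOpen_compl.mem_nhds hzm]
        with p hp hpm using h0 p hp hpm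
    rw [this.fderiv_eq]
    simp
  refine ⟨integrableOn_fundDomain_of_core hm
    (contDiffOn_fderiv_apply (m := 0) (by simp) hF e).continuousOn fun z hz hzm => by
      rw [h0' z hz hzm]; rfl, ?_⟩
  have hclosed : IsClosed ({z : ℝ × ℝ | z.1 ≤ z.2} ∩ {z : ℝ × ℝ | z.2 ≤ z.1 + Real.pi} ∩ core m) :=
    ((isClosed_le continuous_fst continuous_snd).inter
      (isClosed_le continuous_snd (continuous_fst.add continuous_const))).inter (isClosed_core m)
  have hsub : ∀ z : ℝ × ℝ, z ∈ {z : ℝ × ℝ | z.1 ≤ z.2} ∩ {z : ℝ × ℝ | z.2 ≤ z.1 + Real.pi} ∩ core m →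
      z ∈ strip := fun z hz => by
    obtain ⟨⟨h1, h2⟩, h3⟩ := hz
    have h3 := mem_annulusCover.1 (core_subset hm h3)
    refine ⟨lt_of_le_of_ne h1 fun e => h3 ?_, lt_of_le_of_ne h2 fun e => h3 ?_⟩
    · rw [e, sub_self, Real.sin_zero]
    · rw [e, add_sub_cancel_left, Real.sin_pi]
  have hin : ∀ z ∈ strip, strip.indicator F =ᶠ[𝓝 z] F := fun z hz =>
    Filter.mem_of_superset (isOpen_strip.mem_nhds hz) fun p hp => indicator_of_mem hp F
  have hout : ∀ z, z ∉ strip → strip.indicator F =ᶠ[𝓝 z] fun _ => 0 := fun z hz =>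
    Filter.mem_of_superset (hclosed.isOpen_compl.mem_nhds fun h => hz (hsub z h)) fun p hp => by
      by_cases hps : p ∈ strip
      · exact (indicator_of_mem hps F).trans
          (h0 p (strip_subset hps) fun hpm => hp ⟨⟨hps.1.le, hps.2.le⟩, hpm⟩)
      · exact indicator_of_notMem hps F
  have hC : ContDiff ℝ 1 (strip.indicator F) := contDiff_iff_contDiffAt.2 fun z => by
    by_cases hz : z ∈ strip
    · exact (hF.contDiffAt (annulusCover_mem_nhds (strip_subset hz))).congr_of_eventuallyEq (hin z hz)
    · exact contDiffAt_const.congr_of_eventuallyEq (hout z hz)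
  have key := integral_slab_fderiv_eq_zero (volume : Measure (ℝ × ℝ))
    (ContinuousLinearMap.fst ℝ ℝ ℝ) (τ := (Real.pi, Real.pi)) rfl hC (fun q => ?_)
    ⟨2 * Real.pi, fun q hq hq1 => ?_⟩ e
  · have hsplit : ∀ z, fderiv ℝ (strip.indicator F) z e =
        strip.indicator (fun z => fderiv ℝ F z e) z := fun z => by
      by_cases hz : z ∈ strip
      · rw [(hin z hz).fderiv_eq, indicator_of_mem hz]
      · rw [(hout z hz).fderiv_eq, indicator_of_notMem hz]; simp
    simp only [hsplit] at key
    rw [setIntegral_indicator isOpen_strip.measurableSet] at key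
    rw [← key]
    congr 2
    ext z
    simp only [fundDomain, slab, strip, mem_ofPred_eq, mem_inter_iff, mem_preimage, mem_Ico,
      ContinuousLinearMap.coe_fst']
    tauto
  · have hiff : q + (Real.pi, Real.pi) ∈ strip ↔ q ∈ strip := by
      simp only [strip, mem_ofPred_eq, Prod.fst_add, Prod.snd_add]
      constructor <;> rintro ⟨h1, h2⟩ <;> constructor <;> linarith
    by_cases hq : q ∈ strip
    · rw [indicator_of_mem hq, indicator_of_mem (hiff.2 hq), hper.add_pi]
    · rw [indicator_of_notMem hq, indicator_of_notMem (fun h => hq (hiff.1 h))]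
  · have hs : q ∈ strip := by
      by_contra hs
      exact hq (indicator_of_notMem hs F)
    have hq1 : |q.1| ≤ Real.pi := hq1
    have hb := abs_le.1 hq1
    rw [Prod.norm_def, Real.norm_eq_abs, Real.norm_eq_abs]
    refine max_le (by linarith [Real.pi_pos]) (abs_le.2 ⟨?_, ?_⟩) <;> linarith [hs.1, hs.2]

/-- The function `H` is `∂_e (e^{-2ρ} w ∂_e (ρ₁ - ρ₀))`, where `ρ` is the interpolation of `ρ₀` and
`ρ₁` at time `t`, and `∂_e w = 0`. -/
theorem integral_flux_eq_zero {ρ₀ ρ₁ w : ℝ × ℝ → ℝ} {m : ℝ} (hm : 0 < m)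
    (h₀ : ContDiffOn ℝ 2 ρ₀ annulusCover) (h₁ : ContDiffOn ℝ 2 ρ₁ annulusCover)
    (p₀ : AngPeriodic ρ₀) (p₁ : AngPeriodic ρ₁)
    (hc : AgreeOffCore m ρ₀ ρ₁)
    (hw : ContDiffOn ℝ 1 w annulusCover) (pw : AngPeriodic w) {e : ℝ × ℝ}
    (hwe : ∀ z ∈ annulusCover, fderiv ℝ w z e = 0) {D₀ D₁ : ℝ × ℝ → ℝ}
    (hD₀ : D₀ = fun z => fderiv ℝ ρ₀ z e) (hD₁ : D₁ = fun z => fderiv ℝ ρ₁ z e) (t : ℝ) :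
    let H := fun z => Real.exp (-2 * interp ρ₀ ρ₁ (z, t)) * (w z *
      (fderiv ℝ D₁ z e - fderiv ℝ D₀ z e - 2 * interp D₀ D₁ (z, t) * (D₁ z - D₀ z)))
    IntegrableOn H fundDomain ∧ ∫ z in fundDomain, H z = 0 := by
  intro H
  have d₀ : ContDiffOn ℝ 1 D₀ annulusCover := hD₀ ▸ contDiffOn_fderiv_apply (by norm_num) h₀ e
  have d₁ : ContDiffOn ℝ 1 D₁ annulusCover := hD₁ ▸ contDiffOn_fderiv_apply (by norm_num) h₁ e
  have q₀ : AngPeriodic D₀ := fun z z' hz => by simp only [hD₀, p₀.fderiv z z' hz]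
  have q₁ : AngPeriodic D₁ := fun z z' hz => by simp only [hD₁, p₁.fderiv z z' hz]
  set A : ℝ × ℝ → ℝ := fun z => w z * (Real.exp (-2 * interp ρ₀ ρ₁ (z, t)) * (D₁ z - D₀ z)) with hA
  have h₀' : ContDiffOn ℝ 1 ρ₀ annulusCover := h₀.of_le one_le_two
  have h₁' : ContDiffOn ℝ 1 ρ₁ annulusCover := h₁.of_le one_le_two
  have hAs : ContDiffOn ℝ 1 A annulusCover :=
    hw.mul ((contDiffOn_const.mul (h₀'.add (contDiffOn_const.mul (h₁'.sub h₀')))).exp.mul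
      (d₁.sub d₀))
  obtain ⟨hi, hz⟩ := integral_fundDomain_fderiv_eq_zero hm hAs (fun z z' h => by
    simp only [hA, interp, pw z z' h, p₀ z z' h, p₁ z z' h, q₀ z z' h, q₁ z z' h])
    (fun z hz hzm => by
      simp only [hA, hD₀, hD₁, (hc hz hzm).fderiv_eq]; ring) e
  have heq : EqOn (fun z => fderiv ℝ A z e) H fundDomain := fun z hz => by
    have hz := strip_subset (fundDomain_subset_strip hz)
    have lw := hasDerivAt_line (differentiableAt_cover le_rfl hw hz) e
    have l₀ := hasDerivAt_line (differentiableAt_cover le_rfl d₀ hz) e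
    have l₁ := hasDerivAt_line (differentiableAt_cover le_rfl d₁ hz) e
    have r₀ := hasDerivAt_line (differentiableAt_cover le_rfl h₀' hz) e
    have r₁ := hasDerivAt_line (differentiableAt_cover le_rfl h₁' hz) e
    have key := lw.mul ((((r₀.add ((r₁.sub r₀).const_mul t)).const_mul (-2)).exp).mul (l₁.sub l₀))
    have e1 := (hasDerivAt_line (differentiableAt_cover le_rfl hAs hz) e).unique key
    refine e1.trans ?_
    simp only [zero_smul, add_zero, hwe z hz, Pi.mul_apply, Pi.add_apply, Pi.sub_apply, H, interp]
    have f₀ : fderiv ℝ ρ₀ z e = D₀ z := by rw [hD₀]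
    have f₁ : fderiv ℝ ρ₁ z e = D₁ z := by rw [hD₁]
    rw [f₀, f₁]
    ring
  exact ⟨hi.congr_fun heq measurableSet_fundDomain,
    (setIntegral_congr_fun measurableSet_fundDomain heq).symm.trans hz⟩

/-! ### Independence of the immersion -/

theorem continuousOn_fst_comp {F : ℝ × ℝ → ℝ} {n : WithTop ℕ∞} (hF : ContDiffOn ℝ n F annulusCover)
    (I : Set ℝ) : ContinuousOn (fun q : Space => F q.1) (annulusCover ×ˢ I) :=
  hF.continuousOn.comp continuousOn_fst fun _ hq => hq.1

theorem continuousOn_interp {f₀ f₁ : ℝ × ℝ → ℝ} {n : WithTop ℕ∞}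
    (h₀ : ContDiffOn ℝ n f₀ annulusCover) (h₁ : ContDiffOn ℝ n f₁ annulusCover) (I : Set ℝ) :
    ContinuousOn (interp f₀ f₁) (annulusCover ×ˢ I) :=
  (continuousOn_fst_comp h₀ I).add
    (continuousOn_snd.mul ((continuousOn_fst_comp h₁ I).sub (continuousOn_fst_comp h₀ I)))

theorem hasDerivAt_interp (f₀ f₁ : ℝ × ℝ → ℝ) (z : ℝ × ℝ) (t : ℝ) :
    HasDerivAt (fun t => interp f₀ f₁ (z, t)) (f₁ z - f₀ z) t := by
  simpa [interp] using ((hasDerivAt_id t).mul_const (f₁ z - f₀ z)).const_add (f₀ z)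

theorem two_le_coe_add_one {k : ℕ∞} (hk : 1 ≤ k) : (2 : WithTop ℕ∞) ≤ (k + 1 : ℕ∞) := by
  have : (1 : ℕ∞) + 1 ≤ k + 1 := by gcongr
  rw [one_add_one_eq_two] at this
  exact WithTop.coe_le_coe.2 this

/-- Functions which agree near a point have the same `2`-jet there. -/
theorem AgreeOffCore.jets {m : ℝ} {ρ₀ ρ₁ : ℝ × ℝ → ℝ} (h : AgreeOffCore m ρ₀ ρ₁) {z : ℝ × ℝ}
    (hz : z ∈ annulusCover) (hzm : z ∉ core m) :
    ρ₁ z = ρ₀ z ∧ dx ρ₁ z = dx ρ₀ z ∧ dy ρ₁ z = dy ρ₀ z ∧ dx (dx ρ₁) z = dx (dx ρ₀) z ∧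
      dy (dy ρ₁) z = dy (dy ρ₀) z ∧ dx (dy ρ₁) z = dx (dy ρ₀) z :=
  have e := h hz hzm
  ⟨e.self_of_nhds, (dx_congr e).self_of_nhds, (dy_congr e).self_of_nhds,
    (dx_congr (dx_congr e)).self_of_nhds, (dy_congr (dy_congr e)).self_of_nhds,
    (dx_congr (dy_congr e)).self_of_nhds⟩

section Independence
variable {ψ ψ' : RP1 × RP1 → Projectivization ℝ W} {s s' : ℝ × ℝ → W} {ρ₀ ρ₁ : ℝ × ℝ → ℝ} {k : ℕ∞}

/-- The difference of the densities of `-α` for two normal lifts, at the intermediate surfaces. -/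
def alphaGap (ρ₀ ρ₁ : ℝ × ℝ → ℝ) (s s' : ℝ × ℝ → W) (q : Space) : ℝ :=
  1 / 4 * (Real.exp (-2 * interp ρ₀ ρ₁ q) *
    (coefX ρ₀ ρ₁ s q * coefY ρ₀ ρ₁ s q - coefX ρ₀ ρ₁ s' q * coefY ρ₀ ρ₁ s' q))

/-- The function `∂_x (e^{-2ρ} (Q - Q') ∂_x (ρ₁ - ρ₀))`, expanded by means of `∂_x Q = ∂_x Q' = 0`. -/
def fluxX (ρ₀ ρ₁ : ℝ × ℝ → ℝ) (s s' : ℝ × ℝ → W) (q : Space) : ℝ :=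
  Real.exp (-2 * interp ρ₀ ρ₁ q) * ((potY s q.1 - potY s' q.1) *
    (dx (dx ρ₁) q.1 - dx (dx ρ₀) q.1 - 2 * interp (dx ρ₀) (dx ρ₁) q * (dx ρ₁ q.1 - dx ρ₀ q.1)))

/-- The function `∂_y (e^{-2ρ} (q - q') ∂_y (ρ₁ - ρ₀))`, expanded by means of `∂_y q = ∂_y q' = 0`. -/
def fluxY (ρ₀ ρ₁ : ℝ × ℝ → ℝ) (s s' : ℝ × ℝ → W) (q : Space) : ℝ :=
  Real.exp (-2 * interp ρ₀ ρ₁ q) * ((potX s q.1 - potX s' q.1) *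
    (dy (dy ρ₁) q.1 - dy (dy ρ₀) q.1 - 2 * interp (dy ρ₀) (dy ρ₁) q * (dy ρ₁ q.1 - dy ρ₀ q.1)))

/-- The first term on the right is the difference of the densities of `ω`, so that the two parts of
the `W`-volume compensate up to a divergence. -/
theorem hasDerivAt_alphaGap (ρ₀ ρ₁ : ℝ × ℝ → ℝ) (s s' : ℝ × ℝ → W) (z : ℝ × ℝ) (t : ℝ) :
    HasDerivAt (fun t => alphaGap ρ₀ ρ₁ s s' (z, t))
      (-2 * (ρ₁ z - ρ₀ z) * alphaGap ρ₀ ρ₁ s s' (z, t) -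
        1 / 4 * (fluxX ρ₀ ρ₁ s s' (z, t) + fluxY ρ₀ ρ₁ s s' (z, t))) t := by
  have hU := fun s : ℝ × ℝ → W => ((hasDerivAt_interp (dx (dx ρ₀)) (dx (dx ρ₁)) z t).sub
    ((hasDerivAt_interp (dx ρ₀) (dx ρ₁) z t).pow 2)).sub_const (potX s z)
  have hT := fun s : ℝ × ℝ → W => ((hasDerivAt_interp (dy (dy ρ₀)) (dy (dy ρ₁)) z t).sub
    ((hasDerivAt_interp (dy ρ₀) (dy ρ₁) z t).pow 2)).sub_const (potY s z)
  refine HasDerivAt.congr_deriv ((((hasDerivAt_interp ρ₀ ρ₁ z t).const_mul (-2)).exp.mul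
    (((hU s).mul (hT s)).sub ((hU s').mul (hT s')))).const_mul (1 / 4)) ?_
  simp only [alphaGap, fluxX, fluxY, coefX, coefY, Pi.sub_apply, Pi.pow_apply, Pi.mul_apply]
  ring

theorem integrableOn_alphaDensity_sub (hk : 1 ≤ k) {g₀ g₁ : BilinField}
    (hg₀ : IsCompatibleMetric (k + 1) g₀) (hg₁ : IsCompatibleMetric (k + 1) g₁)
    (hg : EqualOutsideCompact g₀ g₁) (h : IsNormalLift ψ s) :
    IntegrableOn (fun z => alphaDensity (fun p => epsteinMap g₀ g₁ s p 0) z -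
      alphaDensity (fun p => epsteinMap g₀ g₁ s p 1) z) fundDomain := by
  obtain ⟨m, hm, hc⟩ := hg.exists_agree
  have ha := fun z hz => alphaDensity_epsteinMap (z := z) hk h hg₀ hg₁ hz
  have s₀ := hg₀.smooth_logFactor.of_le (two_le_coe_add_one hk)
  have s₁ := hg₁.smooth_logFactor.of_le (two_le_coe_add_one hk)
  have dx₀ := contDiffOn_dx (m := 1) (by norm_num) s₀
  have dx₁ := contDiffOn_dx (m := 1) (by norm_num) s₁
  have dy₀ := contDiffOn_dy (m := 1) (by norm_num) s₀
  have dy₁ := contDiffOn_dy (m := 1) (by norm_num) s₁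
  have hi : ∀ t, ContinuousOn (fun z => alphaDensity (fun p => epsteinMap g₀ g₁ s p t) z)
      annulusCover := fun t => by
    have hz : ContinuousOn (fun z : ℝ × ℝ => (z, t)) annulusCover := by fun_prop
    have hmap : MapsTo (fun z : ℝ × ℝ => (z, t)) annulusCover (annulusCover ×ˢ univ) :=
      fun z hz => ⟨hz, mem_univ _⟩
    refine ContinuousOn.congr ?_ fun z hz => ha z hz t
    have c1 := (continuousOn_interp s₀ s₁ univ).comp hz hmap
    have c2 := (continuousOn_interp (contDiffOn_dx (m := 0) (by norm_num) dy₀)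
      (contDiffOn_dx (m := 0) (by norm_num) dy₁) univ).comp hz hmap
    have c3 := ((((continuousOn_interp (contDiffOn_dx (m := 0) (by norm_num) dx₀)
      (contDiffOn_dx (m := 0) (by norm_num) dx₁) univ).sub
      ((continuousOn_interp dx₀ dx₁ univ).pow 2)).sub
      (continuousOn_fst_comp h.smooth_potX univ))).comp hz hmap
    have c4 := ((((continuousOn_interp (contDiffOn_dy (m := 0) (by norm_num) dy₀)
      (contDiffOn_dy (m := 0) (by norm_num) dy₁) univ).sub
      ((continuousOn_interp dy₀ dy₁ univ).pow 2)).sub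
      (continuousOn_fst_comp h.smooth_potY univ))).comp hz hmap
    exact continuousOn_const.mul ((continuousOn_const.mul c1).rexp.sub
      ((continuousOn_const.mul c1).rexp.mul ((c2.pow 2).sub (c3.mul c4))))
  refine integrableOn_fundDomain_of_core hm ((hi 0).sub (hi 1)) fun z hz hzm => ?_
  obtain ⟨o1, o2, o3, o4, o5, o6⟩ := hc.jets hz hzm
  rw [ha z hz, ha z hz]
  simp only [interp, coefX, coefY, o1, o2, o3, o4, o5, o6, sub_self, mul_zero]

/-- The `W`-volume does not depend on the immersion. -/
theorem wVolume_epsteinMap_eq (hk : 1 ≤ k) {g₀ g₁ : BilinField}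
    (hg₀ : IsCompatibleMetric (k + 1) g₀) (hg₁ : IsCompatibleMetric (k + 1) g₁)
    (hg : EqualOutsideCompact g₀ g₁) (h : IsNormalLift ψ s) (h' : IsNormalLift ψ' s') :
    wVolume (epsteinMap g₀ g₁ s) = wVolume (epsteinMap g₀ g₁ s') := by
  obtain ⟨m, hm, hc⟩ := hg.exists_agree
  have hl := (isEpsteinCobordism_epsteinMap hk hg₀ hg₁ hg h).lens
  have hl' := (isEpsteinCobordism_epsteinMap hk hg₀ hg₁ hg h').lens
  have hw := fun z hz => omegaDensity_epsteinMap (q := z) hk h hg₀ hg₁ hz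
  have hw' := fun z hz => omegaDensity_epsteinMap (q := z) hk h' hg₀ hg₁ hz
  have ha := fun z hz => alphaDensity_epsteinMap (z := z) hk h hg₀ hg₁ hz
  have ha' := fun z hz => alphaDensity_epsteinMap (z := z) hk h' hg₀ hg₁ hz
  have hC2 := two_le_coe_add_one hk
  have s₀ : ContDiffOn ℝ 2 (logFactor g₀) annulusCover := hg₀.smooth_logFactor.of_le hC2
  have s₁ : ContDiffOn ℝ 2 (logFactor g₁) annulusCover := hg₁.smooth_logFactor.of_le hC2
  have p₀ := logFactor_per g₀
  have p₁ := logFactor_per g₁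
  set ρ₀ := logFactor g₀
  set ρ₁ := logFactor g₁
  have dx₀ : ContDiffOn ℝ 1 (dx ρ₀) annulusCover := contDiffOn_dx (by norm_num) s₀
  have dx₁ : ContDiffOn ℝ 1 (dx ρ₁) annulusCover := contDiffOn_dx (by norm_num) s₁
  have dy₀ : ContDiffOn ℝ 1 (dy ρ₀) annulusCover := contDiffOn_dy (by norm_num) s₀
  have dy₁ : ContDiffOn ℝ 1 (dy ρ₁) annulusCover := contDiffOn_dy (by norm_num) s₁
  have dxx₀ : ContDiffOn ℝ 0 (dx (dx ρ₀)) annulusCover := contDiffOn_dx (by norm_num) dx₀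
  have dxx₁ : ContDiffOn ℝ 0 (dx (dx ρ₁)) annulusCover := contDiffOn_dx (by norm_num) dx₁
  have dyy₀ : ContDiffOn ℝ 0 (dy (dy ρ₀)) annulusCover := contDiffOn_dy (by norm_num) dy₀
  have dyy₁ : ContDiffOn ℝ 0 (dy (dy ρ₁)) annulusCover := contDiffOn_dy (by norm_num) dy₁
  have dxy₀ : ContDiffOn ℝ 0 (dx (dy ρ₀)) annulusCover := contDiffOn_dx (by norm_num) dy₀
  have dxy₁ : ContDiffOn ℝ 0 (dx (dy ρ₁)) annulusCover := contDiffOn_dx (by norm_num) dy₁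
  -- integrability of the densities
  have cΩ := hl.continuousOn_omegaDensity hk
  have cΩ' := hl'.continuousOn_omegaDensity hk
  have iΩ : IntegrableOn (omegaDensity (epsteinMap g₀ g₁ s)) (fundDomain ×ˢ Icc 0 1) :=
    integrableOn_of_core hm cΩ fun q hq hqm => by
      rw [hw q hq, (hc hq.1 hqm).self_of_nhds]; ring
  have iΩ' : IntegrableOn (omegaDensity (epsteinMap g₀ g₁ s')) (fundDomain ×ˢ Icc 0 1) :=
    integrableOn_of_core hm cΩ' fun q hq hqm => by
      rw [hw' q hq, (hc hq.1 hqm).self_of_nhds]; ring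
  have iX : IntegrableOn (fluxX ρ₀ ρ₁ s s') (fundDomain ×ˢ Icc 0 1) := by
    refine integrableOn_of_core hm ?_ fun q hq hqm => ?_
    · exact (continuousOn_const.mul (continuousOn_interp s₀ s₁ _)).rexp.mul
        (((continuousOn_fst_comp h.smooth_potY _).sub (continuousOn_fst_comp h'.smooth_potY _)).mul
        (((continuousOn_fst_comp dxx₁ _).sub (continuousOn_fst_comp dxx₀ _)).sub
        ((continuousOn_const.mul (continuousOn_interp dx₀ dx₁ _)).mul
        ((continuousOn_fst_comp dx₁ _).sub (continuousOn_fst_comp dx₀ _)))))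
    · obtain ⟨o1, o2, o3, o4, o5, o6⟩ := hc.jets hq.1 hqm
      simp only [fluxX, o2, o4]; ring
  have iY : IntegrableOn (fluxY ρ₀ ρ₁ s s') (fundDomain ×ˢ Icc 0 1) := by
    refine integrableOn_of_core hm ?_ fun q hq hqm => ?_
    · exact (continuousOn_const.mul (continuousOn_interp s₀ s₁ _)).rexp.mul
        (((continuousOn_fst_comp h.smooth_potX _).sub (continuousOn_fst_comp h'.smooth_potX _)).mul
        (((continuousOn_fst_comp dyy₁ _).sub (continuousOn_fst_comp dyy₀ _)).sub
        ((continuousOn_const.mul (continuousOn_interp dy₀ dy₁ _)).mul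
        ((continuousOn_fst_comp dy₁ _).sub (continuousOn_fst_comp dy₀ _)))))
    · obtain ⟨o1, o2, o3, o4, o5, o6⟩ := hc.jets hq.1 hqm
      simp only [fluxY, o3, o5]; ring
  have hΩ : ∀ q ∈ annulusCover ×ˢ Icc (0 : ℝ) 1, omegaDensity (epsteinMap g₀ g₁ s) q -
      omegaDensity (epsteinMap g₀ g₁ s') q = -2 * (ρ₁ q.1 - ρ₀ q.1) * alphaGap ρ₀ ρ₁ s s' q :=
    fun q hq => by rw [hw q hq, hw' q hq, alphaGap]; ring
  have hsub : fundDomain ×ˢ Icc (0 : ℝ) 1 ⊆ annulusCover ×ˢ Icc (0 : ℝ) 1 :=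
    prod_mono_left (fundDomain_subset_strip.trans strip_subset)
  -- the fluxes vanish at all times
  have zero_of : ∀ {H : Space → ℝ}, IntegrableOn H (fundDomain ×ˢ Icc 0 1) →
      (∀ t, ∫ z in fundDomain, H (z, t) = 0) → ∫ q in fundDomain ×ˢ Icc (0 : ℝ) 1, H q = 0 :=
    fun {H} hi h0 => by
      have hi' : Integrable H ((volume.restrict fundDomain).prod (volume.restrict (Icc (0 : ℝ) 1))) := by
        rw [Measure.prod_restrict]; exact hi
      have := integral_prod_symm H hi'
      rw [Measure.prod_restrict] at this
      refine Eq.trans this ?_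
      simp only [h0, integral_zero]
  have zX : ∫ q in fundDomain ×ˢ Icc (0 : ℝ) 1, fluxX ρ₀ ρ₁ s s' q = 0 := zero_of iX fun t =>
    (integral_flux_eq_zero hm s₀ s₁ p₀ p₁ hc (w := fun z => potY s z - potY s' z)
      ((h.smooth_potY.sub h'.smooth_potY).of_le (by exact_mod_cast le_top))
      (fun z z' e => by simp only [h.potY_per z z' e, h'.potY_per z z' e]) (e := e₂) (fun z hz => by
        rw [fderiv_fun_sub (differentiableAt_cover (by simp) h.smooth_potY hz)
          (differentiableAt_cover (by simp) h'.smooth_potY hz)]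
        exact (congrArg₂ (· - ·) (h.dx_potY hz) (h'.dx_potY hz)).trans (sub_zero 0))
      rfl rfl t).2
  have zY : ∫ q in fundDomain ×ˢ Icc (0 : ℝ) 1, fluxY ρ₀ ρ₁ s s' q = 0 := zero_of iY fun t =>
    (integral_flux_eq_zero hm s₀ s₁ p₀ p₁ hc (w := fun z => potX s z - potX s' z)
      ((h.smooth_potX.sub h'.smooth_potX).of_le (by exact_mod_cast le_top))
      (fun z z' e => by simp only [h.potX_per z z' e, h'.potX_per z z' e]) (e := e₁) (fun z hz => by
        rw [fderiv_fun_sub (differentiableAt_cover (by simp) h.smooth_potX hz)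
          (differentiableAt_cover (by simp) h'.smooth_potX hz)]
        exact (congrArg₂ (· - ·) (h.dy_potX hz) (h'.dy_potX hz)).trans (sub_zero 0))
      rfl rfl t).2
  -- the boundary terms, by the fundamental theorem of calculus in `t`
  have iN := (iΩ.sub iΩ').sub ((iX.add iY).const_mul (1 / 4))
  have hN : ∀ z ∈ fundDomain, ∫ t in Icc (0 : ℝ) 1,
      (omegaDensity (epsteinMap g₀ g₁ s) (z, t) - omegaDensity (epsteinMap g₀ g₁ s') (z, t) -
        1 / 4 * (fluxX ρ₀ ρ₁ s s' (z, t) + fluxY ρ₀ ρ₁ s s' (z, t))) =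
      (alphaDensity (fun p => epsteinMap g₀ g₁ s p 0) z -
        alphaDensity (fun p => epsteinMap g₀ g₁ s p 1) z) -
      (alphaDensity (fun p => epsteinMap g₀ g₁ s' p 0) z -
        alphaDensity (fun p => epsteinMap g₀ g₁ s' p 1) z) := fun z hz => by
    have hz' := strip_subset (fundDomain_subset_strip hz)
    have hcont : Continuous fun t => -2 * (ρ₁ z - ρ₀ z) * alphaGap ρ₀ ρ₁ s s' (z, t) -
        1 / 4 * (fluxX ρ₀ ρ₁ s s' (z, t) + fluxY ρ₀ ρ₁ s s' (z, t)) := by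
      simp only [alphaGap, fluxX, fluxY, coefX, coefY, interp]
      fun_prop
    have ftc := intervalIntegral.integral_eq_sub_of_hasDerivAt
      (fun t _ => hasDerivAt_alphaGap ρ₀ ρ₁ s s' z t) (hcont.intervalIntegrable 0 1)
    rw [intervalIntegral.integral_of_le zero_le_one, ← integral_Icc_eq_integral_Ioc] at ftc
    rw [ha z hz' 0, ha z hz' 1, ha' z hz' 0, ha' z hz' 1]
    refine Eq.trans ?_ (ftc.trans ?_)
    · refine setIntegral_congr_fun measurableSet_Icc fun t ht => ?_
      rw [hΩ (z, t) ⟨hz', ht⟩]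
    · simp only [alphaGap]; ring
  have hB : ∫ q in fundDomain ×ˢ Icc (0 : ℝ) 1,
      (omegaDensity (epsteinMap g₀ g₁ s) q - omegaDensity (epsteinMap g₀ g₁ s') q -
        1 / 4 * (fluxX ρ₀ ρ₁ s s' q + fluxY ρ₀ ρ₁ s s' q)) =
      (∫ z in fundDomain, (alphaDensity (fun p => epsteinMap g₀ g₁ s p 0) z -
        alphaDensity (fun p => epsteinMap g₀ g₁ s p 1) z)) -
      ∫ z in fundDomain, (alphaDensity (fun p => epsteinMap g₀ g₁ s' p 0) z -
        alphaDensity (fun p => epsteinMap g₀ g₁ s' p 1) z) := by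
    rw [← integral_sub (integrableOn_alphaDensity_sub hk hg₀ hg₁ hg h)
      (integrableOn_alphaDensity_sub hk hg₀ hg₁ hg h')]
    exact (setIntegral_prod _ iN).trans (setIntegral_congr_fun measurableSet_fundDomain hN)
  have e1 := (integral_sub (iΩ.sub iΩ') ((iX.add iY).const_mul (1 / 4))).symm.trans hB
  have e2 := integral_add iX iY
  rw [integral_const_mul, integral_sub' iΩ iΩ'] at e1
  rw [zX, zY, add_zero] at e2
  rw [wVolume, wVolume]
  simp only [Pi.add_apply] at e1
  linarith

end Independence

/-! ### The inclusion of the annulus in the Einstein torus -/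

/-- The vector of angle `t`. -/
def circleVec (t : ℝ) : V := ![Real.cos t, Real.sin t]

/-- The standard lift of the inclusion of the annulus in the Einstein torus. -/
def segreLift (z : ℝ × ℝ) : W := tensor (circleVec z.1) (circleVec z.2)

theorem segre_angles (z : ℝ × ℝ) : ∃ h : segreLift z ≠ 0,
    segre (angles z).1 (angles z).2 = Projectivization.mk ℝ (segreLift z) h := by
  have h : segreLift z ≠ 0 := tensor_ne_zero (cos_sin_ne_zero _) (cos_sin_ne_zero _)
  refine ⟨h, (Projectivization.mk_eq_mk_iff' ℝ _ _ _ h).2 ?_⟩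
  obtain ⟨a, ha⟩ := Projectivization.exists_smul_eq_mk_rep ℝ _ (cos_sin_ne_zero z.1)
  obtain ⟨b, hb⟩ := Projectivization.exists_smul_eq_mk_rep ℝ _ (cos_sin_ne_zero z.2)
  refine ⟨a * b, ?_⟩
  simp only [angles, angle, ← ha, ← hb, segreLift, circleVec]
  ext i
  fin_cases i <;> simp [tensor, Units.smul_def] <;> ring

theorem contDiff_segreLift : ContDiff ℝ ∞ segreLift := by
  rw [contDiff_pi]
  intro i
  fin_cases i <;> simp [segreLift, tensor, circleVec] <;> fun_prop

theorem dy_segreLift (z : ℝ × ℝ) :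
    dy segreLift z = tensor (circleVec z.1) ![-Real.sin z.2, Real.cos z.2] := by
  have h := hasDerivAt_line ((contDiff_segreLift.differentiable (by simp)) z) e₁
  refine h.unique (hasDerivAt_pi.2 fun i => ?_)
  have hc : HasDerivAt (fun τ : ℝ => Real.cos (z.2 + τ)) (-Real.sin z.2) 0 := by
    simpa using ((hasDerivAt_id (0 : ℝ)).const_add z.2).cos
  have hs : HasDerivAt (fun τ : ℝ => Real.sin (z.2 + τ)) (Real.cos z.2) 0 := by
    simpa using ((hasDerivAt_id (0 : ℝ)).const_add z.2).sin
  fin_cases i <;> simp only [segreLift, tensor, circleVec, e₁] <;> simp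
  · simpa using hc.const_mul (Real.cos z.1)
  · simpa using hs.const_mul (Real.cos z.1)
  · simpa using hc.const_mul (Real.sin z.1)
  · simpa using hs.const_mul (Real.sin z.1)

theorem dx_segreLift (z : ℝ × ℝ) :
    dx segreLift z = tensor ![-Real.sin z.1, Real.cos z.1] (circleVec z.2) := by
  have h := hasDerivAt_line ((contDiff_segreLift.differentiable (by simp)) z) e₂
  refine h.unique (hasDerivAt_pi.2 fun i => ?_)
  have hc : HasDerivAt (fun τ : ℝ => Real.cos (z.1 + τ)) (-Real.sin z.1) 0 := by
    simpa using ((hasDerivAt_id (0 : ℝ)).const_add z.1).cos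
  have hs : HasDerivAt (fun τ : ℝ => Real.sin (z.1 + τ)) (Real.cos z.1) 0 := by
    simpa using ((hasDerivAt_id (0 : ℝ)).const_add z.1).sin
  fin_cases i <;> simp only [segreLift, tensor, circleVec, e₂] <;> simp
  · simpa using hc.mul_const (Real.cos z.2)
  · simpa using hc.mul_const (Real.sin z.2)
  · simpa using hs.mul_const (Real.cos z.2)
  · simpa using hs.mul_const (Real.sin z.2)

theorem areaV_self (v : V) : areaV v v = 0 := by simp [areaV]; ring

theorem isSplitImmersion_segre : IsSplitImmersion fun p => segre p.1 p.2 where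
  mem_ein p _ w hw := by
    rw [segre, Projectivization.submodule_mk, Submodule.mem_span_singleton] at hw
    obtain ⟨c, rfl⟩ := hw
    rw [form_smul_left, form_smul_right, form_tensor, areaV_self]
    ring
  immersion z _ := by
    have hxy : form (dx segreLift z) (dy segreLift z) = 1 := by
      rw [dx_segreLift, dy_segreLift, form_tensor]
      simp only [areaV, circleVec, Matrix.cons_val]
      linear_combination (Real.sin z.2 ^ 2 + Real.cos z.2 ^ 2) * Real.sin_sq_add_cos_sq z.1 +
        Real.sin_sq_add_cos_sq z.2
    refine ⟨segreLift, Eventually.of_forall fun z' =>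
      ⟨contDiff_segreLift.contDiffAt, segre_angles z'⟩, ?_, ?_⟩
    · change LinearIndependent ℝ ![segreLift z, dy segreLift z, dx segreLift z]
      refine linearIndependent_of_null (segre_angles z).1 ?_ ?_ ?_ ?_ ?_
      · rw [dy_segreLift, segreLift, form_tensor, areaV_self]; ring
      · rw [dx_segreLift, segreLift, form_tensor, areaV_self]; ring
      · rw [dy_segreLift, form_tensor, areaV_self]; ring
      · rw [dx_segreLift, form_tensor, areaV_self]; ring
      · rw [form_comm, hxy]; exact one_ne_zero
    · change 0 < form (dy segreLift z) (dx segreLift z)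
      rw [form_comm, hxy]
      exact one_pos
  leaf₁ a := ⟨a, fun b _ => ⟨b, rfl⟩⟩
  leaf₂ b := ⟨b, fun a _ => ⟨a, rfl⟩⟩

theorem circleVec_add (t δ : ℝ) (h : Real.sin δ = 0) :
    circleVec (t + δ) = Real.cos δ • circleVec t := by
  ext i
  fin_cases i <;> simp [circleVec, Real.cos_add, Real.sin_add, h] <;> ring

/-- The factor `sin (y - x)` changes sign together with the standard lift, so that the product
descends to the annulus. -/
theorem angPeriodic_section :
    AngPeriodic fun z : ℝ × ℝ => Real.sin (z.2 - z.1) • segreLift z := by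
  intro z z' h
  obtain ⟨h1, h2⟩ := angles_eq_iff.1 h
  obtain ⟨a, ha⟩ : ∃ a, z'.1 = z.1 + a := ⟨z'.1 - z.1, by ring⟩
  obtain ⟨b, hb⟩ : ∃ b, z'.2 = z.2 + b := ⟨z'.2 - z.2, by ring⟩
  rw [ha, add_sub_cancel_left] at h1
  rw [hb, add_sub_cancel_left] at h2
  have e1 := Real.sin_sq_add_cos_sq a
  have e2 := Real.sin_sq_add_cos_sq b
  rw [h1] at e1
  rw [h2] at e2
  have es : Real.sin (z.2 + b - (z.1 + a)) = Real.cos a * Real.cos b * Real.sin (z.2 - z.1) := by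
    rw [show z.2 + b - (z.1 + a) = (z.2 - z.1) + (b - a) by ring, Real.sin_add,
      Real.cos_sub b a, Real.sin_sub b a, h1, h2]
    ring
  have et : tensor (Real.cos a • circleVec z.1) (Real.cos b • circleVec z.2) =
      (Real.cos a * Real.cos b) • segreLift z := by
    ext i
    fin_cases i <;> simp [tensor, segreLift] <;> ring
  simp only
  rw [segreLift.eq_def z', ha, hb, es, circleVec_add _ _ h1, circleVec_add _ _ h2, et, smul_smul]
  congr 1
  linear_combination -(Real.sin (z.2 - z.1)) * ((Real.cos b) ^ 2 * e1 + e2)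

/-- The factor `sin (y - x)` of the section does not vanish on the annulus. -/
theorem tautologicalTrivial_segre : TautologicalTrivial fun p => segre p.1 p.2 := by
  refine ⟨fun p => Real.sin ((coords p).2 - (coords p).1) • segreLift (coords p), ?_,
    fun p hp => ?_⟩
  · have e := angPeriodic_section.comp_coords_comp
    rw [e]
    have := contDiff_segreLift.continuous
    fun_prop
  · obtain ⟨h, e⟩ := segre_angles (coords p)
    have hs := mem_annulusCover.1 (coords_mem hp)
    rw [angles_coords] at e
    refine ⟨smul_ne_zero hs h, e.trans ((Projectivization.mk_eq_mk_iff' ℝ _ _ h _).2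
      ⟨(Real.sin ((coords p).2 - (coords p).1))⁻¹, ?_⟩)⟩
    rw [smul_smul, inv_mul_cancel₀ hs, one_smul]

end AdS

end

theorem mainTheorem6 (k : ℕ∞) (hk : 1 ≤ k) (g₀ g₁ : AdS.BilinField)
    (hg₀ : AdS.IsCompatibleMetric (k + 1) g₀) (hg₁ : AdS.IsCompatibleMetric (k + 1) g₁)
    (hg : AdS.EqualOutsideCompact g₀ g₁) :
    ∃! S : ℝ, ∀ ψ : AdS.RP1 × AdS.RP1 → Projectivization ℝ AdS.W,
      AdS.IsSplitImmersion ψ → AdS.TautologicalTrivial ψ →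
        (∃ φ, AdS.IsEpsteinCobordism k ψ g₀ g₁ φ) ∧
          ∀ φ, AdS.IsEpsteinCobordism k ψ g₀ g₁ φ → AdS.wVolume φ = S := by
  obtain ⟨s₀, hs₀⟩ :=
    AdS.exists_normalLift AdS.isSplitImmersion_segre AdS.tautologicalTrivial_segre
  refine ⟨AdS.wVolume (AdS.epsteinMap g₀ g₁ s₀), fun ψ hψ hτ => ?_, fun S hS =>
    ((hS _ AdS.isSplitImmersion_segre AdS.tautologicalTrivial_segre).2 _
      (AdS.isEpsteinCobordism_epsteinMap hk hg₀ hg₁ hg hs₀)).symm⟩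
  obtain ⟨s, hs⟩ := AdS.exists_normalLift hψ hτ
  exact ⟨⟨_, AdS.isEpsteinCobordism_epsteinMap hk hg₀ hg₁ hg hs⟩, fun φ hφ =>
    (AdS.wVolume_eq hk hg₀ hg₁ hg hs hφ).trans
      (AdS.wVolume_epsteinMap_eq hk hg₀ hg₁ hg hs hs₀)⟩
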